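/- Let $A$ be a C*-algebra (not necessarily unital). Its double dual $A^{**}$ is a von Neumann algebra; write $\mathcal Z(A^{**})$ for its center. Every automorphism $\theta$ of $A$ induces an automorphism $\theta^{**}$ of $A^{**}$ (its bitranspose), and $\theta$ is called universally weakly inner if $\theta^{**}$ is inner, i.e. $\theta^{**}(x)=uxu^*$ for all $x\in A^{**}$, for some unitary $u\in A^{**}$. An action $\alpha:\Gamma\curvearrowright A$ of a discrete group $\Gamma$ is called amenable if there is a conditional expectation $E:\ell^\infty(\Gamma,\mathcal Z(A^{**}))\to\mathcal Z(A^{**})$, where $\mathcal Z(A^{**})$ is embedded as the constant functions, that is $\Gamma$-equivariant with respect to the action $(g\cdot f)(h)=\alpha_g^{**}(f(g^{-1}h))$ on $\ell^\infty(\Gamma,\mathcal Z(A^{**}))$ and the action $\alpha^{**}$ on $\mathcal Z(A^{**})$. For a non-empty set $I$, equip the finitely supported maps $I\to A$ with the $A$-valued inner product $\langle\xi\mid\eta\rangle=\sum_{j\in I}\xi(j)^*\eta(j)$ and the norm $\|\xi\|_2=\|\langle\xi\mid\xi\rangle\|^{1/2}$, and let $\ell^2(I,A)$ be the completion with respect to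 $\|\cdot\|_2$, i.e. the space of all $\xi:I\to A$ for which $\sum_j\xi(j)^*\xi(j)$ converges unconditionally in norm. For $a\in A$ and $\xi\in\ell^2(I,A)$ put $(a\xi)(j)=a\,\xi(j)$ and $(\xi a)(j)=\xi(j)\,a$. **Lemma.** Let $\alpha:\Gamma\curvearrowright A$ be an action of a discrete group on a C*-algebra, and let $N\subseteq\Gamma$ be a normal subgroup such that $\alpha_g$ is universally weakly inner for every $g\in N$. Let $\bar\alpha:\Gamma\curvearrowright\ell^2(\Gamma/N,A)$ be the action $\bar\alpha_g(\xi)(hN)=\alpha_g(\xi(g^{-1}hN))$. If $\alpha$ is amenable, then there exists a net $(\zeta_i)_i$ in $\ell^2(\Gamma/N,A)$ with $\|\zeta_i\|_2\le 1$ for all $i$ such that \[ \|\langle\zeta_i\mid\zeta_i\rangle a-a\|\to 0,\qquad \|a\zeta_i-\zeta_i a\|_2\to 0,\qquad \|\bar\alpha_g(\zeta_i)-\zeta_i\|_2\to 0 \] for all $a\in A$ and $g\in\Gamma$. -/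

import Mathlib

open Filter Topology
open scoped ENNReal

universe u v

noncomputable section

/-! ### The double dual of a C⋆-algebra -/

section Bidual

variable (A : Type*) [NonUnitalCStarAlgebra A]

/-- The double dual `A**` of the Banach space `A`. -/
def Bidual : Type _ := StrongDual ℂ (StrongDual ℂ A)

namespace Bidual

instance : NormedAddCommGroup (Bidual A) :=
  inferInstanceAs (NormedAddCommGroup (StrongDual ℂ (StrongDual ℂ A)))

instance : NormedSpace ℂ (Bidual A) :=
  inferInstanceAs (NormedSpace ℂ (StrongDual ℂ (StrongDual ℂ A)))

/-- The identity map, from the type `A**` to the type of bounded functionals on `A*`. -/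
def toDual : Bidual A ≃ₗᵢ[ℂ] StrongDual ℂ (StrongDual ℂ A) :=
  LinearIsometryEquiv.refl ℂ (StrongDual ℂ (StrongDual ℂ A))

variable {A}

instance : CoeFun (Bidual A) (fun _ => StrongDual ℂ A → ℂ) := ⟨fun F => toDual A F⟩

@[ext]
theorem ext {F G : Bidual A} (h : ∀ f : StrongDual ℂ A, F f = G f) : F = G :=
  (toDual A).injective (ContinuousLinearMap.ext h)

/-- The functional `G · f ∈ A*` for `G ∈ A**`, `f ∈ A*`: it sends `a` to `G (b ↦ f (a * b))`. -/
def act (G : Bidual A) : StrongDual ℂ A →L[ℂ] StrongDual ℂ A :=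
  LinearMap.mkContinuous
    { toFun := fun f => toDual A G ∘L
        (ContinuousLinearMap.compL ℂ A A ℂ f ∘L ContinuousLinearMap.mul ℂ A)
      map_add' := fun f g => by ext a; simp
      map_smul' := fun c f => by ext a; simp }
    ‖G‖ (fun f => by
      refine ContinuousLinearMap.opNorm_le_bound _ (by positivity) fun a => ?_
      have h1 := (toDual A G).le_opNorm (f ∘L ContinuousLinearMap.mul ℂ A a)
      have h2 : ‖f ∘L ContinuousLinearMap.mul ℂ A a‖ ≤ ‖f‖ * ‖a‖ :=
        (ContinuousLinearMap.opNorm_comp_le _ _).trans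
          (mul_le_mul_of_nonneg_left (ContinuousLinearMap.opNorm_mul_apply_le ℂ A a)
            (norm_nonneg f))
      rw [(toDual A).norm_map] at h1
      calc _ ≤ ‖G‖ * ‖f ∘L ContinuousLinearMap.mul ℂ A a‖ := h1
        _ ≤ ‖G‖ * (‖f‖ * ‖a‖) := mul_le_mul_of_nonneg_left h2 (norm_nonneg G)
        _ = ‖G‖ * ‖f‖ * ‖a‖ := by ring)

theorem act_apply (G : Bidual A) (f : StrongDual ℂ A) (a : A) :
    act G f a = G (f ∘L ContinuousLinearMap.mul ℂ A a) := rfl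

theorem norm_act_le (G : Bidual A) : ‖act G‖ ≤ ‖G‖ :=
  LinearMap.mkContinuous_norm_le _ (norm_nonneg G) _

/-- The (Arens) product of `A**`: `(F * G) (f) = F (a ↦ G (b ↦ f (a * b)))`. -/
instance : Mul (Bidual A) := ⟨fun F G => (toDual A).symm (toDual A F ∘L act G)⟩

theorem mul_apply (F G : Bidual A) (f : StrongDual ℂ A) : (F * G) f = F (act G f) := rfl

theorem act_mul (G H : Bidual A) (f : StrongDual ℂ A) : act (G * H) f = act G (act H f) := by
  ext a
  simp only [act_apply, mul_apply]
  congr 1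
  ext b
  simp only [act_apply, ContinuousLinearMap.comp_apply, ContinuousLinearMap.mul_apply']
  congr 1
  ext c
  simp [mul_assoc]

instance : NonUnitalNormedRing (Bidual A) :=
  { (inferInstance : NormedAddCommGroup (Bidual A)), (inferInstance : Mul (Bidual A)) with
    left_distrib := fun F G H => by
      ext f
      have : act (G + H) f = act G f + act H f := rfl
      exact (congrArg (toDual A F) this).trans (map_add (toDual A F) _ _)
    right_distrib := fun F G H => rfl
    zero_mul := fun F => rfl
    mul_zero := fun F => by
      ext f
      have : act (0 : Bidual A) f = 0 := rfl
      exact (congrArg (toDual A F) this).trans (map_zero (toDual A F))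
    mul_assoc := fun F G H => by
      ext f
      simp only [mul_apply, act_mul]
    norm_mul_le := fun F G =>
      (ContinuousLinearMap.opNorm_comp_le (toDual A F) (act G)).trans
        (mul_le_mul_of_nonneg_left (norm_act_le G) (norm_nonneg _)) }

instance : IsScalarTower ℂ (Bidual A) (Bidual A) := ⟨fun _ _ _ => rfl⟩

instance : SMulCommClass ℂ (Bidual A) (Bidual A) := ⟨fun c F G => by
  ext f
  have : act (c • G) f = c • act G f := rfl
  exact ((congrArg (toDual A F) this).trans (map_smul (toDual A F) c _)).symm⟩

/-- The involution of `A*`: `f* (a) = conj (f (a*))`. -/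
def dualStar (f : StrongDual ℂ A) : StrongDual ℂ A :=
  LinearMap.mkContinuous
    { toFun := fun a => star (f (star a))
      map_add' := fun a b => by simp
      map_smul' := fun c a => by simp }
    ‖f‖ (fun a => by simpa using f.le_opNorm (star a))

theorem dualStar_apply (f : StrongDual ℂ A) (a : A) : dualStar f a = star (f (star a)) := rfl

theorem norm_dualStar_le (f : StrongDual ℂ A) : ‖dualStar f‖ ≤ ‖f‖ :=
  LinearMap.mkContinuous_norm_le _ (norm_nonneg f) _

/-- The involution of `A**`: `F* (f) = conj (F (f*))`. -/
instance : Star (Bidual A) := ⟨fun F => (toDual A).symm <|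
  LinearMap.mkContinuous
    { toFun := fun f => star (F (dualStar f))
      map_add' := fun f g => by
        have : dualStar (f + g) = dualStar f + dualStar g := by
          ext a; simp [dualStar_apply]
        simp [this]
      map_smul' := fun c f => by
        have : dualStar (c • f) = star c • dualStar f := by
          ext a; simp [dualStar_apply]
        simp [this] }
    ‖F‖ (fun f => by
      have h1 := (toDual A F).le_opNorm (dualStar f)
      rw [(toDual A).norm_map] at h1
      simpa using h1.trans (mul_le_mul_of_nonneg_left (norm_dualStar_le f) (norm_nonneg F)))⟩

theorem star_apply (F : Bidual A) (f : StrongDual ℂ A) :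
    (star F) f = star (F (dualStar f)) := rfl

/-- `e` is the unit of the algebra `A**`. -/
def IsOne (e : Bidual A) : Prop := ∀ F : Bidual A, e * F = F ∧ F * e = F

/-- `u` is a unitary of `A**`: both `u* u` and `u u*` are the unit. -/
def IsUnitary (u : Bidual A) : Prop := IsOne (star u * u) ∧ IsOne (u * star u)

/-- `F` is a positive element of `A**`: it has the form `G* G`. -/
def IsPositive (F : Bidual A) : Prop := ∃ G : Bidual A, F = star G * G

variable (A) in
/-- The center of `A**`, with the operations and the norm of `A**`. -/
abbrev center : NonUnitalSubalgebra ℂ (Bidual A) := NonUnitalSubalgebra.center ℂ (Bidual A)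

instance : NormedSpace ℂ (center A) :=
  { (inferInstance : Module ℂ (center A)) with
    norm_smul_le := fun c z => norm_smul_le c (z : Bidual A) }

/-! ### The automorphism of the double dual induced by an automorphism -/

/-- An automorphism of a C⋆-algebra as a bounded linear map. -/
def autCLM (θ : A ≃⋆ₐ[ℂ] A) : A →L[ℂ] A where
  toFun := θ
  map_add' := map_add θ
  map_smul' := map_smul θ
  cont := (NonUnitalStarAlgHom.isometry θ (EquivLike.injective θ)).continuous

theorem autCLM_apply (θ : A ≃⋆ₐ[ℂ] A) (a : A) : autCLM θ a = θ a := rfl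

/-- The bitranspose `θ** : A** → A**`, `θ** (F) (f) = F (f ∘ θ)`. -/
def map (θ : A ≃⋆ₐ[ℂ] A) : Bidual A →L[ℂ] Bidual A :=
  (toDual A).symm.toContinuousLinearEquiv.toContinuousLinearMap ∘L
    ((ContinuousLinearMap.compL ℂ (StrongDual ℂ A) (StrongDual ℂ A) ℂ).flip
      ((ContinuousLinearMap.compL ℂ A A ℂ).flip (autCLM θ))) ∘L
    (toDual A).toContinuousLinearEquiv.toContinuousLinearMap

theorem map_apply (θ : A ≃⋆ₐ[ℂ] A) (F : Bidual A) (f : StrongDual ℂ A) :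
    (map θ F) f = F (f ∘L autCLM θ) := rfl

theorem map_mul (θ : A ≃⋆ₐ[ℂ] A) (F G : Bidual A) : map θ (F * G) = map θ F * map θ G := by
  ext f
  simp only [mul_apply, map_apply]
  congr 1
  ext a
  simp only [act_apply, map_apply, ContinuousLinearMap.comp_apply]
  congr 1
  ext b
  simp [autCLM_apply]

theorem map_map_symm (θ : A ≃⋆ₐ[ℂ] A) (F : Bidual A) : map θ (map θ.symm F) = F := by
  ext f
  simp only [map_apply]
  congr 1
  ext a
  simp [autCLM_apply]

theorem map_mem_center (θ : A ≃⋆ₐ[ℂ] A) {F : Bidual A} (hF : F ∈ center A) :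
    map θ F ∈ center A := by
  rw [NonUnitalSubalgebra.mem_center_iff] at hF ⊢
  intro G
  have h := congrArg (map θ) (hF (map θ.symm G))
  rwa [map_mul, map_mul, map_map_symm] at h

/-- The restriction of `θ**` to the center of `A**`. -/
def centerMap (θ : A ≃⋆ₐ[ℂ] A) (z : center A) : center A := ⟨map θ z, map_mem_center θ z.2⟩

end Bidual

/-- An automorphism `θ` of `A` is universally weakly inner if `θ**` is an inner automorphism
`F ↦ u F u*` of `A**`. -/
def UniversallyWeaklyInner {A : Type*} [NonUnitalCStarAlgebra A] (θ : A ≃⋆ₐ[ℂ] A) : Prop :=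
  ∃ u : Bidual A, u.IsUnitary ∧ ∀ F : Bidual A, Bidual.map θ F = u * F * star u

end Bidual

/-! ### Amenable actions -/

section Amenable

variable {Γ : Type*} [Group Γ] {A : Type*} [NonUnitalCStarAlgebra A]

variable (Γ A) in
/-- The algebra `ℓ^∞(Γ, Z(A**))` of bounded functions with the supremum norm. -/
abbrev LInftyCenter : Type _ := lp (fun _ : Γ => Bidual.center A) ∞

variable (Γ) in
/-- The constant function with value `z`. -/
def constCenter (z : Bidual.center A) : LInftyCenter Γ A :=
  ⟨fun _ => z, memℓp_infty ⟨‖z‖, by rintro _ ⟨h, rfl⟩; exact le_rfl⟩⟩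

/-- The action `(g · f) (h) = α_g** (f (g⁻¹ h))` on `ℓ^∞(Γ, Z(A**))`. -/
def actCenter (α : Γ →* (A ≃⋆ₐ[ℂ] A)) (g : Γ) (f : LInftyCenter Γ A) : LInftyCenter Γ A :=
  ⟨fun h => Bidual.centerMap (α g) (f (g⁻¹ * h)), memℓp_infty
    ⟨‖Bidual.map (α g)‖ * ‖f‖, by
      rintro _ ⟨h, rfl⟩
      refine le_trans ((Bidual.map (α g)).le_opNorm (f (g⁻¹ * h) : Bidual A)) ?_
      exact mul_le_mul_of_nonneg_left
        (lp.norm_apply_le_norm ENNReal.top_ne_zero f (g⁻¹ * h)) (norm_nonneg _)⟩⟩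

/-- `E` is a conditional expectation from `ℓ^∞(Γ, Z(A**))` onto `Z(A**)`, the latter embedded as
the constant functions: a contractive positive linear projection that is `Z(A**)`-linear.
(The range is commutative, so such a map is completely positive.) -/
structure IsCondExpCenter (E : LInftyCenter Γ A →ₗ[ℂ] Bidual.center A) : Prop where
  norm_le : ∀ f, ‖E f‖ ≤ ‖f‖
  apply_const : ∀ z, E (constCenter Γ z) = z
  apply_mul : ∀ z f, E (constCenter Γ z * f) = z * E f
  positive : ∀ f : LInftyCenter Γ A,
    (∀ h : Γ, (f h : Bidual A).IsPositive) → (E f : Bidual A).IsPositive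

/-- The action `α` is amenable: there is a `Γ`-equivariant conditional expectation
`ℓ^∞(Γ, Z(A**)) → Z(A**)`. -/
def IsAmenableAction (α : Γ →* (A ≃⋆ₐ[ℂ] A)) : Prop :=
  ∃ E : LInftyCenter Γ A →ₗ[ℂ] Bidual.center A, IsCondExpCenter E ∧
    ∀ (g : Γ) (f : LInftyCenter Γ A), E (actCenter α g f) = Bidual.centerMap (α g) (E f)

end Amenable

/-! ### The Hilbert module `ℓ²(I, A)` -/

section Ell2

variable {I : Type*} {A : Type*} [NonUnitalCStarAlgebra A]

theorem summable_star_mul_self_of_le {x y : I → A} {C : ℝ}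
    (h : ∀ s : Finset I,
      ‖∑ j ∈ s, star (y j) * y j‖ ≤ C * ‖∑ j ∈ s, star (x j) * x j‖)
    (hx : Summable fun j => star (x j) * x j) : Summable fun j => star (y j) * y j := by
  rw [summable_iff_vanishing_norm] at hx ⊢
  intro ε hε
  obtain ⟨s, hs⟩ := hx (ε / (|C| + 1)) (by positivity)
  refine ⟨s, fun t ht => (h t).trans_lt ?_⟩
  have h1 := hs t ht
  rw [lt_div_iff₀ (by positivity)] at h1
  have h2 : C * ‖∑ j ∈ t, star (x j) * x j‖ ≤ |C| * ‖∑ j ∈ t, star (x j) * x j‖ :=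
    mul_le_mul_of_nonneg_right (le_abs_self C) (norm_nonneg _)
  nlinarith [norm_nonneg (∑ j ∈ t, star (x j) * x j)]

theorem summable_star_mul_self_add {x y : I → A}
    (hx : Summable fun j => star (x j) * x j) (hy : Summable fun j => star (y j) * y j) :
    Summable fun j => star (x j + y j) * (x j + y j) := by
  let _ := CStarAlgebra.spectralOrder A
  have _ := CStarAlgebra.spectralOrderedRing A
  have hxy := hx.add hy
  rw [summable_iff_vanishing_norm] at hxy ⊢
  intro ε hε
  obtain ⟨s, hs⟩ := hxy (ε / 2) (by positivity)
  refine ⟨s, fun t ht => ?_⟩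
  have h1 := hs t ht
  have h0 : (0 : A) ≤ ∑ j ∈ t, star (x j + y j) * (x j + y j) :=
    Finset.sum_nonneg fun j _ => star_mul_self_nonneg _
  have h2 : ∑ j ∈ t, star (x j + y j) * (x j + y j) ≤
      ∑ j ∈ t, ((star (x j) * x j + star (y j) * y j) +
        (star (x j) * x j + star (y j) * y j)) := by
    refine Finset.sum_le_sum fun j _ => ?_
    rw [← sub_nonneg]
    have : (star (x j) * x j + star (y j) * y j) + (star (x j) * x j + star (y j) * y j) -
        star (x j + y j) * (x j + y j) = star (x j - y j) * (x j - y j) := by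
      rw [star_add, star_sub]; noncomm_ring
    rw [this]
    exact star_mul_self_nonneg _
  have h3 := CStarAlgebra.norm_le_norm_of_nonneg_of_le h0 h2
  rw [Finset.sum_add_distrib] at h3
  have h4 := norm_add_le (∑ j ∈ t, (star (x j) * x j + star (y j) * y j))
    (∑ j ∈ t, (star (x j) * x j + star (y j) * y j))
  linarith

variable (I A) in
/-- The Hilbert `A`-module `ℓ²(I, A)` of all `ξ : I → A` such that `∑ ξ(j)* ξ(j)` converges
unconditionally in the norm of `A`; it is the `‖·‖₂`-completion of the finitely supported maps. -/
def ell2 : Submodule ℂ (I → A) where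
  carrier := {ξ | Summable fun j => star (ξ j) * ξ j}
  zero_mem' := by simp [summable_zero]
  add_mem' := fun hx hy => summable_star_mul_self_add hx hy
  smul_mem' := fun c x (hx : Summable _) => by
    have := hx.const_smul (star c * c)
    refine this.congr fun j => ?_
    simp [smul_mul_smul_comm]

/-- `⟨ξ | ξ⟩ = ∑ ξ(j)* ξ(j)`. -/
def ell2InnerSelf (ξ : ell2 I A) : A := ∑' j, star ((ξ : I → A) j) * (ξ : I → A) j

/-- `‖ξ‖₂ = ‖⟨ξ | ξ⟩‖^{1/2}`. -/
def ell2Norm (ξ : ell2 I A) : ℝ := √‖ell2InnerSelf ξ‖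

/-- The left multiplication `(a ξ)(j) = a ξ(j)`. -/
def ell2Left (a : A) (ξ : ell2 I A) : ell2 I A :=
  ⟨fun j => a * (ξ : I → A) j, by
    let _ := CStarAlgebra.spectralOrder A
    have _ := CStarAlgebra.spectralOrderedRing A
    refine summable_star_mul_self_of_le (C := ‖star a * a‖) (fun s => ?_) ξ.2
    have h0 : (0 : A) ≤ ∑ j ∈ s, star (a * (ξ : I → A) j) * (a * (ξ : I → A) j) :=
      Finset.sum_nonneg fun j _ => star_mul_self_nonneg _
    have h2 : ∑ j ∈ s, star (a * (ξ : I → A) j) * (a * (ξ : I → A) j) ≤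
        ‖star a * a‖ • ∑ j ∈ s, star ((ξ : I → A) j) * (ξ : I → A) j := by
      rw [Finset.smul_sum]
      refine Finset.sum_le_sum fun j _ => ?_
      have := CStarAlgebra.star_left_conjugate_le_norm_smul
        (a := (ξ : I → A) j) (b := star a * a) (IsSelfAdjoint.star_mul_self a)
      simpa [mul_assoc] using this
    have h3 := CStarAlgebra.norm_le_norm_of_nonneg_of_le h0 h2
    rwa [norm_smul, norm_norm] at h3⟩

/-- The right multiplication `(ξ a)(j) = ξ(j) a`. -/
def ell2Right (ξ : ell2 I A) (a : A) : ell2 I A :=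
  ⟨fun j => (ξ : I → A) j * a, by
    have h : Summable fun j => star ((ξ : I → A) j) * (ξ : I → A) j := ξ.2
    refine ((h.mul_left (star a)).mul_right a).congr fun j => ?_
    simp [mul_assoc]⟩

/-- The induced action of `Γ` on `ℓ²(Γ/N, A)`: `(g · ξ)(x) = α_g (ξ (g⁻¹ x))`, where `Γ` acts on
`Γ/N` by left translation. -/
def ell2Act {Γ : Type*} [Group Γ] {N : Subgroup Γ} (α : Γ →* (A ≃⋆ₐ[ℂ] A)) (g : Γ)
    (ξ : ell2 (Γ ⧸ N) A) : ell2 (Γ ⧸ N) A :=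
  ⟨fun x => α g ((ξ : Γ ⧸ N → A) (g⁻¹ • x)), by
    have h : Summable fun x => star ((ξ : Γ ⧸ N → A) x) * (ξ : Γ ⧸ N → A) x := ξ.2
    have h' := (h.comp_injective (MulAction.injective (β := Γ ⧸ N) g⁻¹)).mapL (Bidual.autCLM (α g))
    refine h'.congr fun x => ?_
    simp [Bidual.autCLM_apply, map_star]⟩

end Ell2

end

/-! A bounded function on `Γ/N` lifts to a function on `Γ` constant on cosets, and left translation
respects the lifting. The expectation given by amenability therefore restricts to an equivariant
mean on bounded functions from `Γ/N` to the center of `A**` (`CenterModel.exists_mean`). The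
self-adjoint part of that center is modelled as `C(K, ℝ)` by Gelfand duality. The unit of `A**`, on
which all of this rests, comes from a unitary `u` as `star u * u`.

For a fixed positive functional `ω`, a Day–Namioka argument turns the mean into finitely supported
partitions of unity `f : Γ/N → C(K, ℝ)` whose displacements are small in the `L¹`-norm of `ω`
(`IsEquivariantMean.exists_approx_invariant`). The mean need not be normal, so it is not
approximated directly. For each choice of signs a good partition exists, and a minimax theorem on a
weakly compact space of sign choices gives one that works for all signs. A Radon–Nikodym theorem
refers `ω` and its translates to one common functional.

The square roots of the `f x` are central elements whose squares sum to the unit. A Kaplansky-type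
approximation (`Bidual.exists_approx_partition`) replaces them by elements of `A`; centrality makes
commutators small, and `(u - v)² ≤ |u² - v²|` makes displacements small. Thus every `ω` is nearly
annihilated by the positive defects of some contractive vector (`exists_small_defects`).

Passing from one functional to the norm is a Hahn–Banach argument, and it needs the total defects to
form a convex set. If `Γ/N` is infinite, right translation moves a vector off the support of another
without changing its defects, so `√s ζ + √t ζ'` realizes convex combinations (`convex_totalDefect`).
If `Γ/N` is finite, a constant vector built from an almost invariant approximate unit suffices. -/

/-! ### Jordan decomposition of bounded functionals. -/

section PositiveFunctionals

open scoped ComplexOrder ComplexStarModule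

set_option linter.unusedSectionVars false

variable {A : Type v} [NonUnitalCStarAlgebra A] [PartialOrder A] [StarOrderedRing A]

/-- A positive real functional on the self-adjoint part extends to a positive linear functional. -/
theorem exists_positiveLinearMap_extension (g : selfAdjoint A →ₗ[ℝ] ℝ)
    (hg : ∀ a : selfAdjoint A, 0 ≤ (a : A) → 0 ≤ g a) :
    ∃ φ : A →ₚ[ℂ] ℂ, ∀ a : selfAdjoint A, φ a = g a := by
  refine ⟨PositiveLinearMap.mk₀
    { toFun := fun a => (g (ℜ a) : ℂ) + Complex.I * (g (ℑ a) : ℂ)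
      map_add' := fun a b => by simp only [map_add, Complex.ofReal_add, mul_add]; abel
      map_smul' := fun c a => ?_ } ?_, ?_⟩
  · simp only [realPart_smul, imaginaryPart_smul, map_sub, map_add, map_smul, smul_eq_mul,
      RingHom.id_apply]
    apply Complex.ext <;> simp
  · intro a ha
    have h1 : ℑ a = 0 := (IsSelfAdjoint.of_nonneg ha).imaginaryPart
    have h2 : (0 : A) ≤ ℜ a := by
      rw [(IsSelfAdjoint.of_nonneg ha).coe_realPart]; exact ha
    simpa [h1] using hg _ h2
  · intro a
    change (g (ℜ (a : A)) : ℂ) + Complex.I * (g (ℑ (a : A)) : ℂ) = g a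
    simp

/-- The gauge `inf {‖c‖ : c ≥ 0, c ≥ a}`. -/
noncomputable def dominatingNorm (a : selfAdjoint A) : ℝ :=
  sInf {r | ∃ c : A, 0 ≤ c ∧ (a : A) ≤ c ∧ ‖c‖ = r}

theorem dominatingNorm_bddBelow (a : selfAdjoint A) :
    BddBelow {r | ∃ c : A, 0 ≤ c ∧ (a : A) ≤ c ∧ ‖c‖ = r} :=
  ⟨0, by rintro _ ⟨c, -, -, rfl⟩; exact norm_nonneg c⟩

theorem dominatingNorm_le {a : selfAdjoint A} {c : A} (hc : 0 ≤ c) (hac : (a : A) ≤ c) :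
    dominatingNorm a ≤ ‖c‖ :=
  csInf_le (dominatingNorm_bddBelow a) ⟨c, hc, hac, rfl⟩

theorem dominatingNorm_set_nonempty (a : selfAdjoint A) :
    {r | ∃ c : A, 0 ≤ c ∧ (a : A) ≤ c ∧ ‖c‖ = r}.Nonempty :=
  ⟨_, (a : A)⁺, CFC.posPart_nonneg _, CFC.le_posPart a.2, rfl⟩

theorem exists_of_dominatingNorm_lt {a : selfAdjoint A} {r : ℝ} (h : dominatingNorm a < r) :
    ∃ c : A, 0 ≤ c ∧ (a : A) ≤ c ∧ ‖c‖ < r := by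
  obtain ⟨_, ⟨c, hc, hac, rfl⟩, hr⟩ := exists_lt_of_csInf_lt (dominatingNorm_set_nonempty a) h
  exact ⟨c, hc, hac, hr⟩

theorem dominatingNorm_le_norm (a : selfAdjoint A) : dominatingNorm a ≤ ‖(a : A)‖ :=
  (dominatingNorm_le (CFC.posPart_nonneg _) (CFC.le_posPart a.2)).trans
    (CStarAlgebra.norm_posPart_le _)

theorem dominatingNorm_add (a b : selfAdjoint A) :
    dominatingNorm (a + b) ≤ dominatingNorm a + dominatingNorm b := by
  refine le_of_forall_pos_le_add fun ε hε => ?_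
  obtain ⟨c, hc, hac, hcr⟩ := exists_of_dominatingNorm_lt
    (a := a) (r := dominatingNorm a + ε / 2) (by linarith)
  obtain ⟨d, hd, hbd, hdr⟩ := exists_of_dominatingNorm_lt
    (a := b) (r := dominatingNorm b + ε / 2) (by linarith)
  have := dominatingNorm_le (a := a + b) (add_nonneg hc hd) (add_le_add hac hbd)
  linarith [norm_add_le c d]

theorem dominatingNorm_smul_le {r : ℝ} (hr : 0 < r) (a : selfAdjoint A) :
    dominatingNorm (r • a) ≤ r * dominatingNorm a := by
  rw [← div_le_iff₀' hr]
  refine le_csInf (dominatingNorm_set_nonempty a) ?_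
  rintro _ ⟨c, hc, hac, rfl⟩
  rw [div_le_iff₀' hr]
  refine (dominatingNorm_le (a := r • a) (smul_nonneg hr.le hc)
    (smul_le_smul_of_nonneg_left hac hr.le)).trans ?_
  rw [norm_smul, Real.norm_of_nonneg hr.le]

theorem dominatingNorm_smul {r : ℝ} (hr : 0 < r) (a : selfAdjoint A) :
    dominatingNorm (r • a) = r * dominatingNorm a := by
  refine le_antisymm (dominatingNorm_smul_le hr a) ?_
  have h := dominatingNorm_smul_le (inv_pos.mpr hr) (r • a)
  rw [inv_smul_smul₀ hr.ne', inv_mul_eq_div, le_div_iff₀ hr] at h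
  linarith

/-- If `-d ≤ a ≤ c`, then `0 ≤ a + d ≤ c + d`, and the norm is monotone on positive elements. This
bounds a functional by a sublinear gauge on pairs. -/
theorem norm_le_dominatingNorm (a : selfAdjoint A) :
    ‖(a : A)‖ ≤ 2 * (dominatingNorm a + dominatingNorm (-a)) := by
  refine le_of_forall_pos_le_add fun ε hε => ?_
  obtain ⟨c, hc, hac, hcr⟩ := exists_of_dominatingNorm_lt
    (a := a) (r := dominatingNorm a + ε / 4) (by linarith)
  obtain ⟨d, hd, hbd, hdr⟩ := exists_of_dominatingNorm_lt
    (a := -a) (r := dominatingNorm (-a) + ε / 4) (by linarith)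
  have h0 : (0 : A) ≤ a + d := by
    have : -(a : A) ≤ d := by simpa using hbd
    simpa using neg_le_iff_add_nonneg'.mp this
  have h1 : ‖(a : A) + d‖ ≤ ‖c + d‖ :=
    CStarAlgebra.norm_le_norm_of_nonneg_of_le h0 (by gcongr)
  have h2 : ‖(a : A)‖ ≤ ‖(a : A) + d‖ + ‖d‖ := by
    simpa using norm_sub_le ((a : A) + d) d
  linarith [norm_add_le c d, norm_nonneg c]

/-- Jordan decomposition: a bounded real functional on the self-adjoint part is a difference of
positive functionals, with control of the norms. -/
theorem exists_positive_sub_positive (h : selfAdjoint A →ₗ[ℝ] ℝ) {M : ℝ} (hM : 0 ≤ M)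
    (hh : ∀ a : selfAdjoint A, h a ≤ M * ‖(a : A)‖) :
    ∃ φ ψ : A →ₚ[ℂ] ℂ, (∀ a : selfAdjoint A, (h a : ℂ) = φ a - ψ a) ∧
      (∀ a : A, ‖φ a‖ ≤ 8 * M * ‖a‖) ∧ ∀ a : A, ‖ψ a‖ ≤ 8 * M * ‖a‖ := by
  -- The functional is placed on the antidiagonal `(a, -a)`. After a Hahn–Banach extension the
  -- restrictions to the two axes are the two positive parts.
  let f : (selfAdjoint A × selfAdjoint A) →ₗ.[ℝ] ℝ :=
    { domain := LinearMap.range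
        (LinearMap.prod (LinearMap.id : selfAdjoint A →ₗ[ℝ] selfAdjoint A) (-LinearMap.id))
      toFun := h ∘ₗ LinearMap.fst ℝ _ _ ∘ₗ Submodule.subtype _ }
  let p : (selfAdjoint A × selfAdjoint A) → ℝ := fun x => 2 * M * (dominatingNorm x.1 + dominatingNorm x.2)
  obtain ⟨g, hg1, hg2⟩ := exists_extension_of_le_sublinear f p
    (fun c hc x => by
      simp only [p, Prod.smul_fst, Prod.smul_snd, dominatingNorm_smul hc]; ring)
    (fun x y => by
      simp only [p, Prod.fst_add, Prod.snd_add]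
      have := add_le_add (dominatingNorm_add x.1 y.1) (dominatingNorm_add x.2 y.2)
      nlinarith)
    (by
      rintro ⟨_, ⟨a, rfl⟩⟩
      have h1 := hh a
      have h2 := mul_le_mul_of_nonneg_left (norm_le_dominatingNorm a) hM
      have h3 : f ⟨_, ⟨a, rfl⟩⟩ = h a := rfl
      simp only [p, h3]
      simp only [LinearMap.prod_apply, Function.prod, LinearMap.id_apply, LinearMap.neg_apply]
      linarith)
  have hzero : dominatingNorm (0 : selfAdjoint A) ≤ 0 := by
    simpa using dominatingNorm_le_norm (0 : selfAdjoint A)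
  have key : ∀ G : selfAdjoint A →ₗ[ℝ] ℝ, (∀ a, G a ≤ 2 * M * dominatingNorm a) →
      ∃ φ : A →ₚ[ℂ] ℂ, (∀ a : selfAdjoint A, φ a = G a) ∧ ∀ a : A, ‖φ a‖ ≤ 8 * M * ‖a‖ := by
    intro G hG
    -- For `a ≥ 0` the element `-a` is dominated by `0`, so its gauge vanishes and `G (-a) ≤ 0`.
    have hpos : ∀ a : selfAdjoint A, 0 ≤ (a : A) → 0 ≤ G a := by
      intro a ha
      have h1 := hG (-a)
      have h2 : dominatingNorm (-a) ≤ 0 := by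
        simpa using dominatingNorm_le (a := -a) (c := 0) le_rfl (by simpa using ha)
      have h3 := mul_nonpos_of_nonneg_of_nonpos (by positivity : 0 ≤ 2 * M) h2
      rw [map_neg] at h1
      linarith
    obtain ⟨φ, hφ⟩ := exists_positiveLinearMap_extension G hpos
    refine ⟨φ, hφ, fun a => ?_⟩
    obtain ⟨y, hy, hyn, hya⟩ := CStarAlgebra.exists_sum_four_nonneg a
    have hb : ∀ i, ‖φ (y i)‖ ≤ 2 * M * ‖a‖ := by
      intro i
      let b : selfAdjoint A := ⟨y i, .of_nonneg (hy i)⟩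
      have h1 : φ (y i) = G b := hφ b
      rw [h1, Complex.norm_real, Real.norm_of_nonneg (hpos b (hy i))]
      refine (hG b).trans (mul_le_mul_of_nonneg_left ?_ (by positivity))
      exact (dominatingNorm_le_norm b).trans (hyn i)
    conv_lhs => rw [hya]
    simp only [map_sum, map_smul]
    refine (norm_sum_le _ _).trans ?_
    refine (Finset.sum_le_sum (g := fun _ => 2 * M * ‖a‖) fun i _ => ?_).trans ?_
    · simpa [norm_smul] using hb i
    · simp; linarith
  obtain ⟨φ, hφ, hφn⟩ := key (g ∘ₗ LinearMap.inl ℝ _ _) fun a => by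
    have := hg2 (a, 0)
    simp only [p] at this
    simp only [LinearMap.comp_apply, LinearMap.inl_apply]
    nlinarith
  obtain ⟨ψ, hψ, hψn⟩ := key (g ∘ₗ LinearMap.inr ℝ _ _) fun a => by
    have := hg2 (0, a)
    simp only [p] at this
    simp only [LinearMap.comp_apply, LinearMap.inr_apply]
    nlinarith
  refine ⟨φ, ψ, fun a => ?_, hφn, hψn⟩
  have h1 : g (a, -a) = h a := hg1 ⟨_, ⟨a, rfl⟩⟩
  have h2 : ((a, -a) : selfAdjoint A × selfAdjoint A) = LinearMap.inl ℝ _ _ a - LinearMap.inr ℝ _ _ a := by simp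
  rw [h2, map_sub] at h1
  rw [hφ, hψ, ← h1]
  simp

/-- Every bounded functional on a C⋆-algebra is a combination of four positive functionals. -/
theorem exists_four_positive (f : StrongDual ℂ A) :
    ∃ φ : Fin 4 → (A →ₚ[ℂ] ℂ), (∀ i a, ‖φ i a‖ ≤ 8 * ‖f‖ * ‖a‖) ∧
      ∀ a, f a = φ 0 a - φ 1 a + Complex.I * (φ 2 a - φ 3 a) := by
  let h1 : selfAdjoint A →ₗ[ℝ] ℝ :=
    { toFun := fun a => (f a).re, map_add' := by simp, map_smul' := by
        intro c a
        have : ((c • a : selfAdjoint A) : A) = (c : ℂ) • (a : A) := by simp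
        rw [this]; simp }
  let h2 : selfAdjoint A →ₗ[ℝ] ℝ :=
    { toFun := fun a => (f a).im, map_add' := by simp, map_smul' := by
        intro c a
        have : ((c • a : selfAdjoint A) : A) = (c : ℂ) • (a : A) := by simp
        rw [this]; simp }
  obtain ⟨φ, ψ, h, hφ, hψ⟩ := exists_positive_sub_positive h1 (norm_nonneg f) fun a =>
    ((le_abs_self _).trans (Complex.abs_re_le_norm _)).trans (f.le_opNorm a)
  obtain ⟨φ', ψ', h', hφ', hψ'⟩ := exists_positive_sub_positive h2 (norm_nonneg f) fun a =>
    ((le_abs_self _).trans (Complex.abs_im_le_norm _)).trans (f.le_opNorm a)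
  refine ⟨![φ, ψ, φ', ψ'], ?_, ?_⟩
  · intro i
    fin_cases i
    exacts [hφ, hψ, hφ', hψ']
  · have key : ∀ a : selfAdjoint A, f a = φ a - ψ a + Complex.I * (φ' a - ψ' a) := by
      intro a
      rw [← h, ← h', mul_comm]
      exact (Complex.re_add_im (f a)).symm
    intro a
    conv_lhs => rw [← realPart_add_I_smul_imaginaryPart a]
    simp only [Matrix.cons_val_zero, Matrix.cons_val_one, Matrix.cons_val]
    conv_rhs => rw [← realPart_add_I_smul_imaginaryPart a]
    simp only [map_add, map_smul, key, smul_eq_mul]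
    ring

end PositiveFunctionals

/-! ### Extension of representations from `A` to `A**`. -/

section BidualRepresentation

open scoped InnerProductSpace

variable {A : Type v} [NonUnitalCStarAlgebra A] {H : Type*} [NormedAddCommGroup H]
  [InnerProductSpace ℂ H]

namespace Bidual

/-- The canonical embedding of `A` into `A**`. -/
noncomputable def of (a : A) : Bidual A :=
  (toDual A).symm (NormedSpace.inclusionInDoubleDual ℂ A a)

theorem of_apply (a : A) (f : StrongDual ℂ A) : (of a) f = f a := rfl

theorem add_apply (F G : Bidual A) (f : StrongDual ℂ A) : (F + G) f = F f + G f := rfl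

theorem sub_apply (F G : Bidual A) (f : StrongDual ℂ A) : (F - G) f = F f - G f := rfl

theorem smul_apply (c : ℂ) (F : Bidual A) (f : StrongDual ℂ A) : (c • F) f = c * F f := rfl

theorem le_norm (F : Bidual A) (f : StrongDual ℂ A) : ‖F f‖ ≤ ‖F‖ * ‖f‖ :=
  ((toDual A F).le_opNorm f).trans_eq (by rw [(toDual A).norm_map])

theorem norm_le_of_forall {F : Bidual A} {C : ℝ} (hC : 0 ≤ C)
    (h : ∀ f : StrongDual ℂ A, ‖F f‖ ≤ C * ‖f‖) : ‖F‖ ≤ C := by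
  rw [← (toDual A).norm_map]
  exact ContinuousLinearMap.opNorm_le_bound _ hC h

end Bidual

/-- A ⋆-representation as a bounded linear map. -/
noncomputable def repCLM [CompleteSpace H] (π : A →⋆ₙₐ[ℂ] (H →L[ℂ] H)) : A →L[ℂ] (H →L[ℂ] H) :=
  LinearMap.mkContinuous
    { toFun := π, map_add' := map_add π, map_smul' := map_smul π } 1
    (fun a => by simpa using NonUnitalStarAlgHom.norm_apply_le π a)

/-- The coefficient functional `a ↦ ⟪η, π a ξ⟫`. -/
noncomputable def coeffFunctional [CompleteSpace H] (π : A →⋆ₙₐ[ℂ] (H →L[ℂ] H)) (η ξ : H) :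
    StrongDual ℂ A :=
  innerSL ℂ η ∘L (ContinuousLinearMap.apply ℂ H ξ) ∘L repCLM π

theorem coeffFunctional_apply [CompleteSpace H] (π : A →⋆ₙₐ[ℂ] (H →L[ℂ] H)) (η ξ : H) (a : A) :
    coeffFunctional π η ξ a = ⟪η, π a ξ⟫_ℂ := rfl

theorem norm_coeffFunctional_le [CompleteSpace H] (π : A →⋆ₙₐ[ℂ] (H →L[ℂ] H)) (η ξ : H) :
    ‖coeffFunctional π η ξ‖ ≤ ‖η‖ * ‖ξ‖ := by
  refine ContinuousLinearMap.opNorm_le_bound _ (by positivity) fun a => ?_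
  rw [coeffFunctional_apply]
  calc ‖⟪η, π a ξ⟫_ℂ‖ ≤ ‖η‖ * ‖π a ξ‖ := norm_inner_le_norm _ _
    _ ≤ ‖η‖ * (‖a‖ * ‖ξ‖) := by
      gcongr
      exact ((π a).le_opNorm ξ).trans
        (mul_le_mul_of_nonneg_right (NonUnitalStarAlgHom.norm_apply_le π a) (norm_nonneg _))
    _ = _ := by ring

/-- The sesquilinear form `(η, ξ) ↦ F (⟪η, π · ξ⟫)`. -/
noncomputable def bidualForm [CompleteSpace H] (π : A →⋆ₙₐ[ℂ] (H →L[ℂ] H)) (F : Bidual A) :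
    H →L⋆[ℂ] H →L[ℂ] ℂ :=
  LinearMap.mkContinuous₂
    (LinearMap.mk₂'ₛₗ (starRingEnd ℂ) (RingHom.id ℂ) (fun η ξ => F (coeffFunctional π η ξ))
      (fun η η' ξ => by
        rw [← map_add]; congr 1; ext a; simp [coeffFunctional_apply])
      (fun c η ξ => by
        rw [← map_smul]; congr 1; ext a; simp [coeffFunctional_apply, mul_comm])
      (fun η ξ ξ' => by
        rw [← map_add]; congr 1; ext a; simp [coeffFunctional_apply])
      (fun c η ξ => by
        rw [RingHom.id_apply, ← map_smul]; congr 1; ext a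
        simp [coeffFunctional_apply]))
    ‖F‖ (fun η ξ => by
      refine (F.le_norm _).trans ?_
      rw [mul_assoc]
      exact mul_le_mul_of_nonneg_left (norm_coeffFunctional_le π η ξ) (norm_nonneg _))

/-- The extension of a representation of `A` to `A**`. -/
noncomputable def bidualRepFun [CompleteSpace H] (π : A →⋆ₙₐ[ℂ] (H →L[ℂ] H)) (F : Bidual A) :
    H →L[ℂ] H :=
  ContinuousLinearMap.adjoint (InnerProductSpace.continuousLinearMapOfBilin (bidualForm π F))

theorem ext_inner_right_clm {S T : H →L[ℂ] H} (h : ∀ η ξ, ⟪η, S ξ⟫_ℂ = ⟪η, T ξ⟫_ℂ) : S = T := by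
  ext ξ
  exact ext_inner_left ℂ fun η => h η ξ

variable [CompleteSpace H] (π : A →⋆ₙₐ[ℂ] (H →L[ℂ] H))

theorem inner_bidualRepFun (F : Bidual A) (η ξ : H) :
    ⟪η, bidualRepFun π F ξ⟫_ℂ = F (coeffFunctional π η ξ) := by
  rw [bidualRepFun, ContinuousLinearMap.adjoint_inner_right,
    InnerProductSpace.continuousLinearMapOfBilin_apply]
  rfl

/-- The extension of a representation of `A` to `A**`, as a ⋆-homomorphism. -/
noncomputable def bidualRep : Bidual A →⋆ₙₐ[ℂ] (H →L[ℂ] H) where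
  toFun := bidualRepFun π
  map_smul' c F := ext_inner_right_clm fun η ξ => by
    simp [inner_bidualRepFun]
  map_zero' := ext_inner_right_clm fun η ξ => by
    rw [inner_bidualRepFun, zero_apply, inner_zero_right]
    rfl
  map_add' F G := ext_inner_right_clm fun η ξ => by
    simp [inner_bidualRepFun]
  map_mul' F G := ext_inner_right_clm fun η ξ => by
    rw [inner_bidualRepFun, mul_apply_eq_comp, inner_bidualRepFun, Bidual.mul_apply]
    congr 1
    ext a
    rw [coeffFunctional_apply, ← ContinuousLinearMap.adjoint_inner_left, inner_bidualRepFun,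
      Bidual.act_apply]
    congr 1
    ext b
    simp [coeffFunctional_apply, ContinuousLinearMap.adjoint_inner_left]
  map_star' F := ext_inner_right_clm fun η ξ => by
    rw [inner_bidualRepFun, ContinuousLinearMap.star_eq_adjoint,
      ContinuousLinearMap.adjoint_inner_right, ← inner_conj_symm, inner_bidualRepFun,
      Bidual.star_apply]
    change star _ = star _
    congr 2
    ext a
    simp [Bidual.dualStar_apply, coeffFunctional_apply, map_star,
      ContinuousLinearMap.star_eq_adjoint, ContinuousLinearMap.adjoint_inner_right]

theorem inner_bidualRep (F : Bidual A) (η ξ : H) :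
    ⟪η, bidualRep π F ξ⟫_ℂ = F (coeffFunctional π η ξ) := inner_bidualRepFun π F η ξ

theorem bidualRep_of (a : A) : bidualRep π (.of a) = π a :=
  ext_inner_right_clm fun η ξ => by
    rw [inner_bidualRep, Bidual.of_apply, coeffFunctional_apply]

theorem norm_bidualRep_le (F : Bidual A) : ‖bidualRep π F‖ ≤ ‖F‖ := by
  refine ContinuousLinearMap.opNorm_le_bound _ (norm_nonneg _) fun ξ => ?_
  by_cases h0 : ‖bidualRep π F ξ‖ = 0
  · rw [h0]; positivity
  have h1 : ‖bidualRep π F ξ‖ * ‖bidualRep π F ξ‖ ≤ ‖F‖ * (‖bidualRep π F ξ‖ * ‖ξ‖) := by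
    rw [← inner_self_eq_norm_mul_norm (𝕜 := ℂ), inner_bidualRep]
    exact ((Complex.re_le_norm _).trans (F.le_norm _)).trans
      (mul_le_mul_of_nonneg_left (norm_coeffFunctional_le π _ _) (norm_nonneg _))
  have h2 : 0 < ‖bidualRep π F ξ‖ := lt_of_le_of_ne (norm_nonneg _) (Ne.symm h0)
  nlinarith

/-- The vector representing `x ↦ F (⟪x, T ·⟫)`. -/
theorem exists_vector_of_bidual (T : A →L[ℂ] H) (F : Bidual A) :
    ∃ v : H, ∀ x : H, ⟪x, v⟫_ℂ = F (innerSL ℂ x ∘L T) := by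
  let ℓ : H →ₗ[ℂ] ℂ :=
    { toFun := fun x => star (F (innerSL ℂ x ∘L T))
      map_add' := fun x y => by
        have : innerSL ℂ (x + y) ∘L T = innerSL ℂ x ∘L T + innerSL ℂ y ∘L T := by
          ext a; simp
        rw [this, map_add, star_add]
      map_smul' := fun c x => by
        have : innerSL ℂ (c • x) ∘L T = star c • (innerSL ℂ x ∘L T) := by
          ext a; simp
        rw [this, map_smul]; simp }
  let ℓ' : StrongDual ℂ H := ℓ.mkContinuous (‖F‖ * ‖T‖) fun x => by
    change ‖star (F (innerSL ℂ x ∘L T))‖ ≤ _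
    rw [norm_star]
    have h1 := ContinuousLinearMap.opNorm_comp_le (innerSL ℂ x) T
    rw [innerSL_apply_norm] at h1
    have h2 := (F.le_norm (innerSL ℂ x ∘L T)).trans (mul_le_mul_of_nonneg_left h1 (norm_nonneg _))
    linarith
  refine ⟨(InnerProductSpace.toDual ℂ H).symm ℓ', fun x => ?_⟩
  rw [← inner_conj_symm, InnerProductSpace.toDual_symm_apply]
  change star (star (F (innerSL ℂ x ∘L T))) = _
  rw [star_star]

end BidualRepresentation

/-! ### GNS spaces and their cyclic vectors. -/

section GNS

open scoped InnerProductSpace ComplexOrder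

variable {A : Type v} [NonUnitalCStarAlgebra A] [PartialOrder A] [StarOrderedRing A]

namespace PositiveLinearMap

variable (φ : A →ₚ[ℂ] ℂ)

/-- A positive functional as a bounded functional. -/
noncomputable def toStrongDual : StrongDual ℂ A where
  toFun := φ
  map_add' := map_add φ
  map_smul' := map_smul φ
  cont := map_continuous φ

theorem toStrongDual_apply (a : A) : φ.toStrongDual a = φ a := rfl

/-- The canonical map from `A` to the GNS space. -/
noncomputable def toGNS : A →L[ℂ] φ.GNS :=
  LinearMap.mkContinuous
    { toFun := fun a => ((φ.toPreGNS a : φ.PreGNS) : φ.GNS)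
      map_add' := fun a b => by simp [UniformSpace.Completion.coe_add]
      map_smul' := fun c a => by simp [UniformSpace.Completion.coe_smul] }
    (√‖φ.toStrongDual‖) (fun a => by
      change ‖((φ.toPreGNS a : φ.PreGNS) : φ.GNS)‖ ≤ _
      rw [UniformSpace.Completion.norm_coe, preGNS_norm_def]
      have h : (φ (star a * a)).re ≤ ‖φ.toStrongDual‖ * (‖a‖ * ‖a‖) := by
        refine (Complex.re_le_norm _).trans ((φ.toStrongDual.le_opNorm _).trans ?_)
        rw [CStarRing.norm_star_mul_self]
      refine (Real.sqrt_le_sqrt h).trans ?_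
      rw [Real.sqrt_mul (norm_nonneg _), Real.sqrt_mul_self (norm_nonneg _)])

theorem toGNS_apply (a : A) : φ.toGNS a = ((φ.toPreGNS a : φ.PreGNS) : φ.GNS) := rfl

theorem inner_toGNS (a b : A) : ⟪φ.toGNS a, φ.toGNS b⟫_ℂ = φ (star a * b) := by
  rw [toGNS_apply, toGNS_apply, UniformSpace.Completion.inner_coe]
  rfl

theorem gns_toGNS (a b : A) : φ.gnsNonUnitalStarAlgHom a (φ.toGNS b) = φ.toGNS (a * b) := by
  rw [toGNS_apply, gnsNonUnitalStarAlgHom_apply_coe]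
  rfl

theorem denseRange_toGNS : DenseRange φ.toGNS := by
  have h : Function.Surjective φ.toPreGNS := φ.toPreGNS.surjective
  exact UniformSpace.Completion.denseRange_coe.comp h.denseRange
    (UniformSpace.Completion.continuous_coe _)

/-- The cyclic vector of the GNS representation. -/
theorem exists_cyclic_vector {e : Bidual A} (he : e.IsOne) :
    ∃ Ω : φ.GNS, (∀ a, φ.gnsNonUnitalStarAlgHom a Ω = φ.toGNS a) ∧
      (∀ a, ⟪Ω, φ.toGNS a⟫_ℂ = φ a) ∧ ‖Ω‖ ^ 2 ≤ ‖e‖ * ‖φ.toStrongDual‖ := by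
  obtain ⟨Ω, hΩ⟩ := exists_vector_of_bidual φ.toGNS e
  -- This is `b * e = b` in `A**`; the unit of the bidual replaces an approximate unit in the
  -- construction of `Ω`.
  have h0 : ∀ (f : StrongDual ℂ A) (b : A), e (f ∘L ContinuousLinearMap.mul ℂ A b) = f b := by
    intro f b
    have h := congrArg (fun F : Bidual A => F f) (he (.of b)).2
    simpa only [Bidual.mul_apply, Bidual.of_apply, Bidual.act_apply] using h
  have h1 : ∀ a, φ.gnsNonUnitalStarAlgHom a Ω = φ.toGNS a := by
    intro a
    refine ext_inner_left ℂ fun x => ?_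
    rw [← ContinuousLinearMap.adjoint_inner_left, hΩ, ← innerSL_apply_apply ℂ x]
    refine Eq.trans ?_ (h0 (innerSL ℂ x ∘L φ.toGNS) a)
    congr 1
    ext b
    simp [ContinuousLinearMap.adjoint_inner_left, gns_toGNS]
  have h2 : ∀ a, ⟪Ω, φ.toGNS a⟫_ℂ = φ a := by
    intro a
    rw [← inner_conj_symm, hΩ]
    have : innerSL ℂ (φ.toGNS a) ∘L φ.toGNS =
        φ.toStrongDual ∘L ContinuousLinearMap.mul ℂ A (star a) := by
      ext b
      simp [inner_toGNS, toStrongDual_apply]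
    rw [this, h0, toStrongDual_apply, map_star]
    simp
  refine ⟨Ω, h1, h2, ?_⟩
  have h3 : innerSL ℂ Ω ∘L φ.toGNS = φ.toStrongDual := by
    ext a
    simp [h2, toStrongDual_apply]
  rw [← inner_self_eq_norm_sq (𝕜 := ℂ), hΩ, h3]
  exact (Complex.re_le_norm _).trans (e.le_norm _)

end PositiveLinearMap

end GNS

/-! ### A bounded-below representation of `A**` in a C⋆-algebra. -/

section UniversalRepresentation

open scoped InnerProductSpace ComplexOrder

set_option linter.unusedSectionVars false

variable {A : Type v} [NonUnitalCStarAlgebra A] [PartialOrder A] [StarOrderedRing A]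

namespace PositiveLinearMap

/-- The extension of the GNS representation to `A**`. -/
noncomputable def gnsBidual (φ : A →ₚ[ℂ] ℂ) : Bidual A →⋆ₙₐ[ℂ] (φ.GNS →L[ℂ] φ.GNS) :=
  bidualRep φ.gnsNonUnitalStarAlgHom

theorem gnsBidual_of (φ : A →ₚ[ℂ] ℂ) (a : A) :
    φ.gnsBidual (.of a) = φ.gnsNonUnitalStarAlgHom a := bidualRep_of _ a

theorem gnsBidual_isOne (φ : A →ₚ[ℂ] ℂ) {e : Bidual A} (he : e.IsOne) : φ.gnsBidual e = 1 := by
  have h : ⇑(φ.gnsBidual e) = id := by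
    refine (denseRange_toGNS φ).equalizer (φ.gnsBidual e).continuous continuous_id ?_
    obtain ⟨Ω, h1, -, -⟩ := φ.exists_cyclic_vector he
    funext a
    simp only [Function.comp_apply, id]
    rw [← h1, ← gnsBidual_of, ← mul_apply_eq_comp, ← map_mul, (he _).1]
  ext x
  exact congrFun h x

/-- Evaluation at `φ` is a vector functional of the extended GNS representation. Positivity and norm
estimates in `A**` thereby reduce to operators. -/
theorem inner_gnsBidual (φ : A →ₚ[ℂ] ℂ) {Ω : φ.GNS}
    (h1 : ∀ a, φ.gnsNonUnitalStarAlgHom a Ω = φ.toGNS a)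
    (h2 : ∀ a, ⟪Ω, φ.toGNS a⟫_ℂ = φ a) (F : Bidual A) :
    ⟪Ω, φ.gnsBidual F Ω⟫_ℂ = F φ.toStrongDual := by
  rw [gnsBidual, inner_bidualRep]
  congr 1
  ext a
  rw [coeffFunctional_apply, h1, h2, toStrongDual_apply]

/-- The vector functional `a ↦ ⟪v, π a v⟫`. -/
noncomputable def ofVector {H : Type*} [NormedAddCommGroup H] [InnerProductSpace ℂ H]
    [CompleteSpace H] (π : A →⋆ₙₐ[ℂ] (H →L[ℂ] H)) (v : H) : A →ₚ[ℂ] ℂ :=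
  PositiveLinearMap.mk₀ (coeffFunctional π v v : A →ₗ[ℂ] ℂ) fun a ha => by
    obtain ⟨b, rfl⟩ := CStarAlgebra.nonneg_iff_eq_star_mul_self.mp ha
    change 0 ≤ ⟪v, π (star b * b) v⟫_ℂ
    rw [map_mul, map_star, mul_apply_eq_comp, ContinuousLinearMap.star_eq_adjoint,
      ContinuousLinearMap.adjoint_inner_right, inner_self_eq_norm_sq_to_K]
    exact (Complex.zero_le_real.mpr (sq_nonneg ‖π b v‖)).trans_eq (Complex.ofReal_pow _ _)

theorem toStrongDual_ofVector {H : Type*} [NormedAddCommGroup H] [InnerProductSpace ℂ H]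
    [CompleteSpace H] (π : A →⋆ₙₐ[ℂ] (H →L[ℂ] H)) (v : H) :
    (ofVector π v).toStrongDual = coeffFunctional π v v := rfl

end PositiveLinearMap

namespace Bidual

theorem apply_toStrongDual_star_mul_self_nonneg {e : Bidual A} (he : e.IsOne) (F : Bidual A)
    (φ : A →ₚ[ℂ] ℂ) : 0 ≤ (star F * F) φ.toStrongDual := by
  obtain ⟨Ω, h1, h2, -⟩ := φ.exists_cyclic_vector he
  rw [← φ.inner_gnsBidual h1 h2, _root_.map_mul, map_star, mul_apply_eq_comp,
    ContinuousLinearMap.star_eq_adjoint, ContinuousLinearMap.adjoint_inner_right,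
    inner_self_eq_norm_sq_to_K]
  exact (Complex.zero_le_real.mpr (sq_nonneg ‖φ.gnsBidual F Ω‖)).trans_eq (Complex.ofReal_pow _ _)

theorem IsPositive.apply_nonneg {e : Bidual A} (he : e.IsOne) {F : Bidual A}
    (hF : F.IsPositive) (φ : A →ₚ[ℂ] ℂ) : 0 ≤ F φ.toStrongDual := by
  obtain ⟨G, rfl⟩ := hF
  exact apply_toStrongDual_star_mul_self_nonneg he G φ

/-- Four positive functionals, each of norm at most `8 * ‖f‖`, account for the factor `32`. -/
theorem norm_le_of_positive {F : Bidual A} {C : ℝ} (hC : 0 ≤ C)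
    (h : ∀ φ : A →ₚ[ℂ] ℂ, ‖F φ.toStrongDual‖ ≤ C * ‖φ.toStrongDual‖) : ‖F‖ ≤ 32 * C := by
  refine norm_le_of_forall (by positivity) fun f => ?_
  obtain ⟨φ, h1, h2⟩ := exists_four_positive f
  have h3 : f = (φ 0).toStrongDual - (φ 1).toStrongDual +
      Complex.I • ((φ 2).toStrongDual - (φ 3).toStrongDual) := by
    ext a
    simp [h2 a, PositiveLinearMap.toStrongDual_apply]
  have h4 : ∀ i, ‖F (φ i).toStrongDual‖ ≤ C * (8 * ‖f‖) := fun i =>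
    (h (φ i)).trans (mul_le_mul_of_nonneg_left
      (ContinuousLinearMap.opNorm_le_bound _ (by positivity) (h1 i)) hC)
  have h5 : F f = F (φ 0).toStrongDual - F (φ 1).toStrongDual +
      Complex.I • (F (φ 2).toStrongDual - F (φ 3).toStrongDual) := by
    conv_lhs => rw [h3]
    simp only [map_add, map_sub, map_smul]
  rw [h5]
  refine (norm_add_le _ _).trans ?_
  rw [norm_smul, Complex.norm_I, one_mul]
  have := norm_sub_le (F (φ 0).toStrongDual) (F (φ 1).toStrongDual)
  have := norm_sub_le (F (φ 2).toStrongDual) (F (φ 3).toStrongDual)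
  linarith [h4 0, h4 1, h4 2, h4 3]

theorem ext_positive {F G : Bidual A}
    (h : ∀ φ : A →ₚ[ℂ] ℂ, F φ.toStrongDual = G φ.toStrongDual) : F = G := by
  have := norm_le_of_positive (F := F - G) le_rfl fun φ => by
    rw [sub_apply, h φ]; simp
  simpa [sub_eq_zero] using this

end Bidual

variable (A) in
/-- The positive functionals with nonzero GNS space. -/
def GNSIndex : Type v := {φ : A →ₚ[ℂ] ℂ // Nontrivial φ.GNS}

instance (i : GNSIndex A) : Nontrivial i.1.GNS := i.2

/-- The bounded operators on a nonzero GNS space. -/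
def GNSOperator (i : GNSIndex A) : Type v := i.1.GNS →L[ℂ] i.1.GNS

noncomputable instance (i : GNSIndex A) : CStarAlgebra (GNSOperator i) :=
  inferInstanceAs (CStarAlgebra (i.1.GNS →L[ℂ] i.1.GNS))

instance (i : GNSIndex A) : Nontrivial (GNSOperator i) :=
  inferInstanceAs (Nontrivial (i.1.GNS →L[ℂ] i.1.GNS))

variable (A) in
/-- The product of the algebras of bounded operators on the GNS spaces. -/
def GNSProduct : Type v := lp (fun i : GNSIndex A => GNSOperator i) ∞

noncomputable instance {I : Type*} {B : I → Type*} [∀ i, Nontrivial (B i)]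
    [∀ i, CStarAlgebra (B i)] : CStarAlgebra (lp B ∞) where

noncomputable instance : CStarAlgebra (GNSProduct A) :=
  inferInstanceAs (CStarAlgebra (lp (fun i : GNSIndex A => GNSOperator i) ∞))

variable (A) in
/-- The universal representation of `A**`. -/
noncomputable def universalRep : Bidual A →⋆ₙₐ[ℂ] GNSProduct A where
  toFun F := ⟨fun i => i.1.gnsBidual F, memℓp_infty ⟨‖F‖, by
    rintro _ ⟨i, rfl⟩; exact norm_bidualRep_le _ F⟩⟩
  map_smul' c F := Subtype.ext (funext fun i => map_smul i.1.gnsBidual c F)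
  map_zero' := Subtype.ext (funext fun i => map_zero i.1.gnsBidual)
  map_add' F G := Subtype.ext (funext fun i => map_add i.1.gnsBidual F G)
  map_mul' F G := Subtype.ext (funext fun i => map_mul i.1.gnsBidual F G)
  map_star' F := Subtype.ext (funext fun i => map_star i.1.gnsBidual F)

theorem norm_universalRep_le (F : Bidual A) : ‖universalRep A F‖ ≤ ‖F‖ :=
  lp.norm_le_of_forall_le (norm_nonneg _) fun _ => norm_bidualRep_le _ F

/-- Positive functionals are vector functionals with `‖Ω‖² ≤ ‖e‖ ‖φ‖`. A bound up to a constant is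
enough: it gives injectivity and closedness of images, so isometry is not needed. -/
theorem norm_le_norm_universalRep {e : Bidual A} (he : e.IsOne) (F : Bidual A) :
    ‖F‖ ≤ 32 * ‖e‖ * ‖universalRep A F‖ := by
  rw [mul_assoc]
  refine Bidual.norm_le_of_positive (by positivity) fun φ => ?_
  obtain ⟨Ω, h1, h2, h3⟩ := φ.exists_cyclic_vector he
  rw [← φ.inner_gnsBidual h1 h2]
  rcases subsingleton_or_nontrivial φ.GNS with hs | hn
  · rw [Subsingleton.elim Ω 0, inner_zero_left, norm_zero]
    positivity
  · let i : GNSIndex A := ⟨φ, hn⟩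
    have h4 : ‖φ.gnsBidual F‖ ≤ ‖universalRep A F‖ :=
      lp.norm_apply_le_norm (E := fun i : GNSIndex A => GNSOperator i) ENNReal.top_ne_zero
        (universalRep A F) i
    calc ‖⟪Ω, φ.gnsBidual F Ω⟫_ℂ‖ ≤ ‖Ω‖ * (‖φ.gnsBidual F‖ * ‖Ω‖) :=
          (norm_inner_le_norm _ _).trans
            (mul_le_mul_of_nonneg_left (ContinuousLinearMap.le_opNorm _ _) (norm_nonneg _))
      _ = ‖φ.gnsBidual F‖ * ‖Ω‖ ^ 2 := by ring
      _ ≤ ‖universalRep A F‖ * (‖e‖ * ‖φ.toStrongDual‖) :=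
          mul_le_mul h4 h3 (by positivity) (norm_nonneg _)
      _ = _ := by ring

theorem universalRep_injective {e : Bidual A} (he : e.IsOne) :
    Function.Injective (universalRep A) := by
  intro F G h
  have := norm_le_norm_universalRep he (F - G)
  rw [map_sub, h, sub_self, norm_zero, mul_zero] at this
  simpa [sub_eq_zero] using this

theorem universalRep_isOne {e : Bidual A} (he : e.IsOne) : universalRep A e = 1 :=
  Subtype.ext (funext fun i => i.1.gnsBidual_isOne he)

namespace Bidual

/-- The Arens product does not visibly reverse under the involution; the identity is pulled back
along the faithful universal representation. -/
theorem star_mul_of_isOne {e : Bidual A} (he : e.IsOne) (F G : Bidual A) :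
    star (F * G) = star G * star F :=
  universalRep_injective he (by simp only [map_star, _root_.map_mul, star_mul])

theorem star_star_eq (F : Bidual A) : star (star F) = F := by
  ext f
  have : dualStar (dualStar f) = f := by
    ext a; simp [dualStar_apply]
  rw [star_apply, star_apply, star_star, this]

theorem star_mem_center {e : Bidual A} (he : e.IsOne) {F : Bidual A} (hF : F ∈ center A) :
    star F ∈ center A := by
  rw [NonUnitalSubalgebra.mem_center_iff] at hF ⊢
  intro G
  have h := congrArg star (hF (star G))
  rwa [star_mul_of_isOne he, star_mul_of_isOne he, star_star_eq, eq_comm] at h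

theorem isOne_mem_center {e : Bidual A} (he : e.IsOne) : e ∈ center A := by
  rw [NonUnitalSubalgebra.mem_center_iff]
  intro G
  rw [(he G).1, (he G).2]

theorem isClosed_center : IsClosed (center A : Set (Bidual A)) := by
  have : (center A : Set (Bidual A)) = ⋂ G : Bidual A, {F | G * F = F * G} := by
    ext F
    simp [NonUnitalSubalgebra.mem_center_iff]
  rw [this]
  exact isClosed_iInter fun G => isClosed_eq (continuous_const.mul continuous_id)
    (continuous_id.mul continuous_const)

end Bidual

/-- The image of the center of `A**` in the universal representation. -/
noncomputable def universalCenter {e : Bidual A} (he : e.IsOne) :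
    StarSubalgebra ℂ (GNSProduct A) where
  carrier := universalRep A '' (Bidual.center A)
  mul_mem' := by
    rintro _ _ ⟨F, hF, rfl⟩ ⟨G, hG, rfl⟩
    exact ⟨F * G, mul_mem hF hG, _root_.map_mul _ _ _⟩
  add_mem' := by
    rintro _ _ ⟨F, hF, rfl⟩ ⟨G, hG, rfl⟩
    exact ⟨F + G, add_mem hF hG, map_add _ _ _⟩
  algebraMap_mem' c := ⟨c • e, SMulMemClass.smul_mem c (Bidual.isOne_mem_center he), by
    rw [map_smul, universalRep_isOne he, Algebra.algebraMap_eq_smul_one]⟩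
  star_mem' := by
    rintro _ ⟨F, hF, rfl⟩
    exact ⟨star F, Bidual.star_mem_center he hF, map_star _ _⟩

theorem isClosed_universalCenter {e : Bidual A} (he : e.IsOne) :
    IsClosed (universalCenter he : Set (GNSProduct A)) := by
  have h : AntilipschitzWith (32 * ‖e‖).toNNReal (universalRep A) := by
    refine AddMonoidHomClass.antilipschitz_of_bound _ fun F => ?_
    rw [Real.coe_toNNReal _ (by positivity)]
    exact norm_le_norm_universalRep he F
  have h' : UniformContinuous (universalRep A) :=
    (AddMonoidHomClass.lipschitz_of_bound (universalRep A) 1 fun F => by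
      simpa using norm_universalRep_le F).uniformContinuous
  have hcomp : CompleteSpace (Bidual A) :=
    inferInstanceAs (CompleteSpace (StrongDual ℂ (StrongDual ℂ A)))
  exact (h.isClosedEmbedding h').isClosedMap _ Bidual.isClosed_center

end UniversalRepresentation

/-! ### Gelfand model of the self-adjoint center. -/

section CenterModel

open scoped InnerProductSpace ComplexOrder

variable {A : Type v} [NonUnitalCStarAlgebra A] [PartialOrder A] [StarOrderedRing A]

/-- A real continuous function as a complex one. -/
def realToComplex {K : Type*} [TopologicalSpace K] (k : C(K, ℝ)) : C(K, ℂ) :=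
  ⟨fun x => (k x : ℂ), by fun_prop⟩

theorem norm_realToComplex_le {K : Type*} [TopologicalSpace K] [CompactSpace K] (k : C(K, ℝ)) :
    ‖realToComplex k‖ ≤ ‖k‖ :=
  (ContinuousMap.norm_le _ (norm_nonneg _)).mpr fun x => by
    change ‖(k x : ℂ)‖ ≤ _
    rw [Complex.norm_real]
    exact k.norm_coe_le_norm x

/-- A representation of the self-adjoint part of the center of `A**` by the real continuous
functions on a compact space. -/
structure CenterModel (A : Type v) [NonUnitalCStarAlgebra A] (e : Bidual A) (K : Type v)
    [TopologicalSpace K] [CompactSpace K] where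
  /-- The element of the center represented by a continuous function. -/
  toFun : C(K, ℝ) → Bidual A
  map_add' : ∀ k l, toFun (k + l) = toFun k + toFun l
  map_smul' : ∀ (c : ℝ) k, toFun (c • k) = (c : ℂ) • toFun k
  map_mul' : ∀ k l, toFun (k * l) = toFun k * toFun l
  map_one' : toFun 1 = e
  star_toFun : ∀ k, star (toFun k) = toFun k
  mem_center : ∀ k, toFun k ∈ Bidual.center A
  surj : ∀ F ∈ Bidual.center A, star F = F → ∃ k, toFun k = F
  inj : Function.Injective toFun
  bound : ℝ
  norm_le : ∀ k, ‖toFun k‖ ≤ bound * ‖k‖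

/-- Gelfand duality for a commutative closed unital ⋆-subalgebra. -/
theorem exists_gelfand_model {B : Type v} [CStarAlgebra B] (S : StarSubalgebra ℂ B)
    (hS : IsClosed (S : Set B)) (hcomm : ∀ x ∈ S, ∀ y ∈ S, x * y = y * x) :
    ∃ (K : Type v) (_ : TopologicalSpace K) (_ : CompactSpace K) (_ : T2Space K)
      (Θ : C(K, ℂ) →⋆ₐ[ℂ] B), (∀ f, ‖Θ f‖ = ‖f‖) ∧ (∀ f, Θ f ∈ S) ∧ ∀ x ∈ S, ∃ f, Θ f = x := by
  let i0 : CStarAlgebra S := StarSubalgebra.cstarAlgebra S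
  let i1 : CommCStarAlgebra S :=
    { i0 with mul_comm := fun x y => Subtype.ext (hcomm x x.2 y y.2) }
  let Ψ : S ≃⋆ₐ[ℂ] C(WeakDual.characterSpace ℂ S, ℂ) := gelfandStarTransform S
  refine ⟨WeakDual.characterSpace ℂ S, inferInstance, inferInstance, inferInstance,
    S.subtype.comp (Ψ.symm : C(WeakDual.characterSpace ℂ S, ℂ) →⋆ₐ[ℂ] S), ?_, ?_, ?_⟩
  · intro f
    have h := gelfandTransform_isometry S
    have h2 := h.norm_map_of_map_zero (map_zero _) (Ψ.symm f)
    refine Eq.trans h2.symm ?_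
    congr 1
    exact Ψ.apply_symm_apply f
  · exact fun f => (Ψ.symm f).2
  · intro x hx
    exact ⟨Ψ ⟨x, hx⟩, congrArg Subtype.val (Ψ.symm_apply_apply ⟨x, hx⟩)⟩

/-- The image of the center in the universal representation is a closed commutative unital
⋆-subalgebra, hence some `C(K, ℂ)`. Its real functions are pulled back by injectivity. -/
theorem exists_centerModel {e : Bidual A} (he : e.IsOne) :
    ∃ (K : Type v) (_ : TopologicalSpace K) (_ : CompactSpace K) (_ : T2Space K),
      Nonempty (CenterModel A e K) := by
  obtain ⟨K, _, _, _, Θ, hΘn, hΘm, hΘs⟩ := exists_gelfand_model (universalCenter he)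
    (isClosed_universalCenter he) (by
      rintro _ ⟨F, hF, rfl⟩ _ ⟨G, hG, rfl⟩
      rw [← map_mul, ← map_mul, NonUnitalSubalgebra.mem_center_iff.mp hF])
  have hex : ∀ f, ∃ F : Bidual A, F ∈ Bidual.center A ∧ universalRep A F = Θ f :=
    fun f => hΘm f
  have hΘinj : Function.Injective Θ := fun f g h => by
    have := hΘn (f - g)
    rw [map_sub, h, sub_self, norm_zero, eq_comm, norm_eq_zero, sub_eq_zero] at this
    exact this
  choose j hj1 hj2 using hex
  have hinj := universalRep_injective he
  refine ⟨K, inferInstance, inferInstance, inferInstance, ⟨{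
    toFun := fun k => j (realToComplex k)
    map_add' := fun k l => hinj ?_
    map_smul' := fun c k => hinj ?_
    map_mul' := fun k l => hinj ?_
    map_one' := hinj ?_
    star_toFun := fun k => hinj ?_
    mem_center := fun k => hj1 _
    surj := fun F hF hs => ?_
    inj := fun k l h => ?_
    bound := 32 * ‖e‖
    norm_le := fun k => ?_ }⟩⟩
  · have : realToComplex (k + l) = realToComplex k + realToComplex l := by
      ext x; simp [realToComplex]
    rw [map_add, hj2, hj2, hj2, this, map_add]
  · have : realToComplex (c • k) = (c : ℂ) • realToComplex k := by
      ext x; simp [realToComplex]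
    rw [map_smul, hj2, hj2, this, map_smul]
  · have : realToComplex (k * l) = realToComplex k * realToComplex l := by
      ext x; simp [realToComplex]
    rw [map_mul, hj2, hj2, hj2, this, map_mul]
  · have : realToComplex (1 : C(K, ℝ)) = 1 := by
      ext x; simp [realToComplex]
    rw [hj2, this, map_one, universalRep_isOne he]
  · have : star (realToComplex k) = realToComplex k := by
      ext x; simp [realToComplex]
    rw [map_star, hj2]
    conv_rhs => rw [← this, map_star]
  · obtain ⟨f, hf⟩ := hΘs _ ⟨F, hF, rfl⟩
    have hs' : star f = f := hΘinj (by rw [map_star, hf, ← map_star, hs])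
    let k : C(K, ℝ) := ⟨fun x => (f x).re, by fun_prop⟩
    have hk : realToComplex k = f := by
      ext x
      exact Complex.conj_eq_iff_re.mp (congrArg (fun f : C(K, ℂ) => f x) hs')
    exact ⟨k, hinj (by rw [hj2, hk, hf])⟩
  · have h1 : realToComplex k = realToComplex l := hΘinj (by
      rw [← hj2, ← hj2]
      exact congrArg _ h)
    ext x
    exact Complex.ofReal_injective (congrArg (fun f : C(K, ℂ) => f x) h1)
  · refine (norm_le_norm_universalRep he _).trans ?_
    refine mul_le_mul_of_nonneg_left ?_ (by positivity)
    rw [hj2, hΘn]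
    exact norm_realToComplex_le k

end CenterModel

/-! ### A minimax theorem. -/

section Minimax

/-- A minimax principle for functions that are linear in one variable, and continuous and
affine-like on a compact space in the other. -/
theorem exists_forall_lt_of_forall_exists_lt {X : Type*} [TopologicalSpace X] [CompactSpace X]
    [Nonempty X] {V : Type*} [AddCommGroup V] [Module ℝ V] {Y : Set V} (hY : Convex ℝ Y)
    (B : V →ₗ[ℝ] (X → ℝ)) (hB : ∀ y ∈ Y, Continuous (B y))
    (hX : ∀ x x' : X, ∀ s t : ℝ, 0 ≤ s → 0 ≤ t → s + t = 1 →
      ∃ x'' : X, ∀ y ∈ Y, B y x'' = s * B y x + t * B y x')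
    {c : ℝ} (h : ∀ x, ∃ y ∈ Y, B y x < c) : ∃ y ∈ Y, ∀ x, B y x < c := by
  choose y hyY hy using h
  -- Compactness leaves finitely many `y`; the problem becomes a separation of convex sets in a
  -- finite-dimensional space.
  obtain ⟨t, ht⟩ := isCompact_univ.elim_finite_subcover (fun x => {x' | B (y x) x' < c})
    (fun x => isOpen_lt (hB _ (hyY x)) continuous_const)
    (fun x _ => Set.mem_iUnion.mpr ⟨x, hy x⟩)
  let T : X → (t → ℝ) := fun x i => B (y i) x
  have hT : Continuous T := continuous_pi fun i => hB _ (hyY i)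
  have hC1 : Convex ℝ (Set.range T) := by
    rintro _ ⟨x, rfl⟩ _ ⟨x', rfl⟩ a b ha hb hab
    obtain ⟨x'', hx''⟩ := hX x x' a b ha hb hab
    exact ⟨x'', funext fun i => by simpa [T] using hx'' _ (hyY i)⟩
  have hC2 : IsCompact (Set.range T) := isCompact_range hT
  let D : Set (t → ℝ) := {v | ∀ i, c ≤ v i}
  have hD1 : Convex ℝ D := by
    intro v hv w hw a b ha hb hab i
    have h1 := mul_le_mul_of_nonneg_left (hv i) ha
    have h2 := mul_le_mul_of_nonneg_left (hw i) hb
    have h3 : a * c + b * c = c := by rw [← add_mul, hab, one_mul]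
    simp only [Pi.add_apply, Pi.smul_apply, smul_eq_mul]
    linarith
  have hD2 : IsClosed D := by
    simp only [D, Set.ofPred_forall]
    exact isClosed_iInter fun i => isClosed_le continuous_const (continuous_apply i)
  have hdisj : Disjoint (Set.range T) D := by
    rw [Set.disjoint_left]
    rintro _ ⟨x, rfl⟩ hx
    obtain ⟨i, hi, hxi⟩ := Set.mem_iUnion₂.mp (ht (Set.mem_univ x))
    exact absurd (hx ⟨i, hi⟩) (not_le.mpr hxi)
  obtain ⟨l, p, q, hl1, hpq, hl2⟩ := geometric_hahn_banach_compact_closed hC1 hC2 hD1 hD2 hdisj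
  classical
  have hl : ∀ v, l v = ∑ i, v i * l (Pi.single i 1) := by
    intro v
    conv_lhs => rw [pi_eq_sum_univ' v]
    simp [map_sum, map_smul]
  -- `D` is closed under increasing a coordinate; a negative weight would push `l` below `q` on `D`.
  have hnn : ∀ i, 0 ≤ l (Pi.single i 1) := by
    intro i
    by_contra! hneg
    have hcD := hl2 (fun _ => c) (fun _ => le_rfl)
    obtain ⟨n, hn⟩ := exists_nat_gt ((l (fun _ => c) - q) / (-l (Pi.single i 1)))
    rw [div_lt_iff₀ (by linarith)] at hn
    have := hl2 ((fun _ => c) + (n : ℝ) • Pi.single i 1) (fun j => by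
      have : (0 : ℝ) ≤ (n : ℝ) * (Pi.single i 1 : t → ℝ) j := by
        refine mul_nonneg (Nat.cast_nonneg n) ?_
        by_cases hij : j = i
        · subst hij; simp
        · simp [Pi.single_eq_of_ne hij]
      simpa using this)
    rw [map_add, map_smul, smul_eq_mul] at this
    linarith
  obtain ⟨x₀⟩ := ‹Nonempty X›
  have hpos : 0 < ∑ i, l (Pi.single i 1) := by
    refine lt_of_le_of_ne (Finset.sum_nonneg fun i _ => hnn i) fun h0 => ?_
    have hz : ∀ i, l (Pi.single i 1) = 0 := fun i =>
      (Finset.sum_eq_zero_iff_of_nonneg fun i _ => hnn i).mp h0.symm i (Finset.mem_univ i)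
    have h1 := hl1 _ ⟨x₀, rfl⟩
    have h2 := hl2 (fun _ => c) (fun _ => le_rfl)
    rw [hl] at h1 h2
    simp only [hz, mul_zero, Finset.sum_const_zero] at h1 h2
    linarith
  set Λ := ∑ i, l (Pi.single i 1) with hΛ
  -- The separating functional, normalized to total weight one, prescribes the convex combination.
  refine ⟨∑ i : t, (l (Pi.single i 1) / Λ) • y i, ?_, fun x => ?_⟩
  · refine hY.sum_mem (fun i _ => div_nonneg (hnn i) hpos.le) ?_ fun i _ => hyY i
    rw [← Finset.sum_div, div_self hpos.ne']
  · have h1 := hl1 _ ⟨x, rfl⟩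
    have h2 := hl2 (fun _ => c) (fun _ => le_rfl)
    rw [hl] at h1 h2
    rw [← Finset.mul_sum] at h2
    have h3 : B (∑ i : t, (l (Pi.single i 1) / Λ) • y i) x =
        (∑ i : t, T x i * l (Pi.single i 1)) / Λ := by
      rw [map_sum, Finset.sum_apply, Finset.sum_div]
      refine Finset.sum_congr rfl fun i _ => ?_
      rw [map_smul, Pi.smul_apply, smul_eq_mul]
      simp only [T]
      ring
    rw [h3, div_lt_iff₀ hpos]
    linarith

end Minimax

/-! ### Normal functionals on `C(K, ℝ)` and Radon–Nikodym densities. -/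

section NormalFunctionals

set_option linter.unusedSectionVars false

variable {K : Type v} [TopologicalSpace K] [CompactSpace K]

/-- The continuous function `k / (|k| + ε)` stands in for the sign of `k`. -/
theorem exists_approx_sign (k : C(K, ℝ)) {ε : ℝ} (hε : 0 < ε) :
    ∃ x : C(K, ℝ), ‖x‖ ≤ 1 ∧ ∀ t, |k t| - ε ≤ x t * k t := by
  have hne : ∀ t, |k t| + ε ≠ 0 := fun t => by positivity
  refine ⟨⟨fun t => k t / (|k t| + ε), by fun_prop (disch := exact hne _)⟩, ?_, fun t => ?_⟩
  · refine (ContinuousMap.norm_le _ zero_le_one).mpr fun t => ?_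
    change ‖k t / (|k t| + ε)‖ ≤ 1
    rw [norm_div, Real.norm_eq_abs, Real.norm_of_nonneg (by positivity),
      div_le_one (by positivity)]
    linarith
  · change |k t| - ε ≤ k t / (|k t| + ε) * k t
    rw [div_mul_eq_mul_div, le_div_iff₀ (by positivity), ← abs_mul_abs_self (k t)]
    nlinarith [abs_nonneg (k t)]

theorem exists_soft_partition {G : Type*} (F : Finset G) (hF : F.Nonempty) (h : G → C(K, ℝ))
    {ε : ℝ} (hε : 0 < ε) :
    ∃ f : G →₀ C(K, ℝ), (∀ x, 0 ≤ f x) ∧ (f.sum fun _ k => k) = 1 ∧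
      ∀ t, (f.sum fun x k => h x * k) t ≤ F.inf' hF h t + ε := by
  classical
  -- The weight of `x` lives only where `h x` is within `ε` of the minimum. At each point a
  -- minimizing index has weight `ε`, so the sum can be inverted.
  let w : G → C(K, ℝ) := fun x => if x ∈ F then (F.inf' hF h + ContinuousMap.const K ε - h x) ⊔ 0 else 0
  have hw : ∀ x t, 0 ≤ w x t := by
    intro x t
    by_cases hx : x ∈ F <;> simp [w, hx]
  have hW : ∀ t, 0 < ∑ x ∈ F, w x t := by
    intro t
    obtain ⟨x, hx, hxe⟩ := Finset.exists_mem_eq_inf' hF (fun x => h x t)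
    refine Finset.sum_pos' (fun x _ => hw x t) ⟨x, hx, ?_⟩
    simp [w, hx, ContinuousMap.inf'_apply, hxe, hε]
  let W : C(K, ℝ) := ⟨fun t => (∑ x ∈ F, w x t)⁻¹, by
    refine Continuous.inv₀ ?_ fun t => (hW t).ne'
    exact continuous_finsetSum _ fun x _ => (w x).continuous⟩
  refine ⟨Finsupp.onFinset F (fun x => W * w x) fun x hx => ?_, fun x => ?_, ?_, fun t => ?_⟩
  · by_contra hxF
    exact hx (by simp [w, hxF])
  · intro t
    exact mul_nonneg (inv_nonneg.mpr (hW t).le) (hw x t)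
  · rw [Finsupp.onFinset_sum _ (fun _ => rfl)]
    ext t
    rw [← Finset.mul_sum]
    simp only [ContinuousMap.mul_apply, ContinuousMap.coe_sum, Finset.sum_apply,
      ContinuousMap.one_apply]
    exact inv_mul_cancel₀ (hW t).ne'
  · rw [Finsupp.onFinset_sum _ (fun _ => mul_zero _)]
    simp only [ContinuousMap.coe_sum, Finset.sum_apply, ContinuousMap.mul_apply]
    have key : ∀ x ∈ F, h x t * (W t * w x t) ≤ (F.inf' hF h t + ε) * (W t * w x t) := by
      intro x hx
      by_cases hc : h x t ≤ F.inf' hF h t + ε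
      · exact mul_le_mul_of_nonneg_right hc
          (mul_nonneg (inv_nonneg.mpr (hW t).le) (hw x t))
      · have : w x t = 0 := by
          simp only [w, hx, if_true, ContinuousMap.sup_apply]
          refine max_eq_right ?_
          simp only [ContinuousMap.sub_apply, ContinuousMap.add_apply, ContinuousMap.const_apply,
            ContinuousMap.zero_apply]
          linarith
        simp [this]
    refine (Finset.sum_le_sum key).trans_eq ?_
    rw [← Finset.mul_sum, ← Finset.mul_sum]
    change _ * ((∑ x ∈ F, w x t)⁻¹ * _) = _
    rw [inv_mul_cancel₀ (hW t).ne', mul_one]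

/-- A family of functionals on `C(K, ℝ)` that behaves like the normal functionals on a commutative
von Neumann algebra. -/
structure IsNormalFamily (𝒩 : Set (C(K, ℝ) →ₗ[ℝ] ℝ)) : Prop where
  add_mem : ∀ μ ∈ 𝒩, ∀ ν ∈ 𝒩, μ + ν ∈ 𝒩
  mul_mem : ∀ ν ∈ 𝒩, ∀ k : C(K, ℝ), ν ∘ₗ LinearMap.mulRight ℝ k ∈ 𝒩
  nonneg_of : ∀ k : C(K, ℝ), (∀ ν ∈ 𝒩, (∀ l, 0 ≤ l → 0 ≤ ν l) → 0 ≤ ν k) → 0 ≤ k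
  compact : ∀ (C : ℝ) (U : Ultrafilter C(K, ℝ)), (∀ᶠ k in (U : Filter C(K, ℝ)), ‖k‖ ≤ C) →
    ∃ k : C(K, ℝ), ‖k‖ ≤ C ∧ ∀ ν ∈ 𝒩, Tendsto ν (U : Filter C(K, ℝ)) (𝓝 (ν k))

/-- The unit ball of `C(K, ℝ)`, with the weak topology given by a family of functionals. -/
structure WeakBall (_𝒩 : Set (C(K, ℝ) →ₗ[ℝ] ℝ)) where
  /-- The underlying function. -/
  val : C(K, ℝ)
  norm_le_one : ‖val‖ ≤ 1

variable {𝒩 : Set (C(K, ℝ) →ₗ[ℝ] ℝ)}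

instance : TopologicalSpace (WeakBall 𝒩) :=
  TopologicalSpace.induced (fun k (ν : 𝒩) => (ν : C(K, ℝ) →ₗ[ℝ] ℝ) k.1) inferInstance

instance : Nonempty (WeakBall 𝒩) := ⟨⟨0, by simp⟩⟩

theorem WeakBall.continuous_apply {ν : C(K, ℝ) →ₗ[ℝ] ℝ} (hν : ν ∈ 𝒩) :
    Continuous fun k : WeakBall 𝒩 => ν k.1 :=
  (_root_.continuous_apply (A := fun _ : 𝒩 => ℝ) (⟨ν, hν⟩ : 𝒩)).comp
    (continuous_induced_dom (f := fun (k : WeakBall 𝒩) (ν : 𝒩) => (ν : C(K, ℝ) →ₗ[ℝ] ℝ) k.1))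

theorem WeakBall.exists_convex (x x' : WeakBall 𝒩) {s t : ℝ} (hs : 0 ≤ s) (ht : 0 ≤ t)
    (hst : s + t = 1) : ∃ x'' : WeakBall 𝒩, x''.1 = s • x.1 + t • x'.1 := by
  refine ⟨⟨s • x.1 + t • x'.1, ?_⟩, rfl⟩
  refine (norm_add_le _ _).trans ?_
  rw [norm_smul, norm_smul, Real.norm_of_nonneg hs, Real.norm_of_nonneg ht]
  nlinarith [x.2, x'.2]

namespace IsNormalFamily

/-- The `compact` field at radius `1` says precisely that ultrafilters on the ball converge. -/
theorem compactSpace (h𝒩 : IsNormalFamily 𝒩) : CompactSpace (WeakBall 𝒩) := by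
  refine ⟨isCompact_iff_ultrafilter_le_nhds.mpr fun U _ => ?_⟩
  obtain ⟨k, hk, hlim⟩ := h𝒩.compact 1 (U.map WeakBall.val) (by
    rw [Ultrafilter.coe_map, eventually_map]
    exact Eventually.of_forall fun k => k.2)
  refine ⟨⟨k, hk⟩, Set.mem_univ _, ?_⟩
  rw [nhds_induced, ← tendsto_iff_comap, tendsto_pi_nhds]
  intro ν
  exact (hlim ν ν.2).comp tendsto_map

/-- A Radon–Nikodym theorem for dominated functionals. -/
theorem exists_density (h𝒩 : IsNormalFamily 𝒩) {ω ω' : C(K, ℝ) →ₗ[ℝ] ℝ} (hω' : ω' ∈ 𝒩)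
    (h0 : ∀ k, 0 ≤ k → 0 ≤ ω k) (hle : ∀ k, 0 ≤ k → ω k ≤ ω' k) :
    ∃ d : C(K, ℝ), ∀ k, ω k = ω' (d * k) := by
  have := h𝒩.compactSpace
  -- If no `x` in the ball is a density, each `x` has a `k`, rescaled so that `ω' (x * k) - ω k =
  -- -2`. Minimax then provides one `k` for which the difference is below `-1` for every `x`.
  by_contra! hcon
  let B : C(K, ℝ) →ₗ[ℝ] (WeakBall 𝒩 → ℝ) := LinearMap.pi fun x =>
    ω' ∘ₗ LinearMap.mulLeft ℝ x.1 - ω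
  have hBa : ∀ k x, B k x = ω' (x.1 * k) - ω k := fun k x => rfl
  obtain ⟨k, -, hk⟩ := exists_forall_lt_of_forall_exists_lt (Y := Set.univ) convex_univ B
    (fun k _ => (WeakBall.continuous_apply (h𝒩.mul_mem _ hω' k)).sub continuous_const)
    (fun x x' s t hs ht hst => by
      obtain ⟨x'', hx''⟩ := WeakBall.exists_convex x x' hs ht hst
      refine ⟨x'', fun k _ => ?_⟩
      simp only [hBa, hx'', add_mul, smul_mul_assoc, map_add, map_smul, smul_eq_mul]
      have : ω k = s * ω k + t * ω k := by rw [← add_mul, hst, one_mul]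
      linarith) (c := -1) (fun x => by
      obtain ⟨k, hk⟩ := hcon x.1
      refine ⟨(-2 / (ω' (x.1 * k) - ω k)) • k, Set.mem_univ _, ?_⟩
      have : B k x ≠ 0 := sub_ne_zero.mpr hk.symm
      rw [map_smul, Pi.smul_apply, smul_eq_mul, ← hBa, div_mul_cancel₀ _ this]
      norm_num)
  have h1 : 0 ≤ ω' 1 := (h0 1 zero_le_one).trans (hle 1 zero_le_one)
  -- With `x` close to the sign of `k`, `ω' (x * k) ≥ ω' |k| - 1 ≥ ω |k| - 1 ≥ ω k - 1`, a
  -- contradiction; the chosen error costs at most `1` under `ω'`.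
  obtain ⟨x, hx1, hx2⟩ := exists_approx_sign k (ε := 1 / (ω' 1 + 1)) (by positivity)
  have h2 := hk ⟨x, hx1⟩
  rw [hBa] at h2
  simp only at h2
  have h3 : 0 ≤ ω' (x * k - (|k| - (1 / (ω' 1 + 1)) • 1)) := by
    refine (fun l hl => (h0 l hl).trans (hle l hl) : ∀ l, 0 ≤ l → 0 ≤ ω' l) _ fun t => ?_
    simpa using hx2 t
  have h4 : 0 ≤ ω (|k| - k) := h0 _ (sub_nonneg.mpr (le_abs_self k))
  have h5 := hle |k| (abs_nonneg k)
  rw [map_sub, map_sub, map_smul, smul_eq_mul] at h3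
  rw [map_sub] at h4
  have h6 : 1 / (ω' 1 + 1) * ω' 1 ≤ 1 := by
    rw [div_mul_eq_mul_div, one_mul, div_le_one (by positivity)]
    linarith
  linarith

end IsNormalFamily

end NormalFunctionals

/-! ### From an equivariant mean to almost invariant partitions of unity. -/

section InvariantMean

set_option linter.unusedSectionVars false

variable {K : Type v} [TopologicalSpace K] [CompactSpace K] {Γ : Type*} [Group Γ] {G : Type*}
  [MulAction Γ G]

/-- Boundedness of a function with values in `C(K, ℝ)`. -/
def IsBddFun (φ : G → C(K, ℝ)) : Prop := ∃ C, ∀ x, ‖φ x‖ ≤ C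

/-- An equivariant `C(K, ℝ)`-valued mean on the bounded functions from `G` to `C(K, ℝ)`. -/
structure IsEquivariantMean (α : Γ → C(K, ℝ) →ₐ[ℝ] C(K, ℝ)) (P : (G → C(K, ℝ)) → C(K, ℝ)) :
    Prop where
  mean_add : ∀ φ ψ, IsBddFun φ → IsBddFun ψ → P (fun x => φ x + ψ x) = P φ + P ψ
  mean_mul : ∀ k φ, IsBddFun φ → P (fun x => k * φ x) = k * P φ
  mean_const : ∀ k, P (fun _ => k) = k
  mean_nonneg : ∀ φ, IsBddFun φ → (∀ x, 0 ≤ φ x) → 0 ≤ P φ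
  mean_equivariant : ∀ g φ, IsBddFun φ → P (fun x => α g (φ (g⁻¹ • x))) = α g (P φ)

theorem IsBddFun.add {φ ψ : G → C(K, ℝ)} (hφ : IsBddFun φ) (hψ : IsBddFun ψ) :
    IsBddFun fun x => φ x + ψ x := by
  obtain ⟨C, hC⟩ := hφ
  obtain ⟨D, hD⟩ := hψ
  exact ⟨C + D, fun x => (norm_add_le _ _).trans (add_le_add (hC x) (hD x))⟩

theorem IsBddFun.mul {φ : G → C(K, ℝ)} (hφ : IsBddFun φ) (k : C(K, ℝ)) :
    IsBddFun fun x => k * φ x := by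
  obtain ⟨C, hC⟩ := hφ
  exact ⟨‖k‖ * C, fun x => (norm_mul_le _ _).trans
    (mul_le_mul_of_nonneg_left (hC x) (norm_nonneg _))⟩

theorem isBddFun_const (k : C(K, ℝ)) : IsBddFun fun _ : G => k := ⟨‖k‖, fun _ => le_rfl⟩

theorem IsBddFun.sum {ι : Type*} (s : Finset ι) {φ : ι → G → C(K, ℝ)}
    (hφ : ∀ i ∈ s, IsBddFun (φ i)) : IsBddFun fun x => ∑ i ∈ s, φ i x := by
  classical
  induction s using Finset.induction_on with
  | empty => simpa using isBddFun_const (G := G) (0 : C(K, ℝ))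
  | insert i s hi ih =>
    simp only [Finset.sum_insert hi]
    exact (hφ i (Finset.mem_insert_self i s)).add
      (ih fun j hj => hφ j (Finset.mem_insert_of_mem hj))

theorem nonneg_of_algHom (α : C(K, ℝ) →ₐ[ℝ] C(K, ℝ)) {k : C(K, ℝ)} (hk : 0 ≤ k) : 0 ≤ α k := by
  let r : C(K, ℝ) := ⟨fun t => √(k t), by fun_prop⟩
  have : k = r * r := by
    ext t
    exact (Real.mul_self_sqrt (hk t)).symm
  rw [this, map_mul]
  exact ContinuousMap.le_def.mpr fun t => mul_self_nonneg (α r t)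

theorem norm_algHom_le (α : C(K, ℝ) →ₐ[ℝ] C(K, ℝ)) (k : C(K, ℝ)) : ‖α k‖ ≤ ‖k‖ := by
  refine (ContinuousMap.norm_le _ (norm_nonneg _)).mpr fun t => ?_
  have h1 : 0 ≤ α (algebraMap ℝ _ ‖k‖ - k) := nonneg_of_algHom α <| ContinuousMap.le_def.mpr fun t => by
    simpa [Algebra.algebraMap_eq_smul_one] using
      (le_abs_self (k t)).trans (k.norm_coe_le_norm t)
  have h2 : 0 ≤ α (algebraMap ℝ _ ‖k‖ + k) := nonneg_of_algHom α <| ContinuousMap.le_def.mpr fun t => by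
    have := (neg_abs_le (k t))
    have h3 : |k t| ≤ ‖k‖ := k.norm_coe_le_norm t
    simp only [Algebra.algebraMap_eq_smul_one, ContinuousMap.zero_apply, ContinuousMap.add_apply,
      ContinuousMap.smul_apply, ContinuousMap.one_apply, smul_eq_mul, mul_one]
    linarith
  rw [map_sub, AlgHom.commutes] at h1
  rw [map_add, AlgHom.commutes] at h2
  have h3 := ContinuousMap.le_def.mp h1 t
  have h4 := ContinuousMap.le_def.mp h2 t
  simp only [Algebra.algebraMap_eq_smul_one, ContinuousMap.zero_apply, ContinuousMap.add_apply,
    ContinuousMap.sub_apply, ContinuousMap.smul_apply, ContinuousMap.one_apply, smul_eq_mul,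
    mul_one] at h3 h4
  rw [Real.norm_eq_abs, abs_le]
  constructor <;> linarith

theorem IsBddFun.algHom {φ : G → C(K, ℝ)} (hφ : IsBddFun φ) (α : C(K, ℝ) →ₐ[ℝ] C(K, ℝ))
    (σ : G → G) : IsBddFun fun x => α (φ (σ x)) := by
  obtain ⟨C, hC⟩ := hφ
  exact ⟨C, fun x => (norm_algHom_le α _).trans (hC _)⟩

theorem IsEquivariantMean.mean_sum {α : Γ → C(K, ℝ) →ₐ[ℝ] C(K, ℝ)} {P : (G → C(K, ℝ)) → C(K, ℝ)}
    (hP : IsEquivariantMean α P) {ι : Type*} (s : Finset ι) {φ : ι → G → C(K, ℝ)}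
    (hφ : ∀ i ∈ s, IsBddFun (φ i)) : P (fun x => ∑ i ∈ s, φ i x) = ∑ i ∈ s, P (φ i) := by
  classical
  induction s using Finset.induction_on with
  | empty => simpa using hP.mean_const 0
  | insert i s hi ih =>
    simp only [Finset.sum_insert hi]
    rw [hP.mean_add _ _ (hφ i (Finset.mem_insert_self i s))
      (.sum s fun j hj => hφ j (Finset.mem_insert_of_mem hj)),
      ih fun j hj => hφ j (Finset.mem_insert_of_mem hj)]

/-- The displacement `x ↦ α_g (f (g⁻¹ x)) - f x` of a finitely supported function. -/
noncomputable def displacement (α : Γ → C(K, ℝ) →ₐ[ℝ] C(K, ℝ)) (g : Γ) :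
    (G →₀ C(K, ℝ)) →ₗ[ℝ] (G →₀ C(K, ℝ)) :=
  Finsupp.mapRange.linearMap (α g).toLinearMap ∘ₗ
    (Finsupp.domLCongr (MulAction.toPerm g)).toLinearMap - LinearMap.id

theorem displacement_apply (α : Γ → C(K, ℝ) →ₐ[ℝ] C(K, ℝ)) (g : Γ) (f : G →₀ C(K, ℝ)) (x : G) :
    displacement α g f x = α g (f (g⁻¹ • x)) - f x := rfl

theorem displacement_single (α : Γ → C(K, ℝ) →ₐ[ℝ] C(K, ℝ)) (g : Γ) (x : G) (k : C(K, ℝ)) :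
    displacement α g (.single x k) = .single (g • x) (α g k) - .single x k := by
  simp [displacement]

/-- Pairing of a finitely supported function with an arbitrary one. -/
noncomputable def finsuppPairing (ω : C(K, ℝ) →ₗ[ℝ] ℝ) (φ : G → C(K, ℝ)) :
    (G →₀ C(K, ℝ)) →ₗ[ℝ] ℝ :=
  Finsupp.lsum ℝ fun x => ω ∘ₗ LinearMap.mulLeft ℝ (φ x)

theorem finsuppPairing_apply (ω : C(K, ℝ) →ₗ[ℝ] ℝ) (φ : G → C(K, ℝ)) (f : G →₀ C(K, ℝ)) :
    finsuppPairing ω φ f = f.sum fun x k => ω (φ x * k) := rfl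

theorem finsuppPairing_single (ω : C(K, ℝ) →ₗ[ℝ] ℝ) (φ : G → C(K, ℝ)) (x : G) (k : C(K, ℝ)) :
    finsuppPairing ω φ (.single x k) = ω (φ x * k) := by
  simp [finsuppPairing]

variable {𝒩 : Set (C(K, ℝ) →ₗ[ℝ] ℝ)}

/-- A bounded family whose mean is nonpositive against a normal positive functional can be
averaged by a finite partition of unity to something small. -/
theorem IsEquivariantMean.exists_partition_lt [Nonempty G] (h𝒩 : IsNormalFamily 𝒩)
    {α : Γ → C(K, ℝ) →ₐ[ℝ] C(K, ℝ)} {P : (G → C(K, ℝ)) → C(K, ℝ)}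
    (hP : IsEquivariantMean α P) {ω : C(K, ℝ) →ₗ[ℝ] ℝ} (hω : ω ∈ 𝒩)
    (hpos : ∀ k, 0 ≤ k → 0 ≤ ω k) {h : G → C(K, ℝ)} (hh : IsBddFun h) (hPh : ω (P h) ≤ 0)
    {ε : ℝ} (hε : 0 < ε) :
    ∃ f : G →₀ C(K, ℝ), (∀ x, 0 ≤ f x) ∧ (f.sum fun _ k => k) = 1 ∧
      finsuppPairing ω h f < ε := by
  classical
  obtain ⟨x₀⟩ := ‹Nonempty G›
  obtain ⟨C, hC⟩ := hh
  -- Finite infima decrease as `F` grows, and a weak limit `l` of them lies below every `h x`. The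
  -- point `x₀` keeps the infimum over a nonempty set.
  let hF : Finset G → C(K, ℝ) := fun F => (insert x₀ F).inf' (Finset.insert_nonempty _ _) h
  have hFle : ∀ F x, x ∈ F → hF F ≤ h x := fun F x hx =>
    Finset.inf'_le _ (Finset.mem_insert_of_mem hx)
  have hFn : ∀ F, ‖hF F‖ ≤ C := by
    intro F
    refine (ContinuousMap.norm_le _ ((norm_nonneg _).trans (hC x₀))).mpr fun t => ?_
    obtain ⟨x, -, hx⟩ := Finset.exists_mem_eq_inf' (Finset.insert_nonempty x₀ F) (fun x => h x t)
    simp only [hF, ContinuousMap.inf'_apply, hx]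
    exact ((h x).norm_coe_le_norm t).trans (hC x)
  let U : Ultrafilter (Finset G) := Ultrafilter.of atTop
  have hU : (U : Filter (Finset G)) ≤ atTop := Ultrafilter.of_le _
  obtain ⟨l, -, hlim⟩ := h𝒩.compact C (U.map hF) (by
    rw [Ultrafilter.coe_map, eventually_map]
    exact Eventually.of_forall hFn)
  have hlim' : ∀ ν ∈ 𝒩, Tendsto (fun F => ν (hF F)) U (𝓝 (ν l)) := fun ν hν =>
    (hlim ν hν).comp tendsto_map
  have hle : ∀ x, 0 ≤ h x - l := by
    intro x
    refine h𝒩.nonneg_of _ fun ν hν hνpos => ?_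
    rw [map_sub, sub_nonneg]
    refine le_of_tendsto (hlim' ν hν) (hU ?_)
    filter_upwards [eventually_ge_atTop ({x} : Finset G)] with F hxF
    have := hνpos _ (sub_nonneg.mpr (hFle F x (hxF (Finset.mem_singleton_self x))))
    rw [map_sub] at this
    linarith
  -- Since `l ≤ h x` for all `x` and the mean fixes constants, `l ≤ P h`. Only this inequality
  -- relates the mean to normal limits.
  have hωl : ω l ≤ 0 := by
    have h1 := hP.mean_nonneg (fun x => h x + (-1) * l) (IsBddFun.add ⟨C, hC⟩ (isBddFun_const _))
      fun x => by simpa [sub_eq_add_neg] using hle x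
    rw [hP.mean_add _ _ ⟨C, hC⟩ (isBddFun_const _), hP.mean_const] at h1
    have h2 := hpos _ h1
    rw [map_add, neg_one_mul, map_neg] at h2
    linarith
  have h1nn : 0 ≤ ω 1 := hpos 1 zero_le_one
  obtain ⟨F, hFlt⟩ := ((hlim' ω hω).eventually_lt_const
    (show ω l < ε / 2 by linarith)).exists
  obtain ⟨f, hf0, hf1, hf⟩ := exists_soft_partition (insert x₀ F) (Finset.insert_nonempty _ _) h
    (ε := ε / (2 * (ω 1 + 1))) (by positivity)
  refine ⟨f, hf0, hf1, ?_⟩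
  have h2 : finsuppPairing ω h f = ω (f.sum fun x k => h x * k) := by
    rw [finsuppPairing_apply, Finsupp.sum, Finsupp.sum, map_sum]
  have h3 := hpos (hF F + (ε / (2 * (ω 1 + 1))) • 1 - f.sum fun x k => h x * k) <| ContinuousMap.le_def.mpr fun t => by
    have := hf t
    simp only [ContinuousMap.zero_apply, ContinuousMap.sub_apply, ContinuousMap.add_apply,
      ContinuousMap.smul_apply, ContinuousMap.one_apply, smul_eq_mul, mul_one, hF]
    linarith
  rw [map_sub, map_add, map_smul, smul_eq_mul] at h3
  have h4 : ε / (2 * (ω 1 + 1)) * ω 1 ≤ ε / 2 := by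
    rw [div_mul_eq_mul_div, div_le_div_iff₀ (by positivity) (by positivity)]
    nlinarith
  rw [h2]
  linarith

/-- Testing each coordinate against its own approximate sign recovers the `L¹`-norm, with an error
`η * ω 1` per point of the support. -/
theorem sum_abs_le_of_forall_sign_lt {ω : C(K, ℝ) →ₗ[ℝ] ℝ} (hpos : ∀ k, 0 ≤ k → 0 ≤ ω k)
    {ι : Type*} [Fintype ι] (u : ι → G →₀ C(K, ℝ)) {c : ℝ}
    (h : ∀ φ : ι → G → C(K, ℝ), (∀ i x, ‖φ i x‖ ≤ 1) →
      ∑ i, ((u i).sum fun x k => ω (φ i x * k)) < c) :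
    ∑ i, ((u i).sum fun _ k => ω |k|) ≤ c := by
  refine le_of_forall_pos_le_add fun ε hε => ?_
  obtain ⟨n, hn⟩ : ∃ n : ℝ, n = ∑ i, ((u i).support.card : ℝ) := ⟨_, rfl⟩
  have hn0 : 0 ≤ n := by rw [hn]; exact Finset.sum_nonneg fun i _ => Nat.cast_nonneg _
  have h1nn : 0 ≤ ω 1 := hpos 1 zero_le_one
  obtain ⟨η, hη⟩ : ∃ η : ℝ, η = ε / (n * ω 1 + 1) := ⟨_, rfl⟩
  have hη0 : 0 < η := by rw [hη]; positivity
  choose φ hφ1 hφ2 using fun (i : ι) (x : G) => exists_approx_sign (u i x) hη0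
  have h1 := h φ hφ1
  have h2 : ∀ i x, ω |u i x| - η * ω 1 ≤ ω (φ i x * u i x) := by
    intro i x
    have := hpos (φ i x * u i x - (|u i x| - η • 1)) <| ContinuousMap.le_def.mpr
      fun t => by simpa using hφ2 i x t
    rw [map_sub, map_sub, map_smul, smul_eq_mul] at this
    linarith
  have h3 : ∑ i, (((u i).sum fun _ k => ω |k|) - (u i).support.card * (η * ω 1)) < c := by
    refine lt_of_le_of_lt (Finset.sum_le_sum fun i _ => ?_) h1
    rw [Finsupp.sum, Finsupp.sum, ← nsmul_eq_mul, ← Finset.sum_const, ← Finset.sum_sub_distrib]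
    exact Finset.sum_le_sum fun x _ => h2 i x
  rw [Finset.sum_sub_distrib, ← Finset.sum_mul, ← hn] at h3
  have h4 : n * (η * ω 1) ≤ ε := by
    have : n * (η * ω 1) = ε * (n * ω 1) / (n * ω 1 + 1) := by
      rw [hη]; ring
    rw [this, div_le_iff₀ (by positivity)]
    nlinarith
  linarith

/-- The finite partitions of unity indexed by `G`. -/
def finitePartitions (G K : Type*) [TopologicalSpace K] [CompactSpace K] : Set (G →₀ C(K, ℝ)) :=
  {f | (∀ x, 0 ≤ f x) ∧ (f.sum fun _ k => k) = 1}

theorem convex_finitePartitions : Convex ℝ (finitePartitions G K) := by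
  rintro f ⟨hf0, hf1⟩ f' ⟨hf0', hf1'⟩ a b ha hb hab
  refine ⟨fun x => ?_, ?_⟩
  · exact add_nonneg (smul_nonneg ha (hf0 x)) (smul_nonneg hb (hf0' x))
  · rw [Finsupp.sum_add_index' (fun _ => rfl) (fun _ _ _ => rfl),
      Finsupp.sum_smul_index' (fun _ => rfl), Finsupp.sum_smul_index' (fun _ => rfl),
      ← Finsupp.smul_sum, ← Finsupp.smul_sum, hf1, hf1', ← add_smul, hab, one_smul]

/-- After a change of variable the displacement pairing is the pairing of `f` itself with one
bounded function, whose mean vanishes by equivariance. This is the pointwise hypothesis of the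
minimax theorem. -/
theorem IsEquivariantMean.exists_partition_displacement_lt [Nonempty G] (h𝒩 : IsNormalFamily 𝒩)
    {α : Γ → C(K, ℝ) →ₐ[ℝ] C(K, ℝ)} (hα : ∀ g k, α g (α g⁻¹ k) = k)
    {P : (G → C(K, ℝ)) → C(K, ℝ)} (hP : IsEquivariantMean α P) {ω : C(K, ℝ) →ₗ[ℝ] ℝ}
    (hω : ω ∈ 𝒩) (hωα : ∀ g, ω ∘ₗ (α g).toLinearMap ∈ 𝒩)
    (hpos : ∀ k, 0 ≤ k → 0 ≤ ω k) (S : Finset Γ) (φ : S → G → C(K, ℝ))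
    (hφ : ∀ g : S, IsBddFun (φ g)) {ε : ℝ} (hε : 0 < ε) :
    ∃ f ∈ finitePartitions G K,
      ∑ g : S, finsuppPairing ω (φ g) (displacement α (g : Γ) f) < ε := by
  classical
  have hposα : ∀ g k, 0 ≤ k → 0 ≤ ω (α g k) := fun g k hk => hpos _ (nonneg_of_algHom _ hk)
  -- A common functional dominating `ω` and all `ω ∘ α g`; the densities `d` and `dg g` express each
  -- of these through it.
  obtain ⟨ω', hω'a, hω'⟩ : ∃ ω' : C(K, ℝ) →ₗ[ℝ] ℝ,
      (∀ k, ω' k = ω k + ∑ g ∈ S, ω (α g k)) ∧ ω' ∈ 𝒩 := by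
    refine ⟨ω + ∑ g ∈ S, ω ∘ₗ (α g).toLinearMap, fun k => by simp [LinearMap.sum_apply], ?_⟩
    clear hφ φ
    induction S using Finset.induction_on with
    | empty => simpa using hω
    | insert g T hg ih =>
      rw [Finset.sum_insert hg, add_left_comm]
      exact h𝒩.add_mem _ (hωα g) _ ih
  have hω'pos : ∀ k, 0 ≤ k → 0 ≤ ω' k := fun k hk => by
    rw [hω'a]
    exact add_nonneg (hpos k hk) (Finset.sum_nonneg fun g _ => hposα g k hk)
  obtain ⟨d, hd⟩ := h𝒩.exists_density hω' hpos fun k hk => by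
    rw [hω'a]
    linarith [Finset.sum_nonneg fun g (_ : g ∈ S) => hposα g k hk]
  have hex : ∀ g : S, ∃ d : C(K, ℝ), ∀ k, ω (α g k) = ω' (d * k) := fun g =>
    h𝒩.exists_density (ω := ω ∘ₗ (α g).toLinearMap) hω' (hposα g) fun k hk => by
      rw [hω'a]
      have := Finset.single_le_sum (f := fun g => ω (α g k)) (fun g _ => hposα g k hk) g.2
      have := hpos k hk
      simp only [LinearMap.comp_apply, AlgHom.toLinearMap_apply]
      linarith
  choose dg hdg using hex
  obtain ⟨ψ, hψ⟩ : ∃ ψ : S → G → C(K, ℝ),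
      ψ = fun (g : S) x => α (g : Γ)⁻¹ (φ g ((g : Γ) • x)) := ⟨_, rfl⟩
  have hψb : ∀ g, IsBddFun (ψ g) := fun g => by
    rw [hψ]
    exact (hφ g).algHom (α (g : Γ)⁻¹) (fun x => (g : Γ) • x)
  have hhg : ∀ g, IsBddFun fun x => dg g * ψ g x + -d * φ g x := fun g =>
    ((hψb g).mul _).add ((hφ g).mul _)
  have hPψ : ∀ g : S, P (ψ g) = α (g : Γ)⁻¹ (P (φ g)) := fun g => by
    have := hP.mean_equivariant (g : Γ)⁻¹ _ (hφ g)
    rw [inv_inv] at this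
    rw [hψ]
    exact this
  -- The densities pass through `P`, leaving `ω (α g (P (ψ g))) - ω (P (φ g))`; this vanishes since
  -- `P (ψ g) = α g⁻¹ (P (φ g))`.
  have hPh : ω' (P fun x => ∑ g : S, (dg g * ψ g x + -d * φ g x)) = 0 := by
    rw [hP.mean_sum _ fun g _ => hhg g, map_sum]
    refine Finset.sum_eq_zero fun g _ => ?_
    rw [hP.mean_add _ _ ((hψb g).mul _) ((hφ g).mul _), hP.mean_mul _ _ (hψb g),
      hP.mean_mul _ _ (hφ g), hPψ, map_add, ← hdg, hα, neg_mul, map_neg, ← hd, add_neg_cancel]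
  obtain ⟨f, hf0, hf1, hf⟩ := hP.exists_partition_lt h𝒩 hω' hω'pos
    (.sum _ fun g _ => hhg g) hPh.le hε
  refine ⟨f, ⟨hf0, hf1⟩, lt_of_eq_of_lt ?_ hf⟩
  have : ∑ g : S, finsuppPairing ω (φ g) ∘ₗ displacement α (g : Γ) =
      finsuppPairing ω' fun x => ∑ g : S, (dg g * ψ g x + -d * φ g x) := by
    refine Finsupp.lhom_ext fun x k => ?_
    rw [LinearMap.sum_apply, finsuppPairing_single, Finset.sum_mul, map_sum]
    refine Finset.sum_congr rfl fun g _ => ?_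
    have h1 : α (g : Γ) (ψ g x) = φ g ((g : Γ) • x) := by rw [hψ]; exact hα _ _
    rw [LinearMap.comp_apply, displacement_single, map_sub, finsuppPairing_single,
      finsuppPairing_single, add_mul, mul_assoc, mul_assoc, map_add, ← hdg,
      map_mul (α (g : Γ)), h1, neg_mul, map_neg, ← hd, sub_eq_add_neg]
  have h2 := LinearMap.congr_fun this f
  rw [LinearMap.sum_apply] at h2
  exact h2

/-- An equivariant mean yields finite partitions of unity that are approximately invariant in the
`L¹`-norm of a positive normal functional. -/
theorem IsEquivariantMean.exists_approx_invariant [Nonempty G] (h𝒩 : IsNormalFamily 𝒩)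
    {α : Γ → C(K, ℝ) →ₐ[ℝ] C(K, ℝ)} (hα : ∀ g k, α g (α g⁻¹ k) = k)
    {P : (G → C(K, ℝ)) → C(K, ℝ)} (hP : IsEquivariantMean α P) {ω : C(K, ℝ) →ₗ[ℝ] ℝ}
    (hω : ω ∈ 𝒩) (hωα : ∀ g, ω ∘ₗ (α g).toLinearMap ∈ 𝒩)
    (hpos : ∀ k, 0 ≤ k → 0 ≤ ω k) (S : Finset Γ) {ε : ℝ} (hε : 0 < ε) :
    ∃ f ∈ finitePartitions G K,
      ∀ g ∈ S, ((displacement α g f).sum fun _ k => ω |k|) < ε := by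
  have hcpt := h𝒩.compactSpace
  obtain ⟨B, hBa⟩ : ∃ B : (G →₀ C(K, ℝ)) →ₗ[ℝ] ((S → G → WeakBall 𝒩) → ℝ), ∀ f φ, B f φ =
      ∑ g : S, finsuppPairing ω (fun x => (φ g x).val) (displacement α (g : Γ) f) :=
    ⟨LinearMap.pi fun φ =>
      ∑ g : S, finsuppPairing ω (fun x => (φ g x).val) ∘ₗ displacement α (g : Γ),
      fun f φ => by simp [LinearMap.sum_apply]⟩
  have hBcont : ∀ f, Continuous (B f) := by
    intro f
    rw [show B f = fun φ => _ from funext (hBa f)]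
    refine continuous_finsetSum _ fun g _ => ?_
    refine continuous_finsetSum _ fun x _ => ?_
    exact (WeakBall.continuous_apply (h𝒩.mul_mem ω hω (displacement α g f x))).comp
      ((continuous_apply x).comp (continuous_apply g))
  have hBconv : ∀ φ φ' : S → G → WeakBall 𝒩, ∀ s t : ℝ, 0 ≤ s → 0 ≤ t → s + t = 1 →
      ∃ φ'', ∀ f ∈ finitePartitions G K, B f φ'' = s * B f φ + t * B f φ' := by
    intro φ φ' s t hs ht hst
    choose φ'' hφ'' using fun g x => WeakBall.exists_convex (φ g x) (φ' g x) hs ht hst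
    refine ⟨φ'', fun f _ => ?_⟩
    rw [hBa, hBa, hBa, Finset.mul_sum, Finset.mul_sum, ← Finset.sum_add_distrib]
    refine Finset.sum_congr rfl fun g _ => ?_
    rw [finsuppPairing_apply, finsuppPairing_apply, finsuppPairing_apply, Finsupp.sum,
      Finsupp.sum, Finsupp.sum, Finset.mul_sum, Finset.mul_sum, ← Finset.sum_add_distrib]
    refine Finset.sum_congr rfl fun x _ => ?_
    rw [hφ'', add_mul, smul_mul_assoc, smul_mul_assoc, map_add, map_smul, map_smul, smul_eq_mul,
      smul_eq_mul]
  -- The sign choices form a product of weakly compact balls, so one partition serves all of them at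
  -- once.
  obtain ⟨f, hfm, hf⟩ := exists_forall_lt_of_forall_exists_lt convex_finitePartitions B
    (fun f _ => hBcont f) hBconv (c := ε / 2) fun φ => by
      simp only [hBa]
      exact hP.exists_partition_displacement_lt h𝒩 hα hω hωα hpos S _
        (fun g => ⟨1, fun x => (φ g x).norm_le_one⟩) (half_pos hε)
  refine ⟨f, hfm, fun g₀ hg₀ => ?_⟩
  have h4 : ∑ g : S, ((displacement α (g : Γ) f).sum fun _ k => ω |k|) ≤ ε / 2 := by
    refine sum_abs_le_of_forall_sign_lt hpos (fun g : S => displacement α (g : Γ) f)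
      fun φ hφ => ?_
    have := hf fun g x => ⟨φ g x, hφ g x⟩
    rw [hBa] at this
    simpa only [finsuppPairing_apply] using this
  have h6 : ∀ g : S, 0 ≤ ((displacement α (g : Γ) f).sum fun _ k => ω |k|) := fun g =>
    Finset.sum_nonneg fun x _ => hpos _ (abs_nonneg _)
  exact ((Finset.single_le_sum (fun g _ => h6 g) (Finset.mem_univ (⟨g₀, hg₀⟩ : S))).trans
    h4).trans_lt (half_lt_self hε)

end InvariantMean

/-! ### Weak⋆ limits in the bidual. -/

section BidualLimits

open scoped InnerProductSpace ComplexOrder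

set_option linter.unusedSectionVars false

variable {A : Type v} [NonUnitalCStarAlgebra A] [PartialOrder A] [StarOrderedRing A]

namespace Bidual

/-- Bounded subsets of `A**` are relatively compact for pointwise convergence on `A*`. -/
theorem exists_limit {ι : Type*} (U : Ultrafilter ι) (F : ι → Bidual A) {C : ℝ}
    (hF : ∀ᶠ i in (U : Filter ι), ‖F i‖ ≤ C) :
    ∃ F₀ : Bidual A, ∀ f : StrongDual ℂ A,
      Tendsto (fun i => F i f) (U : Filter ι) (𝓝 (F₀ f)) := by
  have h : ∀ f : StrongDual ℂ A, ∃ z : ℂ, ‖z‖ ≤ C * ‖f‖ ∧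
      Tendsto (fun i => F i f) (U : Filter ι) (𝓝 z) := by
    intro f
    have hc := isCompact_iff_ultrafilter_le_nhds.mp (isCompact_closedBall (0 : ℂ) (C * ‖f‖))
      (U.map fun i => F i f) (by
        rw [Ultrafilter.coe_map, le_principal_iff, mem_map]
        filter_upwards [hF] with i hi
        simpa using ((F i).le_norm f).trans (mul_le_mul_of_nonneg_right hi (norm_nonneg f)))
    obtain ⟨z, hz, hlim⟩ := hc
    exact ⟨z, by simpa using hz, hlim⟩
  choose z hz hlim using h
  let ℓ : StrongDual ℂ A →ₗ[ℂ] ℂ :=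
    { toFun := z
      map_add' := fun f g => tendsto_nhds_unique (hlim (f + g)) (by
        simpa only [map_add] using (hlim f).add (hlim g))
      map_smul' := fun c f => tendsto_nhds_unique (hlim (c • f)) (by
        simpa only [map_smul, RingHom.id_apply] using (hlim f).const_smul c) }
  exact ⟨(toDual A).symm (ℓ.mkContinuous C hz), hlim⟩

/-- `H ↦ H * G` is weak⋆ continuous by definition of the product. For `H ↦ G * H` the GNS
representation helps: moving `G` to the other side of the inner product shows `(G * H) φ` to be `H`
at a coefficient functional. -/
theorem mem_center_of_tendsto {e : Bidual A} (he : e.IsOne) {ι : Type*} {l : Filter ι} [l.NeBot]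
    {F : ι → Bidual A} {F₀ : Bidual A} (hF : ∀ i, F i ∈ center A)
    (hlim : ∀ f : StrongDual ℂ A, Tendsto (fun i => F i f) l (𝓝 (F₀ f))) : F₀ ∈ center A := by
  rw [NonUnitalSubalgebra.mem_center_iff]
  intro G
  refine ext_positive fun φ => ?_
  obtain ⟨Ω, h1, h2, -⟩ := φ.exists_cyclic_vector he
  have key : ∀ H : Bidual A, (G * H) φ.toStrongDual =
      H (coeffFunctional φ.gnsNonUnitalStarAlgHom
        (ContinuousLinearMap.adjoint (φ.gnsBidual G) Ω) Ω) := by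
    intro H
    rw [← φ.inner_gnsBidual h1 h2, _root_.map_mul, mul_apply_eq_comp,
      ← ContinuousLinearMap.adjoint_inner_left, PositiveLinearMap.gnsBidual, inner_bidualRep]
  rw [key]
  refine tendsto_nhds_unique (hlim _) ?_
  have : ∀ i, F i (coeffFunctional φ.gnsNonUnitalStarAlgHom
        (ContinuousLinearMap.adjoint (φ.gnsBidual G) Ω) Ω) =
      F i (act G φ.toStrongDual) := fun i => by
    rw [← key, NonUnitalSubalgebra.mem_center_iff.mp (hF i), mul_apply]
  simp only [this]
  exact hlim _

theorem star_eq_of_tendsto {ι : Type*} {l : Filter ι} [l.NeBot]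
    {F : ι → Bidual A} {F₀ : Bidual A} (hF : ∀ i, star (F i) = F i)
    (hlim : ∀ f : StrongDual ℂ A, Tendsto (fun i => F i f) l (𝓝 (F₀ f))) : star F₀ = F₀ := by
  ext f
  refine tendsto_nhds_unique ?_ (hlim f)
  rw [star_apply]
  refine ((hlim (dualStar f)).star).congr fun i => ?_
  conv_rhs => rw [← hF i, star_apply]

theorem IsOne.unique {e e' : Bidual A} (he : e.IsOne) (he' : e'.IsOne) : e = e' := by
  rw [← (he' e).1, (he e').2]

theorem map_star (θ : A ≃⋆ₐ[ℂ] A) (F : Bidual A) : map θ (star F) = star (map θ F) := by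
  ext f
  simp only [map_apply, star_apply]
  congr 2
  ext a
  simp [dualStar_apply, autCLM_apply, StarHomClass.map_star]

theorem IsOne.map {e : Bidual A} (he : e.IsOne) (θ : A ≃⋆ₐ[ℂ] A) : (Bidual.map θ e).IsOne := by
  intro F
  constructor
  · conv_lhs => rw [← map_map_symm θ F]
    rw [← map_mul, (he _).1, map_map_symm]
  · conv_lhs => rw [← map_map_symm θ F]
    rw [← map_mul, (he _).2, map_map_symm]

end Bidual

end BidualLimits

/-! ### Order, automorphisms and mean on the model of the center. -/

namespace CenterModel

open scoped InnerProductSpace ComplexOrder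

set_option linter.unusedSectionVars false

variable {A : Type v} [NonUnitalCStarAlgebra A] {e : Bidual A}
  {K : Type v} [TopologicalSpace K] [CompactSpace K] (J : CenterModel A e K)

/-- The underlying additive map. -/
noncomputable def addHom : C(K, ℝ) →+ Bidual A := AddMonoidHom.mk' J.toFun J.map_add'

theorem map_neg (k : C(K, ℝ)) : J.toFun (-k) = -J.toFun k := _root_.map_neg J.addHom k

theorem map_sub (k l : C(K, ℝ)) : J.toFun (k - l) = J.toFun k - J.toFun l :=
  _root_.map_sub J.addHom k l

theorem map_zero : J.toFun 0 = 0 := _root_.map_zero J.addHom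

theorem map_sum {ι : Type*} (s : Finset ι) (k : ι → C(K, ℝ)) :
    J.toFun (∑ i ∈ s, k i) = ∑ i ∈ s, J.toFun (k i) := _root_.map_sum J.addHom k s

/-- Evaluation of the represented central element at a functional. -/
noncomputable def eval (f : StrongDual ℂ A) : C(K, ℝ) →ₗ[ℝ] ℝ where
  toFun k := (J.toFun k f).re
  map_add' k l := by rw [J.map_add', Bidual.add_apply, Complex.add_re]
  map_smul' c k := by rw [J.map_smul', Bidual.smul_apply]; simp

theorem eval_apply (f : StrongDual ℂ A) (k : C(K, ℝ)) : J.eval f k = (J.toFun k f).re := rfl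

theorem isPositive {k : C(K, ℝ)} (hk : 0 ≤ k) : (J.toFun k).IsPositive := by
  let r : C(K, ℝ) := ⟨fun t => √(k t), by fun_prop⟩
  have : k = r * r := by
    ext t
    exact (Real.mul_self_sqrt (hk t)).symm
  exact ⟨J.toFun r, by rw [J.star_toFun, ← J.map_mul', ← this]⟩

variable [PartialOrder A] [StarOrderedRing A]

theorem eval_nonneg (he : e.IsOne) (φ : A →ₚ[ℂ] ℂ) {k : C(K, ℝ)} (hk : 0 ≤ k) :
    0 ≤ J.eval φ.toStrongDual k :=
  (Complex.nonneg_iff.mp ((J.isPositive hk).apply_nonneg he φ)).1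

/-- Let `w` be the negative part of `k`. The vector functional at `w Ω` evaluates `k` as `φ (w k w)
= -φ (w³)`, so `w³` vanishes at every positive functional and `w = 0`. -/
theorem nonneg_of_eval (he : e.IsOne) {k : C(K, ℝ)}
    (hk : ∀ φ : A →ₚ[ℂ] ℂ, 0 ≤ J.eval φ.toStrongDual k) : 0 ≤ k := by
  let w : C(K, ℝ) := (-k) ⊔ 0
  have hw : w * k * w = -(w * w * w) := by
    ext t
    simp only [w, ContinuousMap.mul_apply, ContinuousMap.neg_apply, ContinuousMap.sup_apply,
      ContinuousMap.zero_apply]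
    rcases le_total (k t) 0 with h | h
    · rw [max_eq_left (by linarith)]; ring
    · rw [max_eq_right (by linarith)]; ring
  have hw0 : 0 ≤ w := le_sup_right
  have hw3 : 0 ≤ w * w * w := ContinuousMap.le_def.mpr fun t =>
    mul_nonneg (mul_nonneg (hw0 t) (hw0 t)) (hw0 t)
  have hz : J.toFun (w * w * w) = 0 := by
    refine Bidual.ext_positive fun φ => ?_
    obtain ⟨Ω, h1, h2, -⟩ := φ.exists_cyclic_vector he
    have h3 := hk (PositiveLinearMap.ofVector φ.gnsNonUnitalStarAlgHom
      (φ.gnsBidual (J.toFun w) Ω))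
    have h4 : J.toFun k (PositiveLinearMap.ofVector φ.gnsNonUnitalStarAlgHom
        (φ.gnsBidual (J.toFun w) Ω)).toStrongDual = J.toFun (w * k * w) φ.toStrongDual := by
      rw [PositiveLinearMap.toStrongDual_ofVector, ← inner_bidualRep, ← φ.inner_gnsBidual h1 h2,
        J.map_mul', J.map_mul', _root_.map_mul, _root_.map_mul, mul_apply_eq_comp,
        mul_apply_eq_comp]
      conv_lhs => rw [← ContinuousLinearMap.adjoint_inner_right,
        ← ContinuousLinearMap.star_eq_adjoint, ← StarHomClass.map_star, J.star_toFun]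
      rfl
    rw [eval_apply, h4, hw, J.map_neg] at h3
    have h5 := Complex.nonneg_iff.mp ((J.isPositive hw3).apply_nonneg he φ)
    have h6 : (-J.toFun (w * w * w)) φ.toStrongDual = -(J.toFun (w * w * w) φ.toStrongDual) := rfl
    rw [h6, Complex.neg_re] at h3
    exact Complex.ext (le_antisymm (neg_nonneg.mp h3) h5.1) h5.2.symm
  have hw0 : w * w * w = 0 := J.inj (by rw [hz, J.map_zero])
  refine ContinuousMap.le_def.mpr fun t => ?_
  have h7 : w t * w t * w t = 0 := congrArg (fun f : C(K, ℝ) => f t) hw0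
  have h8 : w t = 0 := by simpa using h7
  have h9 : -k t ≤ w t := le_max_left _ _
  simp only [ContinuousMap.zero_apply]
  linarith

theorem isNormalFamily (he : e.IsOne) : IsNormalFamily (Set.range J.eval) where
  add_mem := by
    rintro _ ⟨f, rfl⟩ _ ⟨g, rfl⟩
    refine ⟨f + g, LinearMap.ext fun k => ?_⟩
    simp [eval_apply]
  mul_mem := by
    rintro _ ⟨f, rfl⟩ k
    refine ⟨Bidual.act (J.toFun k) f, LinearMap.ext fun l => ?_⟩
    rw [LinearMap.comp_apply, LinearMap.mulRight_apply, eval_apply, eval_apply, J.map_mul',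
      Bidual.mul_apply]
  nonneg_of k hk := J.nonneg_of_eval he fun φ => hk _ ⟨_, rfl⟩ fun _ => J.eval_nonneg he φ
  compact C U hU := by
    obtain ⟨F, hF⟩ := Bidual.exists_limit U J.toFun (C := |J.bound| * C) (by
      filter_upwards [hU] with k hk
      exact (J.norm_le k).trans (mul_le_mul (le_abs_self _) hk (norm_nonneg _) (abs_nonneg _)))
    obtain ⟨k₀, rfl⟩ := J.surj F (Bidual.mem_center_of_tendsto he J.mem_center hF)
      (Bidual.star_eq_of_tendsto J.star_toFun hF)
    have hlim : ∀ f, Tendsto (J.eval f) (U : Filter C(K, ℝ)) (𝓝 (J.eval f k₀)) := fun f =>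
      (Complex.continuous_re.tendsto _).comp (hF f)
    refine ⟨k₀, ?_, by rintro _ ⟨f, rfl⟩; exact hlim f⟩
    obtain ⟨k₁, hk₁⟩ := hU.exists
    have hC : 0 ≤ C := (norm_nonneg _).trans hk₁
    -- The norms of the model and of `A**` are comparable only up to a constant, so the sharp bound
    -- `C` is recovered from the order.
    have h1 : 0 ≤ C • 1 - k₀ := J.nonneg_of_eval he fun φ => by
      rw [_root_.map_sub, sub_nonneg]
      refine le_of_tendsto (hlim _) ?_
      filter_upwards [hU] with k hk
      rw [← sub_nonneg, ← _root_.map_sub]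
      refine J.eval_nonneg he φ <| ContinuousMap.le_def.mpr fun t => ?_
      have := (le_abs_self _).trans ((k.norm_coe_le_norm t).trans hk)
      simpa using this
    have h2 : 0 ≤ C • 1 + k₀ := J.nonneg_of_eval he fun φ => by
      rw [_root_.map_add, ← neg_le_iff_add_nonneg']
      refine ge_of_tendsto (hlim _) ?_
      filter_upwards [hU] with k hk
      rw [neg_le_iff_add_nonneg', ← _root_.map_add]
      refine J.eval_nonneg he φ <| ContinuousMap.le_def.mpr fun t => ?_
      have := (neg_le_abs _).trans ((k.norm_coe_le_norm t).trans hk)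
      simp only [ContinuousMap.zero_apply, ContinuousMap.add_apply, ContinuousMap.smul_apply,
        ContinuousMap.one_apply, smul_eq_mul, mul_one]
      linarith
    refine (ContinuousMap.norm_le _ hC).mpr fun t => ?_
    have h3 := ContinuousMap.le_def.mp h1 t
    have h4 := ContinuousMap.le_def.mp h2 t
    simp only [ContinuousMap.zero_apply, ContinuousMap.add_apply, ContinuousMap.smul_apply,
      ContinuousMap.sub_apply, ContinuousMap.one_apply, smul_eq_mul, mul_one] at h3 h4
    rw [Real.norm_eq_abs, abs_le]
    constructor <;> linarith

theorem exists_aut (he : e.IsOne) (θ : A ≃⋆ₐ[ℂ] A) :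
    ∃ a : C(K, ℝ) →ₐ[ℝ] C(K, ℝ), ∀ k, J.toFun (a k) = Bidual.map θ (J.toFun k) := by
  have h : ∀ k, ∃ l, J.toFun l = Bidual.map θ (J.toFun k) := fun k =>
    J.surj _ (Bidual.map_mem_center θ (J.mem_center k)) (by
      rw [← Bidual.map_star, J.star_toFun])
  choose a ha using h
  let a' : C(K, ℝ) →ₗ[ℝ] C(K, ℝ) :=
    { toFun := a
      map_add' := fun k l => J.inj (by rw [J.map_add', ha, ha, ha, J.map_add', _root_.map_add])
      map_smul' := fun c k => J.inj (by
        rw [RingHom.id_apply, J.map_smul', ha, ha, J.map_smul', _root_.map_smul]) }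
  exact ⟨AlgHom.ofLinearMap a'
    (J.inj ((ha 1).trans (by rw [J.map_one']; exact (he.map θ).unique he)))
    fun k l => J.inj (by
      change J.toFun (a (k * l)) = J.toFun (a k * a l)
      rw [J.map_mul', ha, ha, ha, J.map_mul', Bidual.map_mul]), ha⟩

/-- The automorphism of `C(K, ℝ)` induced by an automorphism of `A`. -/
noncomputable def aut (he : e.IsOne) (θ : A ≃⋆ₐ[ℂ] A) : C(K, ℝ) →ₐ[ℝ] C(K, ℝ) :=
  (J.exists_aut he θ).choose

theorem toFun_aut (he : e.IsOne) (θ : A ≃⋆ₐ[ℂ] A) (k : C(K, ℝ)) :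
    J.toFun (J.aut he θ k) = Bidual.map θ (J.toFun k) := (J.exists_aut he θ).choose_spec k

theorem eval_aut (he : e.IsOne) (θ : A ≃⋆ₐ[ℂ] A) (f : StrongDual ℂ A) :
    J.eval f ∘ₗ (J.aut he θ).toLinearMap = J.eval (f ∘L Bidual.autCLM θ) := by
  refine LinearMap.ext fun k => ?_
  rw [LinearMap.comp_apply, AlgHom.toLinearMap_apply, eval_apply, toFun_aut, Bidual.map_apply,
    eval_apply]

section Mean

variable {Γ : Type u} [Group Γ] (N : Subgroup Γ)

theorem aut_aut_inv (he : e.IsOne) (α : Γ →* (A ≃⋆ₐ[ℂ] A)) (g : Γ) (k : C(K, ℝ)) :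
    J.aut he (α g) (J.aut he (α g⁻¹) k) = k :=
  J.inj (by
    rw [toFun_aut, toFun_aut, map_inv]
    exact Bidual.map_map_symm (α g) _)

/-- A bounded function on `Γ/N` as a bounded function on `Γ` with values in the center. -/
noncomputable def lift {φ : Γ ⧸ N → C(K, ℝ)} (hφ : IsBddFun φ) : LInftyCenter Γ A :=
  ⟨fun h => ⟨J.toFun (φ h), J.mem_center _⟩, memℓp_infty (by
    obtain ⟨C, hC⟩ := hφ
    refine ⟨|J.bound| * C, ?_⟩
    rintro _ ⟨h, rfl⟩
    exact (J.norm_le _).trans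
      (mul_le_mul (le_abs_self _) (hC _) (norm_nonneg _) (abs_nonneg _)))⟩

/-- The expectation is applied to lifts of functions on `Γ/N`. Equivariance survives because the
projection to cosets commutes with left translation. -/
theorem exists_mean (he : e.IsOne) (α : Γ →* (A ≃⋆ₐ[ℂ] A)) (hα : IsAmenableAction α) :
    ∃ P : (Γ ⧸ N → C(K, ℝ)) → C(K, ℝ), IsEquivariantMean (fun g => J.aut he (α g)) P := by
  classical
  obtain ⟨E, hE, hEα⟩ := hα
  have hlift_add : ∀ {φ ψ : Γ ⧸ N → C(K, ℝ)} (hφ : IsBddFun φ) (hψ : IsBddFun ψ),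
      J.lift N (hφ.add hψ) = J.lift N hφ + J.lift N hψ := fun hφ hψ =>
    Subtype.ext (funext fun h => Subtype.ext (J.map_add' _ _))
  have hconst : ∀ k : C(K, ℝ), J.lift N (isBddFun_const k) =
      constCenter Γ ⟨J.toFun k, J.mem_center k⟩ := fun k => rfl
  have hpos : ∀ {φ : Γ ⧸ N → C(K, ℝ)} (hφ : IsBddFun φ), (∀ x, 0 ≤ φ x) →
      (E (J.lift N hφ) : Bidual A).IsPositive := fun hφ h =>
    hE.positive _ fun x => J.isPositive (h x)
  have hex : ∀ {φ : Γ ⧸ N → C(K, ℝ)} (hφ : IsBddFun φ),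
      ∃ k, J.toFun k = (E (J.lift N hφ) : Bidual A) := by
    intro φ hφ
    refine J.surj _ (E (J.lift N hφ)).2 ?_
    obtain ⟨C, hC⟩ := id hφ
    -- Adding the constant `C` makes the function positive; its image `G* G` is self-adjoint, hence
    -- so is the value of `E` at the original lift.
    obtain ⟨G, hG⟩ := hpos (hφ.add (isBddFun_const (C • 1))) fun x =>
      ContinuousMap.le_def.mpr fun t => by
        have := (neg_le_abs _).trans (((φ x).norm_coe_le_norm t).trans (hC x))
        simp only [ContinuousMap.zero_apply, ContinuousMap.add_apply, ContinuousMap.smul_apply,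
          ContinuousMap.one_apply, smul_eq_mul, mul_one]
        linarith
    rw [hlift_add hφ (isBddFun_const _), _root_.map_add, hconst, hE.apply_const] at hG
    have h1 : (E (J.lift N hφ) : Bidual A) = star G * G - J.toFun (C • 1) := by
      rw [← hG]; simp
    have h2 : ∀ F H : Bidual A, star (F - H) = star F - star H := fun F H =>
      universalRep_injective he (by simp only [StarHomClass.map_star, _root_.map_sub, star_sub])
    rw [h1, h2, Bidual.star_mul_of_isOne he, Bidual.star_star_eq, J.star_toFun]
  choose P hP using @hex
  let Q : (Γ ⧸ N → C(K, ℝ)) → C(K, ℝ) := fun φ => if hφ : IsBddFun φ then P hφ else 0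
  have hQ : ∀ {φ : Γ ⧸ N → C(K, ℝ)} (hφ : IsBddFun φ),
      J.toFun (Q φ) = (E (J.lift N hφ) : Bidual A) := fun {φ} hφ => by
    simp only [Q, dif_pos hφ, hP]
  refine ⟨Q, ⟨fun φ ψ hφ hψ => J.inj ?_, fun k φ hφ => J.inj ?_, fun k => J.inj ?_,
    fun φ hφ h => ?_, fun g φ hφ => J.inj ?_⟩⟩
  · rw [hQ (hφ.add hψ), hlift_add, _root_.map_add, J.map_add', hQ hφ, hQ hψ]; rfl
  · have h1 : J.lift N (hφ.mul k) =
        constCenter Γ ⟨J.toFun k, J.mem_center k⟩ * J.lift N hφ :=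
      Subtype.ext (funext fun h => Subtype.ext (J.map_mul' _ _))
    rw [hQ (hφ.mul k), h1, hE.apply_mul, J.map_mul', hQ hφ]; rfl
  · rw [hQ (isBddFun_const k), hconst, hE.apply_const]
  · refine J.nonneg_of_eval he fun ψ => ?_
    rw [eval_apply, hQ hφ]
    exact (Complex.nonneg_iff.mp ((hpos hφ h).apply_nonneg he ψ)).1
  · have hb : IsBddFun fun x : Γ ⧸ N => J.aut he (α g) (φ (g⁻¹ • x)) :=
      hφ.algHom _ fun x => g⁻¹ • x
    have h1 : J.lift N hb = actCenter α g (J.lift N hφ) :=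
      Subtype.ext (funext fun h => Subtype.ext (J.toFun_aut he _ _))
    rw [hQ hb, h1, hEα, J.toFun_aut, hQ hφ]; rfl

end Mean

end CenterModel

/-! ### Goldstine's theorem and strong⋆ approximation. -/

section Goldstine

open scoped InnerProductSpace ComplexOrder

set_option linter.unusedSectionVars false

variable {A : Type v} [NonUnitalCStarAlgebra A]

namespace Bidual

/-- The ball is invariant under phases, so a bound on real parts bounds absolute values, hence `‖F‖
* ‖g‖`. -/
theorem re_apply_le_of_forall {F : Bidual A} {g : StrongDual ℂ A} {u : ℝ}
    (h : ∀ a : A, ‖a‖ ≤ ‖F‖ → (g a).re ≤ u) : (F g).re ≤ u := by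
  have h1 : ∀ a : A, ‖a‖ ≤ ‖F‖ → ‖g a‖ ≤ u := by
    intro a ha
    by_cases h0 : g a = 0
    · simpa [h0] using h 0 (by simp)
    · have h2 := h ((starRingEnd ℂ (g a) / ‖g a‖) • a) (by
        rw [norm_smul, norm_div, RCLike.norm_conj, Complex.norm_real, norm_norm,
          div_self (norm_ne_zero_iff.mpr h0), one_mul]
        exact ha)
      rw [map_smul, smul_eq_mul, div_mul_eq_mul_div, ← Complex.normSq_eq_conj_mul_self,
        Complex.normSq_eq_norm_sq, ← Complex.ofReal_div, Complex.ofReal_re, sq,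
        mul_self_div_self] at h2
      exact h2
  rcases (norm_nonneg F).eq_or_lt with h0 | h0
  · have : F = 0 := norm_eq_zero.mp h0.symm
    subst this
    have := h 0 (by simp)
    rw [map_zero] at this
    exact this
  · have h2 : ‖g‖ ≤ u / ‖F‖ := by
      refine ContinuousLinearMap.opNorm_le_of_unit_norm
        (div_nonneg ((norm_nonneg _).trans (h1 0 (by simp))) h0.le) fun a ha => ?_
      have h2 := h1 ((‖F‖ : ℂ) • a) (by
        rw [norm_smul, ha, mul_one, Complex.norm_real, norm_norm])
      rw [map_smul, norm_smul, Complex.norm_real, norm_norm] at h2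
      rwa [le_div_iff₀' h0]
    calc (F g).re ≤ ‖F g‖ := Complex.re_le_norm _
      _ ≤ ‖F‖ * ‖g‖ := F.le_norm g
      _ ≤ ‖F‖ * (u / ‖F‖) := by gcongr
      _ = u := by field_simp

/-- A form of Goldstine's theorem: if `T : A → E` is real linear and every real functional sees
`y` as the value at `F ∈ A**` of a functional in `A*` extending `T`, then `y` is approximated by
`T a` with `‖a‖ ≤ ‖F‖`. -/
theorem exists_approx_of_functionals {E : Type*} [NormedAddCommGroup E] [NormedSpace ℂ E]
    (F : Bidual A) (T : A →ₗ[ℝ] E) (y : E)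
    (h : ∀ f : StrongDual ℂ E, ∃ g : StrongDual ℂ A, (∀ a, (f (T a)).re = (g a).re) ∧
      (f y).re = (F g).re) {ε : ℝ} (hε : 0 < ε) : ∃ a : A, ‖a‖ ≤ ‖F‖ ∧ ‖T a - y‖ < ε := by
  have hconv : Convex ℝ (T '' Metric.closedBall 0 ‖F‖) :=
    (convex_closedBall (0 : A) ‖F‖).linear_image T
  have hy : y ∈ closure (T '' Metric.closedBall 0 ‖F‖) := by
    by_contra hy
    obtain ⟨f, u, hf1, hf2⟩ := RCLike.geometric_hahn_banach_closed_point (𝕜 := ℂ)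
      hconv.closure isClosed_closure hy
    obtain ⟨g, hg1, hg2⟩ := h f
    have := re_apply_le_of_forall (F := F) (g := g) (u := u) fun a ha => by
      rw [← hg1]
      exact (hf1 _ (subset_closure ⟨a, by simpa using ha, rfl⟩)).le
    rw [← hg2] at this
    exact absurd hf2 (not_lt.mpr this)
  obtain ⟨_, ⟨a, ha, rfl⟩, h2⟩ := Metric.mem_closure_iff.mp hy ε hε
  exact ⟨a, by simpa using ha, by rwa [← dist_eq_norm, dist_comm]⟩

variable [PartialOrder A] [StarOrderedRing A]

/-- The seminorm `F ↦ φ(F* F)^{1/2}` on `A**` given by a positive functional. -/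
noncomputable def stateSeminorm (φ : A →ₚ[ℂ] ℂ) (F : Bidual A) : ℝ :=
  √((star F * F) φ.toStrongDual).re

/-- The seminorm is the length of `F Ω` in the GNS space; the triangle inequality and the bound for
left multiplication follow. -/
theorem stateSeminorm_eq (φ : A →ₚ[ℂ] ℂ) {Ω : φ.GNS}
    (h1 : ∀ a, φ.gnsNonUnitalStarAlgHom a Ω = φ.toGNS a)
    (h2 : ∀ a, ⟪Ω, φ.toGNS a⟫_ℂ = φ a) (F : Bidual A) :
    stateSeminorm φ F = ‖φ.gnsBidual F Ω‖ := by
  rw [stateSeminorm, ← φ.inner_gnsBidual h1 h2, _root_.map_mul, StarHomClass.map_star,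
    mul_apply_eq_comp, ContinuousLinearMap.star_eq_adjoint,
    ContinuousLinearMap.adjoint_inner_right, inner_self_eq_norm_sq_to_K]
  have : ((‖φ.gnsBidual F Ω‖ : ℂ) ^ 2).re = ‖φ.gnsBidual F Ω‖ ^ 2 := by
    rw [← Complex.ofReal_pow, Complex.ofReal_re]
  exact (congrArg Real.sqrt this).trans (Real.sqrt_sq (norm_nonneg _))

theorem stateSeminorm_nonneg (φ : A →ₚ[ℂ] ℂ) (F : Bidual A) : 0 ≤ stateSeminorm φ F :=
  Real.sqrt_nonneg _

theorem stateSeminorm_sq {e : Bidual A} (he : e.IsOne) (φ : A →ₚ[ℂ] ℂ) (F : Bidual A) :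
    stateSeminorm φ F ^ 2 = ((star F * F) φ.toStrongDual).re :=
  Real.sq_sqrt (Complex.nonneg_iff.mp (apply_toStrongDual_star_mul_self_nonneg he F φ)).1

theorem stateSeminorm_add_le {e : Bidual A} (he : e.IsOne) (φ : A →ₚ[ℂ] ℂ) (F G : Bidual A) :
    stateSeminorm φ (F + G) ≤ stateSeminorm φ F + stateSeminorm φ G := by
  obtain ⟨Ω, h1, h2, -⟩ := φ.exists_cyclic_vector he
  simp only [stateSeminorm_eq φ h1 h2, _root_.map_add]
  exact norm_add_le _ _

theorem stateSeminorm_sub_le {e : Bidual A} (he : e.IsOne) (φ : A →ₚ[ℂ] ℂ) (F G : Bidual A) :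
    stateSeminorm φ (F - G) ≤ stateSeminorm φ F + stateSeminorm φ G := by
  obtain ⟨Ω, h1, h2, -⟩ := φ.exists_cyclic_vector he
  simp only [stateSeminorm_eq φ h1 h2, _root_.map_sub]
  exact norm_sub_le _ _

theorem stateSeminorm_sum_le {e : Bidual A} (he : e.IsOne) (φ : A →ₚ[ℂ] ℂ) {ι : Type*}
    (s : Finset ι) (F : ι → Bidual A) :
    stateSeminorm φ (∑ i ∈ s, F i) ≤ ∑ i ∈ s, stateSeminorm φ (F i) := by
  obtain ⟨Ω, h1, h2, -⟩ := φ.exists_cyclic_vector he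
  simp only [stateSeminorm_eq φ h1 h2, _root_.map_sum, sum_apply]
  exact norm_sum_le _ _

theorem stateSeminorm_mul_le {e : Bidual A} (he : e.IsOne) (φ : A →ₚ[ℂ] ℂ) (F G : Bidual A) :
    stateSeminorm φ (F * G) ≤ ‖F‖ * stateSeminorm φ G := by
  obtain ⟨Ω, h1, h2, -⟩ := φ.exists_cyclic_vector he
  simp only [stateSeminorm_eq φ h1 h2, _root_.map_mul, mul_apply_eq_comp]
  exact (ContinuousLinearMap.le_opNorm _ _).trans
    (mul_le_mul_of_nonneg_right (norm_bidualRep_le _ F) (norm_nonneg _))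

theorem stateSeminorm_mono {e : Bidual A} (he : e.IsOne) {φ ψ θ : A →ₚ[ℂ] ℂ}
    (h : ∀ a, θ a = φ a + ψ a) (F : Bidual A) : stateSeminorm φ F ≤ stateSeminorm θ F := by
  refine Real.sqrt_le_sqrt ?_
  have h1 : θ.toStrongDual = φ.toStrongDual + ψ.toStrongDual := by
    ext a
    simp [PositiveLinearMap.toStrongDual_apply, h]
  have h2 := (Complex.nonneg_iff.mp (apply_toStrongDual_star_mul_self_nonneg he F ψ)).1
  rw [h1, _root_.map_add, Complex.add_re]
  linarith

theorem of_star (a : A) : of (star a) = star (of a) := by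
  ext f
  simp [of_apply, star_apply, dualStar_apply]

theorem of_mul (a b : A) : of (a * b) = of a * of b := by
  ext f
  rw [mul_apply, of_apply, of_apply, act_apply, of_apply]
  rfl

theorem of_sub (a b : A) : of (a - b) = of a - of b := by
  ext f
  simp [of_apply, sub_apply]

theorem of_add (a b : A) : of (a + b) = of a + of b := by
  ext f
  simp [of_apply]

theorem of_sum {ι : Type*} (s : Finset ι) (a : ι → A) : of (∑ i ∈ s, a i) = ∑ i ∈ s, of (a i) :=
  map_sum (AddMonoidHom.mk' of of_add) a s

theorem norm_of_le (a : A) : ‖of a‖ ≤ ‖a‖ :=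
  norm_le_of_forall (norm_nonneg a) fun f => by
    rw [of_apply, mul_comm]
    exact f.le_opNorm a

theorem map_of (θ : A ≃⋆ₐ[ℂ] A) (a : A) : map θ (of a) = of (θ a) := by
  ext f
  rw [map_apply, of_apply, of_apply]
  rfl

theorem stateSeminorm_of_sq {e : Bidual A} (he : e.IsOne) (φ : A →ₚ[ℂ] ℂ) (a : A) :
    stateSeminorm φ (of a) ^ 2 = (φ (star a * a)).re := by
  rw [stateSeminorm_sq he, ← of_star, ← of_mul, of_apply]
  rfl

end Bidual

namespace PositiveLinearMap

variable [PartialOrder A] [StarOrderedRing A]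

/-- The functional `b ↦ φ (a* b a)`. -/
noncomputable def conjugate (φ : A →ₚ[ℂ] ℂ) (a : A) : A →ₚ[ℂ] ℂ :=
  PositiveLinearMap.mk₀
    { toFun := fun b => φ (star a * b * a)
      map_add' := fun b c => by rw [mul_add, add_mul, map_add]
      map_smul' := fun c b => by
        rw [mul_smul_comm, smul_mul_assoc, map_smul]; rfl } fun b hb =>
    φ.map_nonneg (star_left_conjugate_nonneg hb a)

theorem conjugate_apply (φ : A →ₚ[ℂ] ℂ) (a b : A) : φ.conjugate a b = φ (star a * b * a) := rfl

/-- The functional `φ ∘ θ`. -/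
noncomputable def compAut (φ : A →ₚ[ℂ] ℂ) (θ : A ≃⋆ₐ[ℂ] A) : A →ₚ[ℂ] ℂ :=
  PositiveLinearMap.mk₀
    { toFun := fun b => φ (θ b)
      map_add' := fun b c => by rw [map_add, map_add]
      map_smul' := fun c b => by rw [map_smul, map_smul]; rfl } fun b hb => by
    obtain ⟨c, rfl⟩ := CStarAlgebra.nonneg_iff_eq_star_mul_self.mp hb
    change 0 ≤ φ (θ (star c * c))
    rw [map_mul, map_star]
    exact φ.map_nonneg (star_mul_self_nonneg _)

/-- A finite sum of positive functionals. -/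
theorem exists_sum {ι : Type*} (s : Finset ι) (φ : ι → (A →ₚ[ℂ] ℂ)) :
    ∃ θ : A →ₚ[ℂ] ℂ, ∀ a, θ a = ∑ i ∈ s, φ i a :=
  ⟨PositiveLinearMap.mk₀ (∑ i ∈ s, (φ i).toLinearMap) fun a ha => by
    rw [LinearMap.sum_apply]
    exact Finset.sum_nonneg fun i _ => (φ i).map_nonneg ha, fun a => by
    change (∑ i ∈ s, (φ i).toLinearMap) a = _
    rw [LinearMap.sum_apply]; rfl⟩

/-- A positive functional dominating finitely many given ones. -/
theorem exists_dominating {ι : Type*} (s : Finset ι) (φ : ι → (A →ₚ[ℂ] ℂ)) :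
    ∃ θ : A →ₚ[ℂ] ℂ, ∀ i ∈ s, ∃ ψ : A →ₚ[ℂ] ℂ, ∀ a, θ a = φ i a + ψ a := by
  classical
  obtain ⟨θ, hθ⟩ := exists_sum s φ
  refine ⟨θ, fun i hi => ?_⟩
  obtain ⟨ψ, hψ⟩ := exists_sum (s.erase i) φ
  exact ⟨ψ, fun a => by rw [hθ, hψ, Finset.add_sum_erase s (fun i => φ i a) hi]⟩

end PositiveLinearMap

namespace Bidual

variable [PartialOrder A] [StarOrderedRing A]

theorem stateSeminorm_mul_of {e : Bidual A} (he : e.IsOne) (φ : A →ₚ[ℂ] ℂ) (F : Bidual A)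
    (a : A) : stateSeminorm φ (F * of a) = stateSeminorm (φ.conjugate a) F := by
  rw [stateSeminorm, stateSeminorm, star_mul_of_isOne he, ← of_star]
  congr 2
  have : of (star a) * star F * (F * of a) = of (star a) * ((star F * F) * of a) := by
    simp only [mul_assoc]
  rw [this, mul_apply, of_apply, act_apply, mul_apply]
  congr 1
  ext b
  simp [act_apply, of_apply, PositiveLinearMap.toStrongDual_apply,
    PositiveLinearMap.conjugate_apply, mul_assoc]

theorem stateSeminorm_map (φ : A →ₚ[ℂ] ℂ) (θ : A ≃⋆ₐ[ℂ] A) (F : Bidual A) :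
    stateSeminorm φ (map θ F) = stateSeminorm (φ.compAut θ) F := by
  rw [stateSeminorm, stateSeminorm, ← map_star, ← map_mul, map_apply]
  rfl

/-- Bounded strong⋆ approximation of elements of `A**` by elements of `A`. -/
theorem exists_approx {e : Bidual A} (he : e.IsOne) (θ : A →ₚ[ℂ] ℂ) (F : Bidual A) {ε : ℝ}
    (hε : 0 < ε) : ∃ a : A, ‖a‖ ≤ ‖F‖ ∧ stateSeminorm θ (of a - F) < ε ∧
      stateSeminorm θ (star (of a) - star F) < ε := by
  obtain ⟨Ω, h1, h2, -⟩ := θ.exists_cyclic_vector he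
  -- Recording `a Ω` and `a* Ω` together controls an element and its adjoint at once. The involution
  -- makes this map only real linear, and real parts of functionals suffice.
  let T : A →ₗ[ℝ] θ.GNS × θ.GNS :=
    { toFun := fun a => (θ.gnsNonUnitalStarAlgHom a Ω, θ.gnsNonUnitalStarAlgHom (star a) Ω)
      map_add' := fun a b => by simp
      map_smul' := fun c a => by
        have : ∀ b : A, θ.gnsNonUnitalStarAlgHom (c • b) = c • θ.gnsNonUnitalStarAlgHom b :=
          fun b => by
            rw [← Complex.coe_smul, map_smul, Complex.coe_smul]
        simp [this] }
  obtain ⟨a, ha, hlt⟩ := exists_approx_of_functionals F T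
    (θ.gnsBidual F Ω, θ.gnsBidual (star F) Ω) (fun f => by
      obtain ⟨x, hx⟩ := (InnerProductSpace.toDual ℂ θ.GNS).surjective
        (f ∘L ContinuousLinearMap.inl ℂ _ _)
      obtain ⟨y, hy⟩ := (InnerProductSpace.toDual ℂ θ.GNS).surjective
        (f ∘L ContinuousLinearMap.inr ℂ _ _)
      have hf : ∀ v w, f (v, w) = ⟪x, v⟫_ℂ + ⟪y, w⟫_ℂ := fun v w => by
        rw [← InnerProductSpace.toDual_apply_apply, ← InnerProductSpace.toDual_apply_apply, hx, hy]
        simp [← map_add]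
      refine ⟨coeffFunctional θ.gnsNonUnitalStarAlgHom x Ω +
        coeffFunctional θ.gnsNonUnitalStarAlgHom Ω y, fun a => ?_, ?_⟩
      · change (f (_, _)).re = _
        rw [hf, _root_.add_apply, Complex.add_re, Complex.add_re, coeffFunctional_apply,
          coeffFunctional_apply, StarHomClass.map_star, ContinuousLinearMap.star_eq_adjoint,
          ContinuousLinearMap.adjoint_inner_right]
        exact congrArg _ (inner_re_symm (𝕜 := ℂ) _ _)
      · rw [hf, _root_.map_add, Complex.add_re, Complex.add_re, ← inner_bidualRep,
          ← inner_bidualRep, StarHomClass.map_star, ContinuousLinearMap.star_eq_adjoint,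
          ContinuousLinearMap.adjoint_inner_right]
        exact congrArg _ (inner_re_symm (𝕜 := ℂ) _ _)) hε
  refine ⟨a, ha, ?_, ?_⟩
  · rw [stateSeminorm_eq θ h1 h2, _root_.map_sub, θ.gnsBidual_of]
    exact (norm_fst_le _).trans_lt hlt
  · rw [stateSeminorm_eq θ h1 h2, _root_.map_sub, ← of_star, θ.gnsBidual_of]
    exact (norm_snd_le _).trans_lt hlt

end Bidual

end Goldstine

/-! ### Approximating central partitions of unity inside `A`. -/

section ApproxPartition

open scoped ComplexOrder

set_option linter.unusedSectionVars false

variable {A : Type v} [NonUnitalCStarAlgebra A] [PartialOrder A] [StarOrderedRing A]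

/-- The bounded transform `t ↦ t / (1 + |t|)` of a positive element. -/
theorem exists_bounded_transform {T : A} (hT : 0 ≤ T) :
    ∃ k : A, star k = k ∧ k * T = T * k ∧ T - T * k = k ∧ ‖k‖ ≤ 1 ∧
      ‖4 • (k - k * k)‖ ≤ 1 := by
  have hc : Continuous fun t : ℝ => t / (1 + |t|) :=
    continuous_id.div (by fun_prop) fun t => by positivity
  have h0 : (fun t : ℝ => t / (1 + |t|)) 0 = 0 := by simp
  have hsa : IsSelfAdjoint T := hT.isSelfAdjoint
  have hid : cfcₙ (fun t : ℝ => t) T = T := cfcₙ_id' ℝ T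
  refine ⟨cfcₙ (fun t : ℝ => t / (1 + |t|)) T, IsSelfAdjoint.cfcₙ, ?_, ?_, ?_, ?_⟩
  · have := cfcₙ_commute_cfcₙ (fun t : ℝ => t / (1 + |t|)) (fun t => t) T
    rw [hid] at this
    exact this.eq
  · have h1 : cfcₙ (fun t : ℝ => t * (t / (1 + |t|))) T =
        T * cfcₙ (fun t : ℝ => t / (1 + |t|)) T := by
      rw [cfcₙ_mul (fun t : ℝ => t) _ T continuousOn_id rfl hc.continuousOn h0, hid]
    rw [← h1]
    nth_rewrite 1 [← hid]
    rw [← cfcₙ_sub (fun t : ℝ => t) (fun t => t * (t / (1 + |t|))) T continuousOn_id rfl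
      (continuous_id.mul hc).continuousOn (by simp)]
    refine cfcₙ_congr fun t ht => ?_
    have ht0 : 0 ≤ t := quasispectrum_nonneg_of_nonneg T hT t ht
    simp only [abs_of_nonneg ht0]
    field_simp
    ring
  · refine norm_cfcₙ_le fun t _ => ?_
    rw [norm_div, Real.norm_eq_abs, Real.norm_eq_abs, abs_of_nonneg (by positivity : 0 ≤ 1 + |t|),
      div_le_one (by positivity)]
    linarith
  · have h1 : 4 • (cfcₙ (fun t : ℝ => t / (1 + |t|)) T - cfcₙ (fun t : ℝ => t / (1 + |t|)) T *
        cfcₙ (fun t : ℝ => t / (1 + |t|)) T) =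
        cfcₙ (fun t : ℝ => (4 : ℝ) * (t / (1 + |t|) - t / (1 + |t|) * (t / (1 + |t|)))) T := by
      rw [cfcₙ_const_mul (4 : ℝ) (fun t => t / (1 + |t|) - t / (1 + |t|) * (t / (1 + |t|))) T
          (hc.sub (hc.mul hc)).continuousOn (by simp),
        cfcₙ_sub _ (fun t : ℝ => t / (1 + |t|) * (t / (1 + |t|))) T hc.continuousOn h0
          (hc.mul hc).continuousOn (by simp),
        cfcₙ_mul _ _ T hc.continuousOn h0 hc.continuousOn h0, ← Nat.cast_smul_eq_nsmul ℝ,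
        Nat.cast_ofNat]
    rw [h1]
    refine norm_cfcₙ_le fun t ht => ?_
    have ht0 : 0 ≤ t := quasispectrum_nonneg_of_nonneg T hT t ht
    rw [abs_of_nonneg ht0, Real.norm_eq_abs, abs_le]
    have h2 : 0 ≤ t / (1 + t) := by positivity
    have h3 : t / (1 + t) ≤ 1 := (div_le_one (by positivity)).mpr (by linarith)
    constructor <;> nlinarith [sq_nonneg (1 - 2 * (t / (1 + t)))]

namespace Bidual

/-- Central self-adjoint elements whose squares sum up to the unit of `A**` are approximated by
elements of `A` whose squares sum up to a contraction. -/
theorem exists_approx_partition {e : Bidual A} (he : e.IsOne) (θ : A →ₚ[ℂ] ℂ) {ι : Type*}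
    (s : Finset ι) (X : ι → Bidual A) (hX : ∀ i, star (X i) = X i)
    (hXc : ∀ i F, X i * F = F * X i) (hXs : ∑ i ∈ s, X i * X i = e)
    (hX0 : ∀ i ∉ s, X i = 0) {δ : ℝ} (hδ : 0 < δ) :
    ∃ ζ : ι → A, (∀ i, X i = 0 → ζ i = 0) ∧ ‖∑ i ∈ s, star (ζ i) * ζ i‖ ≤ 1 ∧
      (∀ i, stateSeminorm θ (of (ζ i) - X i) ≤ δ) ∧
      ∃ r, star r = r ∧ e - of (∑ i ∈ s, star (ζ i) * ζ i) = r * r ∧ stateSeminorm θ r ≤ δ := by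
  set C := ∑ j ∈ s, ‖X j‖ with hC
  have hC0 : 0 ≤ C := Finset.sum_nonneg fun _ _ => norm_nonneg _
  set W := (‖e‖ + 1) * ((s.card : ℝ) * (C + C)) with hW
  have hW0 : 0 ≤ W := by positivity
  -- `W * η` will bound the seminorm of `r`, and `η + C * (W * η)` that of each `ζ i - X i`.
  obtain ⟨η, hη0, hη1, hη2⟩ : ∃ η : ℝ, 0 < η ∧ W * η ≤ δ ∧ η + C * (W * η) ≤ δ := by
    refine ⟨δ / (1 + W + C * W), by positivity, ?_, ?_⟩
    · rw [mul_div_assoc', div_le_iff₀ (by positivity)]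
      nlinarith [mul_nonneg hC0 hW0]
    · have : δ / (1 + W + C * W) * (1 + W + C * W) = δ := by field_simp
      nlinarith [mul_nonneg hC0 hW0, div_pos hδ (by positivity : 0 < 1 + W + C * W)]
  choose a ha1 ha2 ha3 using fun i => exists_approx he θ (X i) hη0
  set T : A := ∑ i ∈ s, star (a i) * a i with hTdef
  have hT : 0 ≤ T := Finset.sum_nonneg fun i _ => star_mul_self_nonneg _
  have hle : ∀ i, ‖X i‖ ≤ C := fun i => by
    by_cases hi : i ∈ s
    · exact Finset.single_le_sum (f := fun j => ‖X j‖) (fun _ _ => norm_nonneg _) hi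
    · rw [hX0 i hi, norm_zero]
      exact hC0
  have hTe : stateSeminorm θ (of T - e) ≤ s.card * (C + C) * η := by
    -- Centrality of `X i` lets both small factors stand on the right, next to the cyclic vector;
    -- the second is the reason for approximating adjoints as well.
    have h1 : of T - e = ∑ i ∈ s, (star (of (a i)) * (of (a i) - X i) +
        X i * (star (of (a i)) - star (X i))) := by
      rw [hTdef, of_sum, ← hXs, ← Finset.sum_sub_distrib]
      refine Finset.sum_congr rfl fun i _ => ?_
      rw [of_mul, of_star, hX, mul_sub, mul_sub, hXc i (star (of (a i)))]
      abel
    rw [h1]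
    refine (stateSeminorm_sum_le he θ s _).trans ?_
    rw [mul_assoc, ← nsmul_eq_mul]
    refine Finset.sum_le_card_nsmul _ _ _ fun i hi => ?_
    have h2 := stateSeminorm_mul_le he θ (star (of (a i))) (of (a i) - X i)
    have h3 := stateSeminorm_mul_le he θ (X i) (star (of (a i)) - star (X i))
    have h4 : ‖star (of (a i))‖ ≤ C := by
      rw [← of_star]
      exact (norm_of_le _).trans ((norm_star (a i)).trans_le ((ha1 i).trans (hle i)))
    calc _ ≤ _ := stateSeminorm_add_le he θ _ _
      _ ≤ C * η + C * η := add_le_add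
        (h2.trans (mul_le_mul h4 (ha2 i).le (stateSeminorm_nonneg _ _) hC0))
        (h3.trans (mul_le_mul (hle i) (ha3 i).le (stateSeminorm_nonneg _ _) hC0))
      _ = _ := by ring
  obtain ⟨k, hk1, hk2, hk3, hk4, hk5⟩ := exists_bounded_transform hT
  -- The corrected vector is `2 a_i (1 - k)` with `k = T / (1 + T)`. Its squares sum to `4 (1 - k) T
  -- (1 - k) = 4 (k - k²)`, a contraction.
  have hsum : ∑ i ∈ s, star (a i + a i - (a i * k + a i * k)) *
      (a i + a i - (a i * k + a i * k)) = 4 • (k - k * k) := by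
    have h1 : ∀ i, star (a i + a i - (a i * k + a i * k)) * (a i + a i - (a i * k + a i * k)) =
        4 • (star (a i) * a i - star (a i) * a i * k - k * (star (a i) * a i) +
          k * (star (a i) * a i) * k) := fun i => by
      simp only [star_add, star_sub, star_mul, hk1]
      noncomm_ring
    simp only [h1]
    rw [← Finset.smul_sum, Finset.sum_add_distrib, Finset.sum_sub_distrib, Finset.sum_sub_distrib,
      ← Finset.sum_mul, ← Finset.mul_sum, ← Finset.sum_mul, ← Finset.mul_sum, ← hTdef]
    congr 1
    have h2 : k * T - k * T * k = k * k := by rw [mul_assoc, ← mul_sub, hk3]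
    rw [hk3, ← h2]
    abel
  -- The deficit `1 - 4 (k - k²)` is exactly `(2 k - 1)²`. The factorization `2 k - 1 = (1 - k)(T -
  -- 1)` makes its root as small as `T - 1`.
  set r : Bidual A := of k + of k - e with hr
  have hkT : of k * of T = of T * of k := by rw [← of_mul, hk2, of_mul]
  have hk3' : of T - of T * of k = of k := by rw [← of_mul, ← of_sub, hk3]
  have hr2 : r = (e - of k) * (of T - e) := by
    rw [sub_mul, mul_sub, mul_sub, (he _).1, (he e).1, (he _).2, hkT, hr]
    nth_rewrite 1 [← hk3']
    abel
  have hpr : stateSeminorm θ r ≤ W * η := by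
    rw [hr2]
    refine (stateSeminorm_mul_le he θ _ _).trans ?_
    have h1 : ‖e - of k‖ ≤ ‖e‖ + 1 :=
      (norm_sub_le _ _).trans (by linarith [(norm_of_le k).trans hk4])
    calc _ ≤ (‖e‖ + 1) * (s.card * (C + C) * η) :=
          mul_le_mul h1 hTe (stateSeminorm_nonneg _ _) (by positivity)
      _ = _ := by rw [hW]; ring
  refine ⟨fun i => a i + a i - (a i * k + a i * k), fun i hi => ?_, ?_, fun i => ?_,
    r, ?_, ?_, hpr.trans hη1⟩
  · have h1 : a i = 0 := by simpa [hi] using ha1 i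
    simp [h1]
  · rw [hsum]
    exact hk5
  · have h1 : of (a i + a i - (a i * k + a i * k)) - X i = (of (a i) - X i) - of (a i) * r := by
      rw [of_sub, of_add, of_add, of_mul, hr, mul_sub, mul_add, (he _).2]
      abel
    rw [h1]
    refine (stateSeminorm_sub_le he θ _ _).trans (le_trans (add_le_add (ha2 i).le ?_) hη2)
    exact (stateSeminorm_mul_le he θ _ _).trans (mul_le_mul
      ((norm_of_le _).trans ((ha1 i).trans (hle i))) hpr (stateSeminorm_nonneg _ _) hC0)
  · have h1 : star e = e := universalRep_injective he (by
      rw [StarHomClass.map_star, universalRep_isOne he, star_one])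
    have h2 : star (of k + of k - e) = star (of k) + star (of k) - star e := by
      ext f
      simp [star_apply, sub_apply]
    rw [hr, h2, ← of_star, hk1, h1]
  · rw [hsum, hr]
    have h1 : of (4 • (k - k * k)) = 4 • (of k - of k * of k) := by
      rw [← of_mul, ← of_sub]
      exact map_nsmul (AddMonoidHom.mk' of of_add) 4 _
    rw [h1]
    simp only [sub_mul, mul_sub, add_mul, mul_add, (he _).1, (he _).2]
    abel

end Bidual

end ApproxPartition

/-! ### Finitely supported vectors with small defects at one functional. -/

section FiniteVectors

open scoped ComplexOrder

set_option linter.unusedSectionVars false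

variable {Γ : Type u} [Group Γ] {A : Type v} [NonUnitalCStarAlgebra A] {G : Type*}
  [MulAction Γ G]

/-- The inner square `∑ ζ(x)* ζ(x)` of a finitely supported vector. -/
noncomputable def finsuppSq (ζ : G →₀ A) : A := ζ.sum fun _ a => star a * a

theorem finsuppSq_eq {ζ : G →₀ A} {s : Finset G} (h : ζ.support ⊆ s) :
    finsuppSq ζ = ∑ x ∈ s, star (ζ x) * ζ x :=
  Finsupp.sum_of_support_subset _ h _ fun _ _ => by simp

/-- The commutator `b ζ - ζ b`. -/
noncomputable def finsuppComm (b : A) (ζ : G →₀ A) : G →₀ A :=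
  ζ.mapRange (fun a => b * a - a * b) (by simp)

theorem finsuppComm_apply (b : A) (ζ : G →₀ A) (x : G) :
    finsuppComm b ζ x = b * ζ x - ζ x * b := rfl

theorem support_finsuppComm (b : A) (ζ : G →₀ A) : (finsuppComm b ζ).support ⊆ ζ.support :=
  Finsupp.support_mapRange

/-- The displacement `g · ζ - ζ`. -/
noncomputable def finsuppDispl (α : Γ →* (A ≃⋆ₐ[ℂ] A)) (g : Γ) (ζ : G →₀ A) : G →₀ A :=
  (ζ.equivMapDomain (MulAction.toPerm g)).mapRange (α g) (map_zero _) - ζ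

theorem finsuppDispl_apply (α : Γ →* (A ≃⋆ₐ[ℂ] A)) (g : Γ) (ζ : G →₀ A) (x : G) :
    finsuppDispl α g ζ x = α g (ζ (g⁻¹ • x)) - ζ x := rfl

theorem support_finsuppDispl [DecidableEq G] (α : Γ →* (A ≃⋆ₐ[ℂ] A)) (g : Γ) (ζ : G →₀ A) :
    (finsuppDispl α g ζ).support ⊆ ζ.support ∪ ζ.support.image (g • ·) := by
  intro x hx
  rw [Finsupp.mem_support_iff, finsuppDispl_apply] at hx
  rw [Finset.mem_union, Finset.mem_image]
  by_contra! h
  refine hx ?_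
  rw [Finsupp.notMem_support_iff.mp h.1, Finsupp.notMem_support_iff.mp
    fun h' => h.2 _ h' (smul_inv_smul g x), map_zero, sub_zero]

variable [PartialOrder A] [StarOrderedRing A]

theorem re_apply_finsuppSq {e : Bidual A} (he : e.IsOne) (ω : A →ₚ[ℂ] ℂ) {ζ : G →₀ A}
    {s : Finset G} (h : ζ.support ⊆ s) :
    (ω (finsuppSq ζ)).re = ∑ x ∈ s, Bidual.stateSeminorm ω (Bidual.of (ζ x)) ^ 2 := by
  rw [finsuppSq_eq h, map_sum, Complex.re_sum]
  exact Finset.sum_congr rfl fun x _ => (Bidual.stateSeminorm_of_sq he ω _).symm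

theorem sub_mul_self_le_abs {u v : ℝ} (hu : 0 ≤ u) (hv : 0 ≤ v) :
    (u - v) * (u - v) ≤ |u * u - v * v| := by
  have h1 : u * u - v * v = (u - v) * (u + v) := by ring
  rw [h1, abs_mul, ← abs_mul_abs_self (u - v)]
  refine mul_le_mul_of_nonneg_left ?_ (abs_nonneg _)
  rw [abs_of_nonneg (add_nonneg hu hv), abs_le]
  constructor <;> linarith

/-- For an amenable action, every positive functional of `A` is almost annihilated by the defects
of some finitely supported vector. -/
theorem exists_small_defects {e : Bidual A} (he : e.IsOne) {α : Γ →* (A ≃⋆ₐ[ℂ] A)}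
    (N : Subgroup Γ) (hα : IsAmenableAction α) (ω : A →ₚ[ℂ] ℂ) (F : Finset A) (S : Finset Γ)
    {δ : ℝ} (hδ : 0 < δ) :
    ∃ ζ : Γ ⧸ N →₀ A, ‖finsuppSq ζ‖ ≤ 1 ∧
      (∀ b ∈ F, (ω (star b * b - star b * finsuppSq ζ * b)).re < δ ∧
        (ω (finsuppSq (finsuppComm b ζ))).re < δ) ∧
      ∀ g ∈ S, (ω (finsuppSq (finsuppDispl α g ζ))).re < δ := by
  classical
  obtain ⟨K, _, _, _, ⟨J⟩⟩ := exists_centerModel he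
  obtain ⟨P, hP⟩ := J.exists_mean N he α hα
  obtain ⟨f, ⟨hf0, hf1⟩, hfS⟩ := hP.exists_approx_invariant (J.isNormalFamily he)
    (J.aut_aut_inv he α) (ω := J.eval ω.toStrongDual) ⟨_, rfl⟩
    (fun g => ⟨_, (J.eval_aut he (α g) _).symm⟩) (fun k hk => J.eval_nonneg he ω hk) S
    (ε := δ / 4) (by positivity)
  let ξ : Γ ⧸ N → C(K, ℝ) := fun x => ⟨fun t => √(f x t), by fun_prop⟩
  have hξ : ∀ x, ξ x * ξ x = f x := fun x =>
    ContinuousMap.ext fun t => Real.mul_self_sqrt (ContinuousMap.le_def.mp (hf0 x) t)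
  have hξ0 : ∀ x, f x = 0 → J.toFun (ξ x) = 0 := fun x hx => by
    have : ξ x = 0 := ContinuousMap.ext fun t => by
      change √(f x t) = 0
      rw [hx]
      exact Real.sqrt_zero
    rw [this, J.map_zero]
  -- Large enough to contain the support of the vector and of each displacement by an element of
  -- `S`.
  set s : Finset (Γ ⧸ N) := f.support ∪ S.biUnion fun g => f.support.image (g • ·) with hs
  have hfs : f.support ⊆ s := Finset.subset_union_left
  have hgs : ∀ g ∈ S, f.support.image (g • ·) ⊆ s := fun g hg =>
    (Finset.subset_biUnion_of_mem (fun g : Γ => f.support.image (g • ·)) hg).trans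
      Finset.subset_union_right
  -- Approximating in the seminorm of one functional dominating `ω`, the `ω (b* · b)` and the `ω ∘ α
  -- g` controls right multiplication by `b` and application of `α g`.
  let φ : Option (A ⊕ Γ) → (A →ₚ[ℂ] ℂ) := fun i =>
    i.elim ω (Sum.elim (fun b => ω.conjugate b) fun g => ω.compAut (α g))
  obtain ⟨θ, hθ⟩ := PositiveLinearMap.exists_dominating (Finset.insertNone (F.disjSum S)) φ
  have hdom : ∀ i ∈ Finset.insertNone (F.disjSum S), ∀ H,
      Bidual.stateSeminorm (φ i) H ≤ Bidual.stateSeminorm θ H := fun i hi H => by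
    obtain ⟨ψ, hψ⟩ := hθ i hi
    exact Bidual.stateSeminorm_mono he hψ H
  have hdom1 : ∀ H, Bidual.stateSeminorm ω H ≤ Bidual.stateSeminorm θ H := hdom none (by simp)
  have hdom2 : ∀ b ∈ F, ∀ H, Bidual.stateSeminorm ω (H * Bidual.of b) ≤
      Bidual.stateSeminorm θ H := fun b hb H =>
    (Bidual.stateSeminorm_mul_of he ω H b).trans_le
      (hdom (some (Sum.inl b)) (by simpa using hb) H)
  have hdom3 : ∀ g ∈ S, ∀ H, Bidual.stateSeminorm ω (Bidual.map (α g) H) ≤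
      Bidual.stateSeminorm θ H := fun g hg H =>
    (Bidual.stateSeminorm_map ω (α g) H).trans_le
      (hdom (some (Sum.inr g)) (by simpa using hg) H)
  set B := ∑ b ∈ F, ‖b‖ with hB
  have hB0 : 0 ≤ B := Finset.sum_nonneg fun _ _ => norm_nonneg _
  have hFB : ∀ b ∈ F, ‖b‖ ≤ B := fun b hb =>
    Finset.single_le_sum (f := fun b => ‖b‖) (fun _ _ => norm_nonneg _) hb
  obtain ⟨η, hη0, hη⟩ : ∃ η : ℝ, 0 < η ∧ 32 * (s.card + 1) * (B + 1) ^ 2 * η ^ 2 = δ := by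
    refine ⟨√(δ / (32 * (s.card + 1) * (B + 1) ^ 2)), by positivity, ?_⟩
    rw [Real.sq_sqrt (by positivity)]
    field_simp
  obtain ⟨ζ₀, hζ0, hζ1, hζ2, r, hr1, hr2, hr3⟩ := Bidual.exists_approx_partition he θ s
    (fun x => J.toFun (ξ x)) (fun x => J.star_toFun _)
    (fun x H => (NonUnitalSubalgebra.mem_center_iff.mp (J.mem_center (ξ x)) H).symm)
    (by
      simp only [← J.map_mul', hξ]
      rw [← J.map_sum, ← Finsupp.sum_of_support_subset f hfs (fun _ k => k) fun _ _ => rfl, hf1,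
        J.map_one'])
    (fun x hx => hξ0 x (Finsupp.notMem_support_iff.mp fun h => hx (hfs h))) hη0
  have hζf : ∀ x, ζ₀ x ≠ 0 → x ∈ f.support := fun x hx => by
    by_contra h
    exact hx (hζ0 x (hξ0 x (Finsupp.notMem_support_iff.mp h)))
  let ζ : Γ ⧸ N →₀ A := Finsupp.onFinset f.support ζ₀ hζf
  have hζs : ζ.support ⊆ f.support := Finsupp.support_onFinset_subset
  have hsq : finsuppSq ζ = ∑ x ∈ s, star (ζ₀ x) * ζ₀ x := finsuppSq_eq (hζs.trans hfs)
  refine ⟨ζ, hsq ▸ hζ1, fun b hb => ⟨?_, ?_⟩, fun g hg => ?_⟩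
  · have h1 : Bidual.stateSeminorm ω (r * Bidual.of b) ^ 2 =
        (ω (star b * b - star b * finsuppSq ζ * b)).re := by
      have h2 : star (r * Bidual.of b) * (r * Bidual.of b) =
          Bidual.of (star b * b - star b * finsuppSq ζ * b) := by
        have h3 : Bidual.of (star b) * r * (r * Bidual.of b) =
            Bidual.of (star b) * (r * r) * Bidual.of b := by simp only [mul_assoc]
        rw [Bidual.star_mul_of_isOne he, hr1, ← Bidual.of_star, h3, ← hr2, mul_sub, (he _).2,
          sub_mul, Bidual.of_sub, Bidual.of_mul, Bidual.of_mul, Bidual.of_mul, hsq]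
      rw [Bidual.stateSeminorm_sq he, h2, Bidual.of_apply]
      rfl
    rw [← h1, ← hη]
    have h2 := pow_le_pow_left₀ (Bidual.stateSeminorm_nonneg _ _) ((hdom2 b hb r).trans hr3) 2
    have h3 : 0 < η ^ 2 := by positivity
    have h4 : 1 < 32 * ((s.card : ℝ) + 1) * (B + 1) ^ 2 := by
      have h5 : 1 ≤ (B + 1) ^ 2 := one_le_pow₀ (by linarith)
      nlinarith [Nat.cast_nonneg (α := ℝ) s.card]
    exact h2.trans_lt (lt_mul_of_one_lt_left h3 h4)
  · rw [re_apply_finsuppSq he ω ((support_finsuppComm b ζ).trans (hζs.trans hfs)), ← hη]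
    have h1 : ∀ x, Bidual.stateSeminorm ω (Bidual.of (finsuppComm b ζ x)) ≤ (B + 1) * η := by
      intro x
      -- The central element `ξ x` commutes with `b`, so only the approximation error enters the
      -- commutator.
      have h2 : Bidual.of (finsuppComm b ζ x) =
          Bidual.of b * (Bidual.of (ζ₀ x) - J.toFun (ξ x)) -
            (Bidual.of (ζ₀ x) - J.toFun (ξ x)) * Bidual.of b := by
        rw [mul_sub, sub_mul, NonUnitalSubalgebra.mem_center_iff.mp (J.mem_center (ξ x)),
          sub_sub_sub_cancel_right, ← Bidual.of_mul, ← Bidual.of_mul, ← Bidual.of_sub]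
        rfl
      rw [h2, add_mul, one_mul]
      refine (Bidual.stateSeminorm_sub_le he ω _ _).trans (add_le_add ?_ ?_)
      · exact (Bidual.stateSeminorm_mul_le he ω _ _).trans (mul_le_mul
          ((Bidual.norm_of_le b).trans (hFB b hb)) ((hdom1 _).trans (hζ2 x))
          (Bidual.stateSeminorm_nonneg _ _) hB0)
      · exact (hdom2 b hb _).trans (hζ2 x)
    have h2 := Finset.sum_le_card_nsmul s
      (fun x => Bidual.stateSeminorm ω (Bidual.of (finsuppComm b ζ x)) ^ 2) _ fun x _ =>
      pow_le_pow_left₀ (Bidual.stateSeminorm_nonneg _ _) (h1 x) 2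
    refine h2.trans_lt ?_
    rw [nsmul_eq_mul]
    have h3 : 0 < (B + 1) ^ 2 * η ^ 2 := by positivity
    nlinarith [mul_nonneg (Nat.cast_nonneg (α := ℝ) s.card) h3.le]
  · have hsupp : (finsuppDispl α g ζ).support ⊆ s :=
      (support_finsuppDispl α g ζ).trans (Finset.union_subset (hζs.trans hfs)
        ((Finset.image_subset_image hζs).trans (hgs g hg)))
    rw [re_apply_finsuppSq he ω hsupp]
    set d := displacement (fun g => J.aut he (α g)) g f with hd
    have hds : d.support ⊆ s := by
      intro x hx
      rw [Finsupp.mem_support_iff, hd, displacement_apply] at hx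
      by_contra h
      have h1 : f x = 0 := Finsupp.notMem_support_iff.mp fun h' => h (hfs h')
      have h2 : f (g⁻¹ • x) = 0 := Finsupp.notMem_support_iff.mp fun h' =>
        h (hgs g hg (Finset.mem_image.mpr ⟨_, h', smul_inv_smul g x⟩))
      exact hx (by rw [h1, h2, map_zero, sub_zero])
    have h1 : ∀ x, Bidual.stateSeminorm ω (Bidual.of (finsuppDispl α g ζ x)) ^ 2 ≤
        8 * η ^ 2 + 2 * J.eval ω.toStrongDual |d x| := by
      intro x
      set y := g⁻¹ • x with hy
      have h2 : Bidual.of (finsuppDispl α g ζ x) =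
          Bidual.map (α g) (Bidual.of (ζ₀ y) - J.toFun (ξ y)) -
            (Bidual.of (ζ₀ x) - J.toFun (ξ x)) +
            J.toFun (J.aut he (α g) (ξ y) - ξ x) := by
        rw [J.map_sub, J.toFun_aut, _root_.map_sub, Bidual.map_of, finsuppDispl_apply,
          Bidual.of_sub]
        change Bidual.of (α g (ζ₀ y)) - Bidual.of (ζ₀ x) = _
        abel
      -- Pointwise `(u - v)² ≤ |u² - v²|` turns the `L¹` estimate for `f` into an `L²` estimate for
      -- its square roots.
      have h3 : Bidual.stateSeminorm ω (J.toFun (J.aut he (α g) (ξ y) - ξ x)) ^ 2 ≤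
          J.eval ω.toStrongDual |d x| := by
        rw [Bidual.stateSeminorm_sq he, J.star_toFun, ← J.map_mul', ← J.eval_apply, ← sub_nonneg,
          ← map_sub]
        refine J.eval_nonneg he ω (ContinuousMap.le_def.mpr fun t => ?_)
        have h5 : 0 ≤ J.aut he (α g) (ξ y) := nonneg_of_algHom _
          (ContinuousMap.le_def.mpr fun t => Real.sqrt_nonneg _)
        have h6 := sub_mul_self_le_abs (ContinuousMap.le_def.mp h5 t) (Real.sqrt_nonneg (f x t))
        have h7 : d x = J.aut he (α g) (ξ y) * J.aut he (α g) (ξ y) - ξ x * ξ x := by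
          rw [← map_mul, hξ, hξ]
          rfl
        rw [h7]
        exact sub_nonneg.mpr h6
      have h4 : Bidual.stateSeminorm ω (Bidual.of (finsuppDispl α g ζ x)) ≤
          η + η + Bidual.stateSeminorm ω (J.toFun (J.aut he (α g) (ξ y) - ξ x)) := by
        rw [h2]
        refine (Bidual.stateSeminorm_add_le he ω _ _).trans (add_le_add_left ?_ _)
        exact (Bidual.stateSeminorm_sub_le he ω _ _).trans
          (add_le_add ((hdom3 g hg _).trans (hζ2 y)) ((hdom1 _).trans (hζ2 x)))
      have h5 := pow_le_pow_left₀ (Bidual.stateSeminorm_nonneg _ _) h4 2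
      nlinarith [sq_nonneg (η + η -
        Bidual.stateSeminorm ω (J.toFun (J.aut he (α g) (ξ y) - ξ x)))]
    have h2 := Finset.sum_le_sum fun x (_ : x ∈ s) => h1 x
    rw [Finset.sum_add_distrib, Finset.sum_const, nsmul_eq_mul, ← Finset.mul_sum,
      ← Finsupp.sum_of_support_subset d hds (fun _ k => J.eval ω.toStrongDual |k|)
        fun _ _ => by simp] at h2
    refine h2.trans_lt ?_
    have h3 := hfS g hg
    have h4 : (s.card : ℝ) * (8 * η ^ 2) ≤ δ / 4 := by
      rw [← hη]
      have h5 : 1 ≤ (B + 1) ^ 2 := one_le_pow₀ (by linarith)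
      have h6 : (s.card : ℝ) * η ^ 2 * 1 ≤ (s.card + 1) * η ^ 2 * (B + 1) ^ 2 := by
        gcongr
        linarith
      linarith
    linarith

end FiniteVectors

/-! ### From one functional to the norm. -/

section SmallDefects

open scoped ComplexOrder

set_option linter.unusedSectionVars false

variable {Γ : Type u} [Group Γ] {A : Type v} [NonUnitalCStarAlgebra A]

section Linearity

variable {G : Type*} [MulAction Γ G]

theorem finsuppSq_add_of_disjoint {ζ ζ' : G →₀ A} (h : ∀ x, ζ x = 0 ∨ ζ' x = 0) (p q : ℝ) :
    finsuppSq ((p : ℂ) • ζ + (q : ℂ) • ζ') =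
      ((p ^ 2 : ℝ) : ℂ) • finsuppSq ζ + ((q ^ 2 : ℝ) : ℂ) • finsuppSq ζ' := by
  classical
  have h1 : ((p : ℂ) • ζ + (q : ℂ) • ζ').support ⊆ ζ.support ∪ ζ'.support :=
    Finsupp.support_add.trans
      (Finset.union_subset_union Finsupp.support_smul Finsupp.support_smul)
  rw [finsuppSq_eq h1, finsuppSq_eq Finset.subset_union_left,
    finsuppSq_eq (Finset.subset_union_right (s₁ := ζ.support)), Finset.smul_sum, Finset.smul_sum,
    ← Finset.sum_add_distrib]
  refine Finset.sum_congr rfl fun x _ => ?_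
  rcases h x with h0 | h0 <;>
    simp only [Finsupp.add_apply, Finsupp.smul_apply, h0, smul_zero, mul_zero, zero_add, add_zero,
      star_smul, smul_mul_smul_comm, sq, Complex.ofReal_mul, RCLike.star_def, Complex.conj_ofReal]

theorem finsuppComm_add_smul (b : A) (ζ ζ' : G →₀ A) (p q : ℂ) :
    finsuppComm b (p • ζ + q • ζ') = p • finsuppComm b ζ + q • finsuppComm b ζ' := by
  ext x
  simp only [finsuppComm_apply, Finsupp.add_apply, Finsupp.smul_apply, mul_add, add_mul,
    mul_smul_comm, smul_mul_assoc, smul_sub]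
  abel

theorem finsuppDispl_add_smul (α : Γ →* (A ≃⋆ₐ[ℂ] A)) (g : Γ) (ζ ζ' : G →₀ A) (p q : ℂ) :
    finsuppDispl α g (p • ζ + q • ζ') = p • finsuppDispl α g ζ + q • finsuppDispl α g ζ' := by
  ext x
  simp only [finsuppDispl_apply, Finsupp.add_apply, Finsupp.smul_apply, map_add, map_smul,
    smul_sub]
  abel

/-- The sum of the defects of a vector with respect to finitely many elements of the algebra and
of the group. -/
noncomputable def totalDefect (α : Γ →* (A ≃⋆ₐ[ℂ] A)) (F : Finset A) (S : Finset Γ)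
    (ζ : G →₀ A) : A :=
  ∑ b ∈ F, (star b * b - star b * finsuppSq ζ * b + finsuppSq (finsuppComm b ζ)) +
    ∑ g ∈ S, finsuppSq (finsuppDispl α g ζ)

end Linearity

section Translation

variable {N : Subgroup Γ} [N.Normal]

/-- Right translation of a vector over the group `Γ/N`. -/
noncomputable def finsuppTranslate (c : Γ ⧸ N) (ζ : Γ ⧸ N →₀ A) : Γ ⧸ N →₀ A :=
  ζ.equivMapDomain (Equiv.mulRight c)

theorem finsuppTranslate_apply (c : Γ ⧸ N) (ζ : Γ ⧸ N →₀ A) (x : Γ ⧸ N) :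
    finsuppTranslate c ζ x = ζ (x * c⁻¹) := rfl

theorem finsuppSq_translate (c : Γ ⧸ N) (ζ : Γ ⧸ N →₀ A) :
    finsuppSq (finsuppTranslate c ζ) = finsuppSq ζ := by
  rw [finsuppTranslate, Finsupp.equivMapDomain_eq_mapDomain]
  exact Finsupp.sum_mapDomain_index_inj (Equiv.mulRight c).injective

theorem finsuppComm_translate (b : A) (c : Γ ⧸ N) (ζ : Γ ⧸ N →₀ A) :
    finsuppComm b (finsuppTranslate c ζ) = finsuppTranslate c (finsuppComm b ζ) :=
  Finsupp.ext fun _ => rfl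

/-- Left and right translations commute on the group `Γ/N`; normality of `N` is what makes right
translation available. -/
theorem finsuppDispl_translate (α : Γ →* (A ≃⋆ₐ[ℂ] A)) (g : Γ) (c : Γ ⧸ N) (ζ : Γ ⧸ N →₀ A) :
    finsuppDispl α g (finsuppTranslate c ζ) = finsuppTranslate c (finsuppDispl α g ζ) := by
  ext x
  have h : (g⁻¹ • x) * c⁻¹ = g⁻¹ • (x * c⁻¹) := by
    induction x using QuotientGroup.induction_on with | H x =>
    change ((g⁻¹ : Γ) : Γ ⧸ N) * (x : Γ ⧸ N) * c⁻¹ = _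
    rw [mul_assoc]
    induction c using QuotientGroup.induction_on with | H c => rfl
  rw [finsuppDispl_apply, finsuppTranslate_apply, finsuppTranslate_apply, finsuppTranslate_apply,
    finsuppDispl_apply, h]

/-- Over an infinite quotient group the total defects of contractive vectors form a convex set. -/
theorem convex_totalDefect [Infinite (Γ ⧸ N)] [PartialOrder A] [StarOrderedRing A]
    (α : Γ →* (A ≃⋆ₐ[ℂ] A)) (F : Finset A) (S : Finset Γ) :
    Convex ℝ (totalDefect α F S '' {ζ : Γ ⧸ N →₀ A | ‖finsuppSq ζ‖ ≤ 1}) := by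
  classical
  rintro _ ⟨ζ, hζ, rfl⟩ _ ⟨ζ', hζ', rfl⟩ s t hs ht hst
  let U : (Γ ⧸ N →₀ A) → Finset (Γ ⧸ N) := fun η =>
    η.support ∪ S.biUnion fun g => η.support.image (g • ·)
  have hU : ∀ η x, η x ≠ 0 → x ∈ U η := fun η x hx =>
    Finset.mem_union_left _ (Finsupp.mem_support_iff.mpr hx)
  have hUc : ∀ η b x, finsuppComm b η x ≠ 0 → x ∈ U η := fun η b x hx =>
    Finset.mem_union_left _ (support_finsuppComm b η (Finsupp.mem_support_iff.mpr hx))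
  have hUd : ∀ g ∈ S, ∀ η x, finsuppDispl α g η x ≠ 0 → x ∈ U η := fun g hg η x hx => by
    have := support_finsuppDispl α g η (Finsupp.mem_support_iff.mpr hx)
    exact Finset.union_subset_union_right
      (Finset.subset_biUnion_of_mem (fun g : Γ => η.support.image (g • ·)) hg) this
  -- Translating by a `c` outside the finite set `U ζ'⁻¹ U ζ` separates the vectors together with
  -- all their commutators and displacements, so every inner square splits without cross terms.
  obtain ⟨c, hc⟩ := Infinite.exists_notMem_finset
    (Finset.image₂ (fun y x : Γ ⧸ N => y⁻¹ * x) (U ζ') (U ζ))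
  have hdisj : ∀ η η' : Γ ⧸ N →₀ A, (∀ x, η x ≠ 0 → x ∈ U ζ) → (∀ x, η' x ≠ 0 → x ∈ U ζ') →
      ∀ x, η x = 0 ∨ finsuppTranslate c η' x = 0 := by
    intro η η' h h' x
    by_contra! hx
    refine hc (Finset.mem_image₂.mpr ⟨_, h' _ hx.2, _, h _ hx.1, ?_⟩)
    change (x * c⁻¹)⁻¹ * x = c
    group
  have hcomb : ∀ η η' : Γ ⧸ N →₀ A, (∀ x, η x ≠ 0 → x ∈ U ζ) → (∀ x, η' x ≠ 0 → x ∈ U ζ') →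
      finsuppSq (((√s : ℝ) : ℂ) • η + ((√t : ℝ) : ℂ) • finsuppTranslate c η') =
        s • finsuppSq η + t • finsuppSq η' := by
    intro η η' h h'
    rw [finsuppSq_add_of_disjoint (hdisj η η' h h'), finsuppSq_translate, Real.sq_sqrt hs,
      Real.sq_sqrt ht, Complex.coe_smul, Complex.coe_smul]
  refine ⟨((√s : ℝ) : ℂ) • ζ + ((√t : ℝ) : ℂ) • finsuppTranslate c ζ', ?_, ?_⟩
  · have := convex_closedBall (0 : A) 1 (mem_closedBall_zero_iff.mpr hζ)
      (mem_closedBall_zero_iff.mpr hζ') hs ht hst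
    rw [← hcomb ζ ζ' (hU ζ) (hU ζ')] at this
    exact mem_closedBall_zero_iff.mp this
  · rw [totalDefect, totalDefect, totalDefect, hcomb ζ ζ' (hU ζ) (hU ζ'), smul_add, smul_add,
      Finset.smul_sum, Finset.smul_sum, Finset.smul_sum, Finset.smul_sum, add_add_add_comm,
      ← Finset.sum_add_distrib, ← Finset.sum_add_distrib]
    congr 1
    · refine Finset.sum_congr rfl fun b _ => ?_
      rw [finsuppComm_add_smul, finsuppComm_translate, hcomb _ _ (hUc ζ b) (hUc ζ' b)]
      have h1 : star b * b = s • (star b * b) + t • (star b * b) := by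
        rw [← add_smul, hst, one_smul]
      nth_rewrite 1 [h1]
      simp only [mul_add, add_mul, mul_smul_comm, smul_mul_assoc, smul_add, smul_sub]
      abel
    · refine Finset.sum_congr rfl fun g hg => ?_
      rw [finsuppDispl_add_smul, finsuppDispl_translate, hcomb _ _ (hUd g hg ζ) (hUd g hg ζ')]

end Translation

variable [PartialOrder A] [StarOrderedRing A]

theorem finsuppSq_nonneg {G : Type*} (ζ : G →₀ A) : 0 ≤ finsuppSq ζ :=
  Finset.sum_nonneg fun _ _ => star_mul_self_nonneg _

theorem sub_conjugate_nonneg {a : A} (ha : 0 ≤ a) (h1 : ‖a‖ ≤ 1) (b : A) :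
    0 ≤ star b * b - star b * a * b := by
  rw [sub_nonneg]
  refine (CStarAlgebra.star_left_conjugate_le_norm_smul ha.isSelfAdjoint).trans ?_
  calc ‖a‖ • (star b * b) ≤ (1 : ℝ) • (star b * b) :=
        smul_le_smul_of_nonneg_right h1 (star_mul_self_nonneg b)
    _ = star b * b := one_smul _ _

theorem mul_self_le_of_norm_le_one {a : A} (ha : 0 ≤ a) (h1 : ‖a‖ ≤ 1) : a * a ≤ a := by
  obtain ⟨b, rfl⟩ := CStarAlgebra.nonneg_iff_eq_star_mul_self.mp ha
  have h2 := sub_conjugate_nonneg (mul_star_self_nonneg b)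
    (by rwa [CStarRing.norm_self_mul_star, ← CStarRing.norm_star_mul_self]) b
  rw [sub_nonneg] at h2
  simpa only [mul_assoc] using h2

/-- This is `b* (1 - a)² b ≤ b* (1 - a) b`; it converts the positive defect into the normalization
estimate. -/
theorem norm_mul_sub_sq_le {a : A} (ha : 0 ≤ a) (h1 : ‖a‖ ≤ 1) (b : A) :
    ‖a * b - b‖ ^ 2 ≤ ‖star b * b - star b * a * b‖ := by
  rw [sq, ← CStarRing.norm_star_mul_self]
  refine CStarAlgebra.norm_le_norm_of_nonneg_of_le (star_mul_self_nonneg _) ?_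
  have h2 : star b * (a * a) * b ≤ star b * a * b :=
    star_left_conjugate_le_conjugate (mul_self_le_of_norm_le_one ha h1) b
  have h3 : star (a * b - b) * (a * b - b) =
      star b * b - star b * a * b - (star b * a * b - star b * (a * a) * b) := by
    rw [star_sub, star_mul, ha.isSelfAdjoint.star_eq]
    noncomm_ring
  rw [h3]
  exact sub_le_self _ (sub_nonneg.mpr h2)

/-- Otherwise Hahn–Banach separates `0` from the convex set of defects. Defects are positive, so the
positive part `φ` of the separating functional alone is already at least `u` on them, contrary to
`exists_small_defects`. -/
theorem exists_norm_totalDefect_lt {e : Bidual A} (he : e.IsOne) {α : Γ →* (A ≃⋆ₐ[ℂ] A)}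
    {N : Subgroup Γ} [N.Normal] [Infinite (Γ ⧸ N)] (hα : IsAmenableAction α) (F : Finset A)
    (S : Finset Γ) {ε : ℝ} (hε : 0 < ε) :
    ∃ ζ : Γ ⧸ N →₀ A, ‖finsuppSq ζ‖ ≤ 1 ∧ ‖totalDefect α F S ζ‖ < ε := by
  have hconv := convex_totalDefect (N := N) α F S
  set V := totalDefect α F S '' {ζ : Γ ⧸ N →₀ A | ‖finsuppSq ζ‖ ≤ 1} with hV
  suffices h0 : (0 : A) ∈ closure V by
    obtain ⟨_, ⟨ζ, hζ, rfl⟩, h⟩ := Metric.mem_closure_iff.mp h0 ε hε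
    exact ⟨ζ, hζ, by rwa [dist_zero_left] at h⟩
  by_contra h0
  obtain ⟨f, u, hf1, hf2⟩ := RCLike.geometric_hahn_banach_point_closed (𝕜 := ℂ)
    hconv.closure isClosed_closure h0
  rw [map_zero] at hf1
  replace hf1 : 0 < u := hf1
  obtain ⟨φ, ψ, hφψ, -⟩ := exists_positive_sub_positive
    (Complex.reLm ∘ₗ f.toLinearMap.restrictScalars ℝ ∘ₗ (selfAdjoint.submodule ℝ A).subtype)
    (norm_nonneg f) fun a => (Complex.re_le_norm _).trans (f.le_opNorm _)
  -- Each element of `F` contributes two terms and each element of `S` one; the extra `1` makes the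
  -- total strictly less than `u`.
  obtain ⟨ζ, hζ1, hζ2, hζ3⟩ := exists_small_defects he N hα φ F S
    (δ := u / (2 * F.card + S.card + 1)) (by positivity)
  have hnn : 0 ≤ totalDefect α F S ζ := add_nonneg
    (Finset.sum_nonneg fun b _ => add_nonneg
      (sub_conjugate_nonneg (finsuppSq_nonneg _) hζ1 b) (finsuppSq_nonneg _))
    (Finset.sum_nonneg fun g _ => finsuppSq_nonneg _)
  have h1 := hf2 _ (subset_closure ⟨ζ, hζ1, rfl⟩)
  have h2 := congrArg Complex.re (hφψ ⟨_, hnn.isSelfAdjoint⟩)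
  replace h2 : (f (totalDefect α F S ζ)).re =
    (φ (totalDefect α F S ζ)).re - (ψ (totalDefect α F S ζ)).re := h2
  have h3 := (Complex.nonneg_iff.mp (ψ.map_nonneg hnn)).1
  have h4 : (φ (totalDefect α F S ζ)).re ≤
      F.card * (u / (2 * F.card + S.card + 1) + u / (2 * F.card + S.card + 1)) +
        S.card * (u / (2 * F.card + S.card + 1)) := by
    rw [totalDefect, map_add, map_sum, map_sum, Complex.add_re, Complex.re_sum, Complex.re_sum,
      ← nsmul_eq_mul, ← nsmul_eq_mul]
    refine add_le_add (Finset.sum_le_card_nsmul _ _ _ fun b hb => ?_)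
      (Finset.sum_le_card_nsmul _ _ _ fun g hg => (hζ3 g hg).le)
    rw [map_add, Complex.add_re]
    exact add_le_add (hζ2 b hb).1.le (hζ2 b hb).2.le
  have h5 : F.card * (u / (2 * F.card + S.card + 1) + u / (2 * F.card + S.card + 1)) +
        S.card * (u / (2 * F.card + S.card + 1)) < u := by
    have : (F.card * (u / (2 * F.card + S.card + 1) + u / (2 * F.card + S.card + 1)) +
        S.card * (u / (2 * F.card + S.card + 1)) : ℝ) =
        u - u / (2 * F.card + S.card + 1) := by
      field_simp
      ring
    rw [this]
    exact sub_lt_self _ (by positivity)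
  have h6 : u < (f (totalDefect α F S ζ)).re := h1
  linarith

/-- The unit of `A**` is the weak⋆ limit of contractions, hence a contraction. -/
theorem Bidual.IsOne.norm_le_one {e : Bidual A} (he : e.IsOne) : ‖e‖ ≤ 1 := by
  have hl := CStarAlgebra.increasingApproximateUnit A
  let U := Ultrafilter.of (CStarAlgebra.approximateUnit A)
  have hU : (U : Filter A) ≤ CStarAlgebra.approximateUnit A := Ultrafilter.of_le _
  have hn : ∀ᶠ a in (U : Filter A), ‖a‖ ≤ 1 := hU hl.eventually_norm
  obtain ⟨E, hE⟩ := Bidual.exists_limit U Bidual.of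
    (hn.mono fun a ha => (Bidual.norm_of_le a).trans ha)
  have h1 : ∀ f : StrongDual ℂ A, Bidual.act E f = f := fun f => by
    ext a
    rw [Bidual.act_apply]
    refine tendsto_nhds_unique (hE _) ?_
    exact (f.continuous.tendsto a).comp ((hl.tendsto_mul_left a).mono_left hU)
  have h2 : e = E := by
    rw [← (he E).1]
    ext f
    rw [Bidual.mul_apply, h1]
  rw [h2]
  refine Bidual.norm_le_of_forall zero_le_one fun f => le_of_tendsto (hE f).norm ?_
  filter_upwards [hn] with a ha
  rw [Bidual.of_apply]
  exact (f.le_opNorm a).trans (by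
    rw [mul_comm]
    exact mul_le_mul_of_nonneg_right ha (norm_nonneg f))

theorem exists_approx_family {ι : Type*} [Fintype ι] (F : Bidual A) (T : ι → A →L[ℂ] A)
    (y : ι → A) (h : ∀ i (f : StrongDual ℂ A), F (f ∘L T i) = f (y i)) {ε : ℝ} (hε : 0 < ε) :
    ∃ a : A, ‖a‖ ≤ ‖F‖ ∧ ∀ i, ‖T i a - y i‖ < ε := by
  classical
  obtain ⟨a, ha, hlt⟩ := Bidual.exists_approx_of_functionals F
    ((ContinuousLinearMap.pi T).toLinearMap.restrictScalars ℝ) y (fun f => by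
      refine ⟨f ∘L ContinuousLinearMap.pi T, fun a => rfl, ?_⟩
      have h1 : ∀ z : ι → A, f z = ∑ i, (f ∘L ContinuousLinearMap.single ℂ (fun _ => A) i) (z i) :=
        fun z => by
          conv_lhs => rw [← Finset.univ_sum_single z]
          rw [map_sum]
          rfl
      have h2 : f ∘L ContinuousLinearMap.pi T =
          ∑ i, (f ∘L ContinuousLinearMap.single ℂ (fun _ => A) i) ∘L T i := by
        ext a
        rw [sum_apply]
        exact h1 _
      rw [h2, h1, map_sum]
      simp only [h]) hε
  exact ⟨a, ha, fun i => (norm_le_pi_norm _ i).trans_lt hlt⟩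

theorem finsuppSq_of_const {G : Type*} [Fintype G] [Nonempty G] (ζ : G →₀ A) (d : A)
    (h : ∀ x, ζ x = (((√(Fintype.card G))⁻¹ : ℝ) : ℂ) • d) : finsuppSq ζ = star d * d := by
  rw [finsuppSq_eq (Finset.subset_univ _)]
  have h1 : ∀ x, star (ζ x) * ζ x = ((Fintype.card G : ℝ)⁻¹) • (star d * d) := fun x => by
    rw [h, star_smul, smul_mul_smul_comm, RCLike.star_def, Complex.conj_ofReal,
      ← Complex.ofReal_mul, ← mul_inv, Real.mul_self_sqrt (Nat.cast_nonneg _), Complex.coe_smul]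
  rw [Finset.sum_congr rfl fun x _ => h1 x, Finset.sum_const, Finset.card_univ,
    ← Nat.cast_smul_eq_nsmul ℝ, smul_smul, mul_inv_cancel₀, one_smul]
  exact Nat.cast_ne_zero.mpr Fintype.card_ne_zero

theorem sqrt_norm_star_mul_self (d : A) : √‖star d * d‖ = ‖d‖ := by
  rw [CStarRing.norm_star_mul_self, Real.sqrt_mul_self (norm_nonneg d)]

/-- For an amenable action there are contractive finitely supported vectors that are approximately
normalized, central and invariant. -/
theorem exists_approx_central_invariant {e : Bidual A} (he : e.IsOne) {α : Γ →* (A ≃⋆ₐ[ℂ] A)}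
    (N : Subgroup Γ) [N.Normal] (hα : IsAmenableAction α) (F : Finset A)
    (S : Finset Γ) {ε : ℝ} (hε : 0 < ε) :
    ∃ ζ : Γ ⧸ N →₀ A, ‖finsuppSq ζ‖ ≤ 1 ∧
      (∀ b ∈ F, ‖finsuppSq ζ * b - b‖ < ε ∧ √‖finsuppSq (finsuppComm b ζ)‖ < ε) ∧
      ∀ g ∈ S, √‖finsuppSq (finsuppDispl α g ζ)‖ < ε := by
  classical
  rcases finite_or_infinite (Γ ⧸ N) with hfin | hinf
  · have := Fintype.ofFinite (Γ ⧸ N)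
    -- The quotient is finite, so disjoint translates are unavailable. The unit of `A**` is a
    -- two-sided unit fixed by each `θ**`; approximating these identities in norm gives a
    -- contraction `d` that is almost a unit for `F` and almost fixed by `S`.
    let T : (F ⊕ F) ⊕ (F ⊕ S) → A →L[ℂ] A := Sum.elim
      (Sum.elim (fun b => ContinuousLinearMap.mul ℂ A b)
        fun b => (ContinuousLinearMap.mul ℂ A).flip b)
      (Sum.elim (fun b => ContinuousLinearMap.mul ℂ A (star b))
        fun g => Bidual.autCLM (α g) - ContinuousLinearMap.id ℂ A)
    let y : (F ⊕ F) ⊕ (F ⊕ S) → A := Sum.elim (Sum.elim (fun b => b) fun b => b)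
      (Sum.elim (fun b => star (b : A)) fun g => 0)
    have hmul : ∀ (b : A) (f : StrongDual ℂ A), e (f ∘L ContinuousLinearMap.mul ℂ A b) = f b :=
      fun b f => by
        rw [← Bidual.act_apply, ← Bidual.of_apply b (Bidual.act e f), ← Bidual.mul_apply,
          (he _).2, Bidual.of_apply]
    obtain ⟨d, hd, hd'⟩ := exists_approx_family e T y (by
      rintro ((b | b) | (b | g)) f
      · exact hmul b f
      · have h1 : f ∘L T (Sum.inl (Sum.inr b)) = Bidual.act (Bidual.of (b : A)) f := by
          ext a
          rw [Bidual.act_apply, Bidual.of_apply]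
          rfl
        rw [h1, ← Bidual.mul_apply, (he _).1, Bidual.of_apply]
        rfl
      · exact hmul (star (b : A)) f
      · have h1 : f ∘L T (Sum.inr (Sum.inr g)) = f ∘L Bidual.autCLM (α g) - f := by
          ext a
          simp [T]
        rw [h1, map_sub, ← Bidual.map_apply, (he.map (α g)).unique he, sub_self]
        exact (map_zero f).symm) (half_pos hε)
    replace hd := hd.trans he.norm_le_one
    have hd1 : ∀ b ∈ F, ‖b * d - b‖ < ε / 2 := fun b hb => hd' (Sum.inl (Sum.inl ⟨b, hb⟩))
    have hd2 : ∀ b ∈ F, ‖d * b - b‖ < ε / 2 := fun b hb => hd' (Sum.inl (Sum.inr ⟨b, hb⟩))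
    have hd3 : ∀ b ∈ F, ‖star b * d - star b‖ < ε / 2 := fun b hb =>
      hd' (Sum.inr (Sum.inl ⟨b, hb⟩))
    have hd4 : ∀ g ∈ S, ‖α g d - d‖ < ε / 2 := fun g hg => by
      simpa [T, y, Bidual.autCLM_apply] using hd' (Sum.inr (Sum.inr ⟨g, hg⟩))
    -- The factor `1 / √|Γ/N|` makes the inner square of the constant vector equal to `d* d`.
    let ζ : Γ ⧸ N →₀ A := Finsupp.onFinset Finset.univ
      (fun _ => (((√(Fintype.card (Γ ⧸ N)))⁻¹ : ℝ) : ℂ) • d) fun _ _ => Finset.mem_univ _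
    have hζ : finsuppSq ζ = star d * d := finsuppSq_of_const ζ d fun _ => rfl
    refine ⟨ζ, ?_, fun b hb => ⟨?_, ?_⟩, fun g hg => ?_⟩
    · rw [hζ, CStarRing.norm_star_mul_self]
      exact mul_le_one₀ hd (norm_nonneg d) hd
    · have h1 : star d * d * b - b = star d * (d * b - b) + star (star b * d - star b) := by
        rw [star_sub, star_mul, star_star]
        noncomm_ring
      rw [hζ, h1]
      have h2 : ‖star d * (d * b - b)‖ ≤ 1 * ‖d * b - b‖ := (norm_mul_le _ _).trans
        (mul_le_mul_of_nonneg_right ((norm_star d).trans_le hd) (norm_nonneg _))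
      have h3 := norm_add_le (star d * (d * b - b)) (star (star b * d - star b))
      rw [norm_star] at h3
      linarith [hd2 b hb, hd3 b hb]
    · rw [finsuppSq_of_const (finsuppComm b ζ) (b * d - d * b) fun x => by
        rw [finsuppComm_apply, smul_sub, ← mul_smul_comm, ← smul_mul_assoc]
        rfl, sqrt_norm_star_mul_self]
      have h1 : b * d - d * b = (b * d - b) - (d * b - b) := by abel
      rw [h1]
      linarith [norm_sub_le (b * d - b) (d * b - b), hd1 b hb, hd2 b hb]
    · rw [finsuppSq_of_const (finsuppDispl α g ζ) (α g d - d) fun x => by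
        rw [finsuppDispl_apply, smul_sub, ← map_smul]
        rfl, sqrt_norm_star_mul_self]
      linarith [hd4 g hg]
  · obtain ⟨ζ, hζ, hD⟩ := exists_norm_totalDefect_lt (N := N) he hα F S
      (ε := ε ^ 2) (by positivity)
    have hF0 : ∀ b ∈ F, 0 ≤ star b * b - star b * finsuppSq ζ * b + finsuppSq (finsuppComm b ζ) :=
      fun b _ => add_nonneg (sub_conjugate_nonneg (finsuppSq_nonneg _) hζ b) (finsuppSq_nonneg _)
    have hS0 : ∀ g ∈ S, 0 ≤ finsuppSq (finsuppDispl α g ζ) := fun g _ => finsuppSq_nonneg _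
    -- All summands are positive, so a bound on the norm of the total defect bounds each of them.
    have hFle : ∀ b ∈ F, star b * b - star b * finsuppSq ζ * b + finsuppSq (finsuppComm b ζ) ≤
        totalDefect α F S ζ := fun b hb =>
      (Finset.single_le_sum hF0 hb).trans (le_add_of_nonneg_right (Finset.sum_nonneg hS0))
    have hlt : ∀ c : A, 0 ≤ c → c ≤ totalDefect α F S ζ → ‖c‖ < ε ^ 2 := fun c hc hc' =>
      (CStarAlgebra.norm_le_norm_of_nonneg_of_le hc hc').trans_lt hD
    refine ⟨ζ, hζ, fun b hb => ⟨?_, ?_⟩, fun g hg => ?_⟩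
    · refine lt_of_pow_lt_pow_left₀ 2 hε.le
        ((norm_mul_sub_sq_le (finsuppSq_nonneg ζ) hζ b).trans_lt (hlt _
          (sub_conjugate_nonneg (finsuppSq_nonneg ζ) hζ b) (le_trans ?_ (hFle b hb))))
      exact le_add_of_nonneg_right (finsuppSq_nonneg _)
    · rw [Real.sqrt_lt' hε]
      refine hlt _ (finsuppSq_nonneg _) (le_trans ?_ (hFle b hb))
      exact le_add_of_nonneg_left (sub_conjugate_nonneg (finsuppSq_nonneg ζ) hζ b)
    · rw [Real.sqrt_lt' hε]
      refine hlt _ (finsuppSq_nonneg _) ((Finset.single_le_sum hS0 hg).trans ?_)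
      exact le_add_of_nonneg_left (Finset.sum_nonneg hF0)

end SmallDefects

/-! ### Passage to `ℓ²(Γ/N, A)` and assembly of the net. -/

section Main

variable {A : Type v} [NonUnitalCStarAlgebra A]

/-- A finitely supported vector as an element of `ℓ²(I, A)`. -/
noncomputable def finsuppToEll2 {I : Type*} (ζ : I →₀ A) : ell2 I A :=
  ⟨ζ, summable_of_ne_finset_zero (s := ζ.support) fun x hx => by
    rw [Finsupp.notMem_support_iff.mp hx, mul_zero]⟩

theorem ell2InnerSelf_finsuppToEll2 {I : Type*} (ζ : I →₀ A) :
    ell2InnerSelf (finsuppToEll2 ζ) = finsuppSq ζ :=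
  (tsum_eq_sum fun x hx => by
    change star (ζ x) * ζ x = 0
    rw [Finsupp.notMem_support_iff.mp hx, mul_zero]).trans
      (finsuppSq_eq (Finset.Subset.refl ζ.support)).symm

theorem ell2Left_sub_ell2Right {I : Type*} (ζ : I →₀ A) (a : A) :
    ell2Left a (finsuppToEll2 ζ) - ell2Right (finsuppToEll2 ζ) a =
      finsuppToEll2 (finsuppComm a ζ) := rfl

theorem ell2Act_sub {Γ : Type u} [Group Γ] {N : Subgroup Γ} (α : Γ →* (A ≃⋆ₐ[ℂ] A)) (g : Γ)
    (ζ : Γ ⧸ N →₀ A) : ell2Act α g (finsuppToEll2 ζ) - finsuppToEll2 ζ =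
      finsuppToEll2 (finsuppDispl α g ζ) := rfl

end Main

theorem mainTheorem3 {Γ : Type u} [Group Γ] {A : Type v} [NonUnitalCStarAlgebra A]
    (α : Γ →* (A ≃⋆ₐ[ℂ] A)) (N : Subgroup Γ) [N.Normal]
    (hN : ∀ g ∈ N, UniversallyWeaklyInner (α g))
    (hα : IsAmenableAction α) :
    ∃ (ι : Type (max u v)) (_ : Preorder ι) (_ : IsDirectedOrder ι) (_ : Nonempty ι)
      (ζ : ι → ell2 (Γ ⧸ N) A),
      (∀ i, ell2Norm (ζ i) ≤ 1) ∧
      (∀ a : A, Tendsto (fun i => ell2InnerSelf (ζ i) * a) atTop (𝓝 a)) ∧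
      (∀ a : A, Tendsto (fun i => ell2Norm (ell2Left a (ζ i) - ell2Right (ζ i) a))
        atTop (𝓝 0)) ∧
      (∀ g : Γ, Tendsto (fun i => ell2Norm (ell2Act α g (ζ i) - ζ i)) atTop (𝓝 0)) := by
  classical
  let _ := CStarAlgebra.spectralOrder A
  have _ := CStarAlgebra.spectralOrderedRing A
  -- Unitarity of `u` supplies the unit `star u * u` of `A**`.
  obtain ⟨u, ⟨he, -⟩, -⟩ := hN 1 N.one_mem
  -- The net is indexed by finite subsets of `A` and of `Γ` and a precision `1 / (n + 1)`, with the
  -- product order.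
  choose ζ hζ hF hS using fun i : Finset A × Finset Γ × ℕ =>
    exists_approx_central_invariant he N hα i.1 i.2.1 (Nat.one_div_pos_of_nat (α := ℝ) (n := i.2.2))
  have hnorm : ∀ η : Γ ⧸ N →₀ A, ell2Norm (finsuppToEll2 η) = √‖finsuppSq η‖ := fun η => by
    rw [ell2Norm, ell2InnerSelf_finsuppToEll2]
  have hlim : ∀ (F : Finset A) (S : Finset Γ) (d : Finset A × Finset Γ × ℕ → ℝ),
      (∀ i, 0 ≤ d i) → (∀ i, F ⊆ i.1 → S ⊆ i.2.1 → d i < 1 / ((i.2.2 : ℝ) + 1)) →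
      Tendsto d atTop (𝓝 0) := fun F S d hd0 hd => by
    rw [Metric.tendsto_atTop]
    intro ε hε
    obtain ⟨n, hn⟩ := exists_nat_one_div_lt hε
    refine ⟨(F, S, n), fun i hi => ?_⟩
    rw [Real.dist_0_eq_abs, abs_of_nonneg (hd0 i)]
    refine (hd i hi.1 hi.2.1).trans (lt_of_le_of_lt ?_ hn)
    exact one_div_le_one_div_of_le (by positivity) (by
      have : (n : ℝ) ≤ i.2.2 := Nat.cast_le.mpr hi.2.2
      linarith)
  refine ⟨Finset A × Finset Γ × ℕ, inferInstance, inferInstance, inferInstance,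
    fun i => finsuppToEll2 (ζ i), fun i => ?_, fun a => ?_, fun a => ?_, fun g => ?_⟩
  · rw [hnorm]
    exact Real.sqrt_le_one.mpr (hζ i)
  · refine tendsto_iff_norm_sub_tendsto_zero.mpr
      (hlim {a} ∅ _ (fun _ => norm_nonneg _) fun i h _ => ?_)
    rw [ell2InnerSelf_finsuppToEll2]
    exact (hF i a (h (Finset.mem_singleton_self a))).1
  · refine hlim {a} ∅ _ (fun _ => Real.sqrt_nonneg _) fun i h _ => ?_
    rw [ell2Left_sub_ell2Right, hnorm]
    exact (hF i a (h (Finset.mem_singleton_self a))).2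
  · refine hlim ∅ {g} _ (fun _ => Real.sqrt_nonneg _) fun i _ h => ?_
    rw [ell2Act_sub, hnorm]
    exact hS i g (h (Finset.mem_singleton_self g))
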